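/- Let $G$ be a locally compact (Hausdorff) group, $\mathcal H$ a complex Hilbert space and $\pi:G\to\mathcal U(\mathcal H)$ a strongly continuous unitary representation. Let $\mathrm M(G)$ be the algebra, under convolution, of bounded regular complex Borel measures on $G$ with the total variation norm, let $\mathrm L^1(G)\subset \mathrm M(G)$ be the measures that are absolutely continuous with respect to left Haar measure, and let $\ell^1(G)\subset\mathrm M(G)$ be the measures $\sum_{s}\alpha(s)\delta_s$ with $\sum_s|\alpha(s)|<\infty$. Let $\pi_1(\mu)=\int_G\pi(s)\,d\mu(s)$ (weak* integral in $\mathcal B(\mathcal H)$) and let $\mathrm M^*_\pi$, $\mathrm C^*_\pi$, $\mathrm D^*_\pi$ be the norm closures in $\mathcal B(\mathcal H)$ of $\pi_1(\mathrm M(G))$, $\pi_1(\mathrm L^1(G))$ and $\pi_1(\ell^1(G))$. For closed subspaces $V,W\subset\mathcal B(\mathcal H)$ let $V\otimes^{eh}W$ (the extended Haagerup tensor product) be the space of series $\sum_i v_i\otimes w_i$ with $v_i\in V$, $w_i\in W$ for which $\sum_i v_iv_i^*$ and $\sum_i w_i^*w_i$ converge weak*, where two series are identified if they define the same operator $x\mapsto\sum_i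 v_ixw_i$ on $\mathcal B(\mathcal H)$; its norm is the infimum of $\|\sum_i v_iv_i^*\|^{1/2}\|\sum_i w_i^*w_i\|^{1/2}$ over all such series, and the product on $\mathcal B(\mathcal H)\otimes^{eh}\mathcal B(\mathcal H)$ is the composition of operators. Let $V\otimes^{h}W$ (the Haagerup tensor product) consist of the elements that admit a series for which $\sum_i v_iv_i^*$ and $\sum_i w_i^*w_i$ converge in norm. The weak* topology of $\mathcal B(\mathcal H)\otimes^{eh}\mathcal B(\mathcal H)$ comes from the duality with the (completed) Haagerup tensor product $\mathcal B(\mathcal H)_*\otimes^h\mathcal B(\mathcal H)_*$ of preduals, $\langle \sum_i v_i\otimes w_i,\omega\otimes\nu\rangle=\sum_i\omega(v_i)\nu(w_i)$. Then for every $\mu\in\mathrm M(G)$ there is a unique element $$\Gamma_\pi(\mu)=\int_G\pi(s)\otimes\pi(s)^*\,d\mu(s)\in\mathcal B(\mathcal H)\otimes^{eh}\mathcal B(\mathcal H),$$ the integral converging weak*: $\langle\Gamma_\pi(\mu),z\rangle=\int_G\langle\pi(s)\otimes\pi(s)^*,z\rangle\,d\mu(s)$ for each $z\in\mathcal B(\mathcal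 H)_*\otimes^h\mathcal B(\mathcal H)_*$. Moreover: (i) $\Gamma_\pi$ is a contractive algebra homomorphism from $\mathrm M(G)$ into $\mathcal B(\mathcal H)\otimes^{eh}\mathcal B(\mathcal H)$, and its range is contained in $\mathrm M^*_\pi\otimes^{eh}\mathrm M^*_\pi$; (ii) $\Gamma_\pi(\mathrm L^1(G))\subset\mathrm C^*_\pi\otimes^{eh}\mathrm C^*_\pi$; (iii) $\Gamma_\pi(\ell^1(G))\subset\mathrm D^*_\pi\otimes^{h}\mathrm D^*_\pi$; (iv) if $\pi$ is norm continuous, then $\Gamma_\pi(\mathrm M(G))\subset\mathrm D^*_\pi\otimes^{h}\mathrm D^*_\pi$. -/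

import Mathlib

open MeasureTheory Filter Topology Set
open scoped TensorProduct ComplexOrder ZeroAtInfty ENNReal

namespace GroupCB

universe u v

noncomputable section

/-! ### The measure algebra of a locally compact group -/

section MeasureAlgebra

variable (G : Type v) [TopologicalSpace G] [MeasurableSpace G]

/-- A measure dominated by a finite regular measure is regular. -/
theorem regular_of_le {X : Type v} [TopologicalSpace X] [T2Space X] [LocallyCompactSpace X]
    [MeasurableSpace X] [BorelSpace X] {κ ρ : Measure X} [IsFiniteMeasure κ]
    [κ.InnerRegularCompactLTTop] (h : ρ ≤ κ) : ρ.Regular := by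
  have hfin : IsFiniteMeasure ρ := isFiniteMeasure_of_le κ h
  have hreg : ρ.InnerRegularCompactLTTop := by
    constructor
    rintro A ⟨hA, -⟩ r hr
    obtain ⟨K, hKA, hK, hlt⟩ := hA.exists_isCompact_sdiff_lt (measure_ne_top κ A)
      (tsub_pos_of_lt hr).ne'
    refine ⟨K, hKA, hK, ?_⟩
    by_contra! hle
    have h1 : ρ A ≤ ρ K + ρ (A \ K) := by
      refine (measure_mono ?_).trans (measure_union_le K (A \ K))
      intro x hx
      by_cases hxK : x ∈ K
      · exact Or.inl hxK
      · exact Or.inr ⟨hx, hxK⟩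
    have h2 : ρ (A \ K) < ρ A - r := (h _).trans_lt hlt
    have h3 : ρ A < r + (ρ A - r) :=
      h1.trans_lt (ENNReal.add_lt_add_of_le_of_lt (ne_top_of_le_ne_top hr.ne_top hle) hle h2)
    rw [add_tsub_cancel_of_le hr.le] at h3
    exact lt_irrefl _ h3
  infer_instance

/-- `M(G)`: the space of bounded regular complex Borel measures on `G`. -/
def MG [T2Space G] [LocallyCompactSpace G] [BorelSpace G] : Submodule ℂ (ComplexMeasure G) where
  carrier := {μ | IsFiniteMeasure μ.variation ∧ μ.variation.Regular}
  zero_mem' := by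
    simp only [mem_ofPred_eq, VectorMeasure.variation_zero]
    exact ⟨inferInstance, inferInstance⟩
  add_mem' := by
    rintro μ ν ⟨hμ, hμ'⟩ ⟨hν, hν'⟩
    exact ⟨isFiniteMeasure_of_le _ VectorMeasure.variation_add_le,
      regular_of_le (κ := μ.variation + ν.variation) VectorMeasure.variation_add_le⟩
  smul_mem' := by
    rintro c μ ⟨hμ, hμ'⟩
    simp only [mem_ofPred_eq, VectorMeasure.variation_smul]
    exact ⟨inferInstance, inferInstance⟩

variable {G}

/-- The integral `∫ f dμ` of a complex function against a complex measure. -/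
def cintegral (μ : ComplexMeasure G) (f : G → ℂ) : ℂ :=
  μ.integral f (ContinuousLinearMap.mul ℝ ℂ)

variable [T2Space G] [LocallyCompactSpace G] [BorelSpace G]

/-- The norm of `M(G)`: the total variation of the measure. -/
def mnorm (μ : MG G) : ℝ := ((μ : ComplexMeasure G).variation univ).toReal

/-- `ρ` is the convolution of `μ` and `ν`:
`∫ φ dρ = ∫ ∫ φ(s t) dμ(s) dν(t)` for every `φ ∈ C₀(G)`. -/
def IsConvolution [Group G] (μ ν ρ : MG G) : Prop :=
  ∀ φ : C₀(G, ℂ), cintegral (ρ : ComplexMeasure G) (fun s => φ s) =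
    cintegral (ν : ComplexMeasure G) fun t =>
      cintegral (μ : ComplexMeasure G) fun s => φ (s * t)

/-- `L¹(G)`: the measures in `M(G)` absolutely continuous with respect to left Haar measure. -/
def L1 (G : Type v) [TopologicalSpace G] [MeasurableSpace G] [T2Space G] [LocallyCompactSpace G]
    [BorelSpace G] [Group G] [IsTopologicalGroup G] : Set (MG G) :=
  {μ | (μ : ComplexMeasure G).variation ≪ Measure.haar}

open scoped Classical in
/-- `ℓ¹(G)`: the measures `∑ α(s) δ_s` in `M(G)` with `∑ |α(s)| < ∞`. -/
def ell1 (G : Type v) [TopologicalSpace G] [MeasurableSpace G] [T2Space G] [LocallyCompactSpace G]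
    [BorelSpace G] : Set (MG G) :=
  {μ | ∃ α : G → ℂ, Summable (fun s => ‖α s‖) ∧
    ∀ E, MeasurableSet E → HasSum (fun s => if s ∈ E then α s else 0) ((μ : ComplexMeasure G) E)}

end MeasureAlgebra

/-! ### The predual of `B(H)` and its operator space structure -/

section Operators

variable (H : Type u) [NormedAddCommGroup H] [InnerProductSpace ℂ H] [CompleteSpace H]

/-- The algebra `B(H)` of bounded operators. -/
abbrev BH : Type u := H →L[ℂ] H

variable {H}

/-- The vector functional `x ↦ ⟨x ξ, η⟩` (linear in `ξ`, conjugate linear in `η`). -/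
def vectorFunctional (ξ η : H) : StrongDual ℂ (BH H) :=
  (innerSL ℂ η).comp (ContinuousLinearMap.apply ℂ H ξ)

variable (H) in
/-- The predual `B(H)_*`, i.e. the space of normal functionals: the norm closed linear span of the
vector functionals in the dual of `B(H)`. -/
def predual : Submodule ℂ (StrongDual ℂ (BH H)) :=
  (Submodule.span ℂ (range fun p : H × H => vectorFunctional p.1 p.2)).topologicalClosure

/-- Weak* convergence of a series in `B(H) = (B(H)_*)^*`. -/
def WeakStarHasSum {ι : Type*} (f : ι → BH H) (a : BH H) : Prop :=
  ∀ ω ∈ predual H, HasSum (fun i => ω (f i)) (ω a)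

/-- The matrix norms of the operator space `B(H)_*`, where `M_{p,q}(B(H)_*)` consists of the normal
completely bounded maps `B(H) → M_{p,q}`: the matrix `ω` has norm at most `C`. That is,
`‖[ω_{kl}(x_{ij})]‖ ≤ C ‖x‖` for every `m` and every `x ∈ M_m(B(H))`. -/
def MatrixNormLE {p q : Type} [Fintype p] [Fintype q] (ω : p → q → predual H) (C : ℝ) : Prop :=
  ∀ (m : ℕ) (x : CStarMatrix (Fin m) (Fin m) (BH H)),
    ‖(CStarMatrix.ofMatrix (Matrix.of fun (k : Fin m × p) (l : Fin m × q) =>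
        (ω k.2 l.2 : StrongDual ℂ (BH H)) (x k.1 l.1)) :
      CStarMatrix (Fin m × p) (Fin m × q) ℂ)‖ ≤ C * ‖x‖

/-- The Haagerup norm on the algebraic tensor product `B(H)_* ⊗ B(H)_*`: the infimum of
`‖ω‖_{M_{1,n}} ‖ν‖_{M_{n,1}}` over all `n` and all representations `∑ₖ ωₖ ⊗ νₖ`. -/
def hNorm (z : predual H ⊗[ℂ] predual H) : ℝ :=
  sInf {r | ∃ (n : ℕ) (ω ν : Fin n → predual H) (C D : ℝ), 0 ≤ C ∧ 0 ≤ D ∧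
    MatrixNormLE (fun (_ : Unit) k => ω k) C ∧ MatrixNormLE (fun k (_ : Unit) => ν k) D ∧
    z = ∑ k, ω k ⊗ₜ[ℂ] ν k ∧ r = C * D}

set_option maxSynthPendingDepth 3 in
/-- The additive group structure of the tensor product (a shortcut for instance search). -/
instance : AddCommGroup (predual H ⊗[ℂ] predual H) := TensorProduct.addCommGroup

/-- Cauchy sequences for the Haagerup norm. They represent the elements of the completion
`B(H)_* ⊗ʰ B(H)_*`. -/
def IsHCauchy (z : ℕ → predual H ⊗[ℂ] predual H) : Prop :=
  ∀ ε > 0, ∃ N, ∀ m ≥ N, ∀ n ≥ N, hNorm (z m - z n) < ε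

/-- Evaluation of a normal functional at an operator. -/
def evalAt (a : BH H) : predual H →ₗ[ℂ] ℂ where
  toFun ω := (ω : StrongDual ℂ (BH H)) a
  map_add' _ _ := rfl
  map_smul' _ _ := rfl

/-- The linear functional on `B(H)_* ⊗ B(H)_*` with `ω ⊗ ν ↦ ω(a) ν(b)`. -/
def evalPair (a b : BH H) : predual H ⊗[ℂ] predual H →ₗ[ℂ] ℂ :=
  LinearMap.mul' ℂ ℂ ∘ₗ TensorProduct.map (evalAt a) (evalAt b)

/-! ### Haagerup and extended Haagerup tensor products

The elements are identified with the operators `x ↦ ∑ᵢ vᵢ x wᵢ` on `B(H)`, so that two series give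
the same element exactly when these operators agree, and the product is the composition. -/

/-- `T = ∑ᵢ vᵢ ⊗ wᵢ`, where `∑ᵢ vᵢ vᵢ* = a` and `∑ᵢ wᵢ* wᵢ = b` in the weak* topology. -/
structure IsEHSeries {ι : Type*} (v w : ι → BH H) (a b : BH H) (T : BH H →L[ℂ] BH H) :
    Prop where
  row : WeakStarHasSum (fun i => v i * star (v i)) a
  col : WeakStarHasSum (fun i => star (w i) * w i) b
  apply : ∀ x, WeakStarHasSum (fun i => v i * x * w i) (T x)

/-- The extended Haagerup tensor product `V ⊗ᵉʰ W` of closed subspaces of `B(H)`. -/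
def extHaagerup (V W : Set (BH H)) : Set (BH H →L[ℂ] BH H) :=
  {T | ∃ (ι : Type u) (v w : ι → BH H) (a b : BH H),
    (∀ i, v i ∈ V) ∧ (∀ i, w i ∈ W) ∧ IsEHSeries v w a b T}

/-- The norm of `B(H) ⊗ᵉʰ B(H)`: the infimum of `‖∑ᵢ vᵢ vᵢ*‖^{1/2} ‖∑ᵢ wᵢ* wᵢ‖^{1/2}`. -/
def ehNorm (T : BH H →L[ℂ] BH H) : ℝ :=
  sInf {r | ∃ (ι : Type u) (v w : ι → BH H) (a b : BH H),
    IsEHSeries v w a b T ∧ r = √‖a‖ * √‖b‖}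

/-- The Haagerup tensor product `V ⊗ʰ W` of closed subspaces of `B(H)`: the elements that have a
series for which `∑ᵢ vᵢ vᵢ*` and `∑ᵢ wᵢ* wᵢ` converge in norm. -/
def haagerup (V W : Set (BH H)) : Set (BH H →L[ℂ] BH H) :=
  {T | ∃ (v w : ℕ → BH H) (a b : BH H), (∀ i, v i ∈ V) ∧ (∀ i, w i ∈ W) ∧
    HasSum (fun i => v i * star (v i)) a ∧ HasSum (fun i => star (w i) * w i) b ∧
    IsEHSeries v w a b T}

/-- The pairing of `B(H) ⊗ᵉʰ B(H)` with `B(H)_* ⊗ʰ B(H)_*`: `⟨T, z⟩ = c`, where `z` is represented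
by a Cauchy sequence. For `T = ∑ᵢ vᵢ ⊗ wᵢ` it is given by
`⟨T, ω ⊗ ν⟩ = ∑ᵢ ω(vᵢ) ν(wᵢ)` and by the passage to the limit, whatever series is chosen for `T`. -/
def PairsTo (T : BH H →L[ℂ] BH H) (z : ℕ → predual H ⊗[ℂ] predual H) (c : ℂ) : Prop :=
  ∀ (ι : Type u) (v w : ι → BH H) (a b : BH H), IsEHSeries v w a b T →
    ∃ p : ℕ → ℂ, (∀ n, HasSum (fun i => evalPair (v i) (w i) (z n)) (p n)) ∧
      Tendsto p atTop (𝓝 c)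

/-! ### Integrated forms of a unitary representation -/

variable {G : Type v} [Group G] [TopologicalSpace G] [MeasurableSpace G] [T2Space G]
  [LocallyCompactSpace G] [BorelSpace G] (π : G →* unitary (BH H))

/-- `A = π₁(μ)`, the weak* integral `∫ π(s) dμ(s)` in `B(H)`. -/
def IsPi1 (μ : MG G) (A : BH H) : Prop :=
  ∀ ω ∈ predual H, ω A = cintegral (μ : ComplexMeasure G) fun s => ω (π s : BH H)

/-- The norm closure of `π₁(S)`, for a set `S` of measures. -/
def closedRange (S : Set (MG G)) : Set (BH H) :=
  closure {A | ∃ μ ∈ S, IsPi1 π μ A}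

/-- The C*-algebra `M*_π`, the norm closure of `π₁(M(G))`. -/
def Mstar : Set (BH H) := closedRange π univ

/-- The C*-algebra `C*_π`, the norm closure of `π₁(L¹(G))`. -/
def Cstar [IsTopologicalGroup G] : Set (BH H) := closedRange π (L1 G)

/-- The C*-algebra `D*_π`, the norm closure of `π₁(ℓ¹(G))`. -/
def Dstar : Set (BH H) := closedRange π (ell1 G)

/-- `T = ∫ π(s) ⊗ π(s)* dμ(s)`: `T` is an element of `B(H) ⊗ᵉʰ B(H)`, and for every `z` in
`B(H)_* ⊗ʰ B(H)_*` the function `s ↦ ⟨π(s) ⊗ π(s)*, z⟩` is `μ`-integrable with integral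
`⟨T, z⟩`. -/
def IsGamma (μ : MG G) (T : BH H →L[ℂ] BH H) : Prop :=
  T ∈ extHaagerup (univ : Set (BH H)) univ ∧
  ∀ z : ℕ → predual H ⊗[ℂ] predual H, IsHCauchy z →
    ∃ f : G → ℂ,
      (∀ s, PairsTo
        (ContinuousLinearMap.mulLeftRight ℂ (BH H) (π s : BH H) (star (π s : BH H))) z (f s)) ∧
      (μ : ComplexMeasure G).Integrable f ∧
      PairsTo T z (cintegral (μ : ComplexMeasure G) f)

end Operators

end

end GroupCB

open GroupCB

open MeasureTheory Filter Topology Set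
open scoped TensorProduct ComplexOrder ZeroAtInfty ENNReal

namespace GroupCB

set_option linter.unusedSectionVars false

section Densities

variable {X : Type*} [MeasurableSpace X] {lam : Measure X}

theorem integrable_mul_of_withDensity {f g : X → ℂ} (hg : Integrable g lam)
    (hf : Integrable f (lam.withDensity fun x => ‖g x‖ₑ)) :
    Integrable (fun x => f x * g x) lam := by
  have h1 : Integrable (fun x => ‖g x‖₊ • f x) lam :=
    (integrable_withDensity_iff_integrable_smul₀ (f := fun x => ‖g x‖₊)
      hg.aestronglyMeasurable.nnnorm.aemeasurable).1 hf
  have h2 : AEStronglyMeasurable (fun x => ‖g x‖⁻¹ • g x) lam :=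
    hg.aestronglyMeasurable.norm.inv₀.smul hg.aestronglyMeasurable
  have h3 : Integrable (fun x => (‖g x‖₊ • f x) * (‖g x‖⁻¹ • g x)) lam := by
    refine h1.mul_bdd (c := 1) h2 (.of_forall fun x => ?_)
    simp [inv_mul_le_one]
  refine h3.congr (.of_forall fun x => ?_)
  rcases eq_or_ne (g x) 0 with h | h
  · simp [h]
  · have h' : ((‖g x‖ : ℝ) : ℂ) ≠ 0 := by simpa using h
    simp only [NNReal.smul_def, coe_nnnorm, Complex.real_smul, Complex.ofReal_inv]
    field_simp

theorem integral_norm_mul_withDensity {f g : X → ℂ} (hg : Integrable g lam) :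
    ∫ x, ‖f x‖ ∂(lam.withDensity fun x => ‖g x‖ₑ) = ∫ x, ‖f x * g x‖ ∂lam := by
  have := integral_withDensity_eq_integral_smul₀ (f := fun x => ‖g x‖₊)
      (μ := lam) hg.aestronglyMeasurable.nnnorm.aemeasurable fun x => ‖f x‖
  refine this.trans (integral_congr_ae (.of_forall fun x => ?_))
  simp [NNReal.smul_def, mul_comm]

theorem cintegral_withDensity {f g : X → ℂ} (hg : Integrable g lam)
    (hf : Integrable f (lam.withDensity fun x => ‖g x‖ₑ)) :
    (lam.withDensityᵥ g : ComplexMeasure X).integral f (ContinuousLinearMap.mul ℝ ℂ) =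
      ∫ x, f x * g x ∂lam := by
  have hvar := Measure.variation_withDensityᵥ hg
  have hfin : IsFiniteMeasure (lam.withDensityᵥ g).variation := by
    rw [hvar]; exact ⟨by simpa using! hg.2⟩
  have hint : ∀ f : X → ℂ, Integrable f (lam.withDensityᵥ g).variation →
      Integrable (fun x => f x * g x) lam := fun f hf =>
    integrable_mul_of_withDensity hg (by rwa [← hvar])
  have hnorm : ∀ f : X → ℂ, ∫ x, ‖f x‖ ∂(lam.withDensityᵥ g).variation =
      ∫ x, ‖f x * g x‖ ∂lam := fun f => by
    rw [hvar, integral_norm_mul_withDensity hg]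
  revert hf f
  rw [← hvar]
  refine Integrable.induction _ ?_ ?_ ?_ ?_
  · intro c s hs _
    rw [VectorMeasure.integral_indicator_const c hs, withDensityᵥ_apply hg hs]
    simp only [ContinuousLinearMap.mul_apply']
    rw [← integral_const_mul, ← integral_indicator hs]
    congr 1 with x
    by_cases hx : x ∈ s <;> simp [hx]
  · intro f f' _ hf hf' h h'
    rw [VectorMeasure.integral_add hf hf', h, h', ← integral_add]
    · simp [add_mul]
    · exact hint _ hf
    · exact hint _ hf'
  · refine isClosed_eq VectorMeasure.continuous_integral ?_
    refine (LipschitzWith.of_dist_le_mul (K := 1) fun f f' => ?_).continuous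
    have hf := hint f (L1.integrable_coeFn f)
    have hf' := hint f' (L1.integrable_coeFn f')
    rw [dist_eq_norm, dist_eq_norm, ← integral_sub hf hf', L1.norm_eq_integral_norm]
    refine (norm_integral_le_integral_norm _).trans (le_of_eq ?_)
    have : ∫ a, ‖(f - f') a‖ ∂(lam.withDensityᵥ g).variation =
        ∫ a, ‖f a - f' a‖ ∂(lam.withDensityᵥ g).variation := by
      refine integral_congr_ae ?_
      filter_upwards [Lp.coeFn_sub f f'] with x hx
      rw [hx, Pi.sub_apply]
    rw [this, NNReal.coe_one, one_mul, hnorm]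
    simp [sub_mul]
  · intro f f' h hf hP
    rw [← VectorMeasure.integral_congr_ae h, hP]
    have h1 := hint _ hf
    have h2 := hint _ (hf.congr h)
    rw [← sub_eq_zero, ← integral_sub h1 h2]
    refine norm_le_zero_iff.1 ((norm_integral_le_integral_norm _).trans (le_of_eq ?_))
    have h3 := hnorm fun x => f x - f' x
    simp only [sub_mul] at h3
    rw [← h3]
    refine integral_eq_zero_of_ae ?_
    filter_upwards [h] with x hx
    simp [hx]

theorem exists_unimodular_density (c : ComplexMeasure X) [IsFiniteMeasure c.variation] :
    ∃ h : X → ℂ, Measurable h ∧ (∀ x, ‖h x‖ = 1) ∧ c = c.variation.withDensityᵥ h := by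
  have hac : c ≪ᵥ c.variation.toENNRealVectorMeasure := by
    refine VectorMeasure.AbsolutelyContinuous.mk fun E hE h => ?_
    rw [Measure.toENNRealVectorMeasure_apply_measurable hE] at h
    exact (VectorMeasure.variation_apply_eq_zero hE).1 h E le_rfl hE
  obtain ⟨hre, him⟩ := (c.absolutelyContinuous_ennreal_iff _).1 hac
  have hre' := SignedMeasure.withDensityᵥ_rnDeriv_eq _ _ hre
  have him' := SignedMeasure.withDensityᵥ_rnDeriv_eq _ _ him
  set g := c.rnDeriv c.variation with hgdef
  have hg : Integrable g c.variation := c.integrable_rnDeriv _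
  have hc : c = c.variation.withDensityᵥ g := by
    ext E hE
    rw [withDensityᵥ_apply hg hE]
    apply Complex.ext
    · change (c E).re = RCLike.re (∫ x in E, g x ∂c.variation)
      rw [← integral_re hg.integrableOn]
      have := congrArg (fun v => v E) hre'
      rw [withDensityᵥ_apply (SignedMeasure.integrable_rnDeriv _ _) hE] at this
      exact this.symm
    · change (c E).im = RCLike.im (∫ x in E, g x ∂c.variation)
      rw [← integral_im hg.integrableOn]
      have := congrArg (fun v => v E) him'
      rw [withDensityᵥ_apply (SignedMeasure.integrable_rnDeriv _ _) hE] at this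
      exact this.symm
  have hone : (fun x => ‖g x‖ₑ) =ᵐ[c.variation] fun _ => 1 := by
    have hv := Measure.variation_withDensityᵥ hg
    rw [← hc] at hv
    refine (withDensity_eq_iff_of_sigmaFinite hg.aestronglyMeasurable.enorm
      aemeasurable_const).1 ?_
    rw [← hv]
    simp
  have hgm : Measurable g :=
    Complex.measurable_ofReal.comp (SignedMeasure.measurable_rnDeriv _ _) |>.add
      ((Complex.measurable_ofReal.comp (SignedMeasure.measurable_rnDeriv _ _)).mul_const
        Complex.I) |> fun h => by
        convert h using 1
        ext x
        exact (Complex.re_add_im (g x)).symm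
  classical
  refine ⟨fun x => if ‖g x‖ = 1 then g x else 1,
    Measurable.ite (measurableSet_eq_fun hgm.norm measurable_const) hgm measurable_const,
    fun x => ?_, ?_⟩
  · by_cases h : ‖g x‖ = 1 <;> simp [h]
  · conv_lhs => rw [hc]
    refine WithDensityᵥEq.congr_ae ?_
    filter_upwards [hone] with x hx
    have : ‖g x‖ = 1 := by
      rw [← toReal_enorm, hx]; simp
    simp [this]

end Densities

section Regularity

variable {G : Type*} [TopologicalSpace G] [MeasurableSpace G] [T2Space G]
  [LocallyCompactSpace G] [BorelSpace G]

/-- A finite measure absolutely continuous with respect to a finite regular measure is regular. -/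
theorem regular_of_absolutelyContinuous {κ ρ : Measure G} [IsFiniteMeasure κ] [IsFiniteMeasure ρ]
    [κ.Regular] (h : ρ ≪ κ) : ρ.Regular := by
  have hreg : ρ.InnerRegularCompactLTTop := by
    constructor
    rintro A ⟨hA, -⟩ r hr
    have hK : ∀ n : ℕ, ∃ K ⊆ A, IsCompact K ∧ κ (A \ K) < ((n : ℝ≥0∞) + 1)⁻¹ := fun n =>
      hA.exists_isCompact_sdiff_lt (measure_ne_top κ A) (by simp)
    choose K hKA hKc hKlt using hK
    have hU : ∀ n, IsCompact (⋃ i ∈ Finset.range (n + 1), K i) := fun n =>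
      (Finset.range (n + 1)).isCompact_biUnion fun i _ => hKc i
    have hnull : κ (A \ ⋃ i, K i) = 0 := by
      refine le_antisymm (ge_of_tendsto' (x := atTop) (f := fun n : ℕ => ((n : ℝ≥0∞) + 1)⁻¹) ?_
        fun n => ?_) zero_le
      · have := ENNReal.tendsto_inv_nat_nhds_zero.comp (tendsto_add_atTop_nat 1)
        simpa [Function.comp_def] using this
      · exact (measure_mono (sdiff_subset_sdiff_right (subset_iUnion K n))).trans (hKlt n).le
    have hlim : Tendsto (fun n => ρ (⋃ i ∈ Finset.range (n + 1), K i)) atTop (𝓝 (ρ (⋃ i, K i))) := by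
      have hmono : Monotone fun n : ℕ => ⋃ i ∈ Finset.range (n + 1), K i := by
        intro a b hab
        exact biUnion_subset_biUnion_left fun i hi => by
          simp only [Finset.coe_range, mem_Iio] at hi ⊢; omega
      have heq : ⋃ i, K i = ⋃ n : ℕ, ⋃ i ∈ Finset.range (n + 1), K i := by
        ext x
        simp only [mem_iUnion, Finset.mem_range, exists_prop]
        exact ⟨fun ⟨i, hi⟩ => ⟨i, i, by omega, hi⟩, fun ⟨_, i, _, hi⟩ => ⟨i, hi⟩⟩
      rw [heq]
      exact tendsto_measure_iUnion_atTop hmono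
    have hle : ρ A ≤ ρ (⋃ i, K i) := by
      refine (measure_mono (subset_sdiff_union A (⋃ i, K i))).trans ?_
      refine (measure_union_le _ _).trans ?_
      rw [h hnull, zero_add]
    obtain ⟨n, hn⟩ := (hlim.eventually (lt_mem_nhds (hr.trans_le hle))).exists
    exact ⟨_, iUnion₂_subset fun i _ => hKA i, hU n, hn⟩
  infer_instance

theorem exists_sigmaCompact_full (lam : Measure G) [IsFiniteMeasure lam] [lam.Regular] :
    ∃ K : ℕ → Set G, (∀ n, IsCompact (K n)) ∧ lam (⋃ n, K n)ᶜ = 0 := by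
  have hK : ∀ n : ℕ, ∃ K ⊆ (univ : Set G), IsCompact K ∧ lam (univ \ K) < ((n : ℝ≥0∞) + 1)⁻¹ :=
    fun n => MeasurableSet.univ.exists_isCompact_sdiff_lt (measure_ne_top lam _) (by simp)
  choose K _ hKc hKlt using hK
  refine ⟨K, hKc, le_antisymm (ge_of_tendsto' (x := atTop)
    (f := fun n : ℕ => ((n : ℝ≥0∞) + 1)⁻¹) ?_ fun n => ?_) zero_le⟩
  · have := ENNReal.tendsto_inv_nat_nhds_zero.comp (tendsto_add_atTop_nat 1)
    simpa [Function.comp_def] using this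
  · refine le_trans (measure_mono ?_) (hKlt n).le
    rw [← compl_eq_univ_sdiff]
    exact compl_subset_compl.2 (subset_iUnion K n)

theorem exists_isCompact_compl_lt (lam : Measure G) [IsFiniteMeasure lam] [lam.Regular] {ε : ℝ}
    (hε : 0 < ε) : ∃ K, IsCompact K ∧ lam.real Kᶜ < ε := by
  obtain ⟨K, -, hK, hlt⟩ := MeasurableSet.univ.exists_isCompact_sdiff_lt
    (measure_ne_top lam univ) (ENNReal.ofReal_pos.2 hε).ne'
  refine ⟨K, hK, ?_⟩
  rw [compl_eq_univ_sdiff, measureReal_def]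
  exact (ENNReal.toReal_lt_of_lt_ofReal hlt)

theorem aestronglyMeasurable_of_continuous (lam : Measure G) [IsFiniteMeasure lam] [lam.Regular]
    {E : Type*} [NormedAddCommGroup E] {f : G → E} (hf : Continuous f) :
    AEStronglyMeasurable f lam := by
  obtain ⟨K, hK, h0⟩ := exists_sigmaCompact_full lam
  have h1 : AEStronglyMeasurable f (lam.restrict (⋃ n, K n)) :=
    aestronglyMeasurable_iUnion_iff.2 fun n =>
      hf.continuousOn.aestronglyMeasurable_of_isCompact (hK n) (hK n).measurableSet
  rwa [Measure.restrict_eq_self_of_ae_mem] at h1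
  exact h0

theorem integrable_of_continuous (lam : Measure G) [IsFiniteMeasure lam] [lam.Regular]
    {E : Type*} [NormedAddCommGroup E] {f : G → E} (hf : Continuous f) {C : ℝ}
    (hC : ∀ x, ‖f x‖ ≤ C) : Integrable f lam :=
  .of_bound (aestronglyMeasurable_of_continuous lam hf) C (.of_forall hC)

instance (μ : MG G) : IsFiniteMeasure (μ : ComplexMeasure G).variation := μ.2.1

instance (μ : MG G) : (μ : ComplexMeasure G).variation.Regular := μ.2.2

theorem exists_polar (μ : MG G) : ∃ h : G → ℂ, Measurable h ∧ (∀ x, ‖h x‖ = 1) ∧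
    ∀ f : G → ℂ, cintegral (μ : ComplexMeasure G) f =
      ∫ x, f x * h x ∂(μ : ComplexMeasure G).variation := by
  obtain ⟨h, hm, h1, hμ⟩ := exists_unimodular_density (μ : ComplexMeasure G)
  refine ⟨h, hm, h1, fun f => ?_⟩
  have hh : Integrable h (μ : ComplexMeasure G).variation :=
    .of_bound hm.aestronglyMeasurable 1 (.of_forall fun x => (h1 x).le)
  have hw : (μ : ComplexMeasure G).variation.withDensity (fun x => ‖h x‖ₑ) =
      (μ : ComplexMeasure G).variation := by
    have : (fun x => ‖h x‖ₑ) = 1 := by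
      ext x; rw [← ofReal_norm, h1]; simp
    rw [this, withDensity_one]
  by_cases hf : Integrable f (μ : ComplexMeasure G).variation
  · conv_lhs => rw [cintegral, hμ]
    exact cintegral_withDensity hh (hw.symm ▸ hf)
  · rw [cintegral, VectorMeasure.integral_undef hf, integral_undef]
    intro hfh
    refine hf ((hfh.mul_bdd (c := 1) (g := fun x => (h x)⁻¹) hm.inv.aestronglyMeasurable
      (.of_forall fun x => ?_)).congr (.of_forall fun x => ?_))
    · simp [h1]
    · have : h x ≠ 0 := fun h0 => by simpa [h0] using h1 x
      simp [this]

theorem exists_density (lam : Measure G) [IsFiniteMeasure lam] [lam.Regular] {g : G → ℂ}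
    (hg : Integrable g lam) : ∃ ν : MG G, (ν : ComplexMeasure G).variation ≪ lam ∧
      (∀ f : G → ℂ, AEStronglyMeasurable f lam → (∃ C, ∀ x, ‖f x‖ ≤ C) →
        cintegral (ν : ComplexMeasure G) f = ∫ x, f x * g x ∂lam) := by
  have hv := Measure.variation_withDensityᵥ hg
  have hac : (lam.withDensityᵥ g).variation ≪ lam := hv ▸ withDensity_absolutelyContinuous _ _
  have hfin : IsFiniteMeasure (lam.withDensityᵥ g).variation := by
    rw [hv]; exact ⟨by simpa using! hg.2⟩
  refine ⟨⟨lam.withDensityᵥ g, hfin, regular_of_absolutelyContinuous hac⟩, hac, fun f hf hC => ?_⟩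
  obtain ⟨C, hC⟩ := hC
  refine cintegral_withDensity hg ?_
  rw [← hv]
  exact .of_bound (hf.mono_ac hac) C (.of_forall hC)

theorem exists_dirac (s : G) : ∃ ν : MG G, ν ∈ ell1 G ∧
    ∀ f : G → ℂ, cintegral (ν : ComplexMeasure G) f = f s := by
  classical
  have hv : (VectorMeasure.dirac s (1 : ℂ)).variation = Measure.dirac s := by
    simp [VectorMeasure.variation_dirac]
  have hreg : (Measure.dirac s).Regular := by
    have : (Measure.dirac s).InnerRegularCompactLTTop := by
      constructor
      rintro A ⟨hA, -⟩ r hr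
      by_cases hs : s ∈ A
      · exact ⟨{s}, by simpa using hs, isCompact_singleton, by
          rw [Measure.dirac_apply_of_mem (by simp)]
          rwa [Measure.dirac_apply_of_mem hs] at hr⟩
      · rw [Measure.dirac_apply' _ hA] at hr
        simp [hs] at hr
    infer_instance
  refine ⟨⟨VectorMeasure.dirac s (1 : ℂ), by rw [hv]; infer_instance, by rw [hv]; infer_instance⟩,
    ⟨Pi.single s 1, ?_, fun E hE => ?_⟩, fun f => ?_⟩
  · refine summable_of_ne_finset_zero (s := {s}) fun t ht => ?_
    rw [Pi.single_eq_of_ne (by simpa using ht), norm_zero]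
  · have h := hasSum_ite_eq s (if s ∈ E then (1 : ℂ) else 0)
    convert h using 1
    · ext t
      rcases eq_or_ne t s with rfl | h'
      · simp
      · simp [h']
    · by_cases h' : s ∈ E <;> simp [hE, h']
  · rw [cintegral, VectorMeasure.integral_dirac]
    simp

end Regularity

section Haar

variable {G : Type*} [TopologicalSpace G] [MeasurableSpace G] [T2Space G]
  [LocallyCompactSpace G] [BorelSpace G] [Group G] [IsTopologicalGroup G]

theorem haar_eq_zero_of_isCompact_inv {K : Set G} (hK : IsCompact K)
    (h0 : (Measure.haar : Measure G) K⁻¹ = 0) : (Measure.haar : Measure G) K = 0 := by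
  set μ : Measure G := Measure.haar
  have hν0 : μ.inv K = 0 := by rwa [Measure.inv_apply]
  obtain ⟨g, hgc, hg0, hg1⟩ := exists_continuous_nonneg_pos (1 : G)
  set D : G → ℝ := fun x => ∫ y, g (y⁻¹ * x) ∂μ.inv with hD
  have hDc : Continuous D := continuous_integral_apply_inv_mul g.continuous hgc
  have hDpos : ∀ x, 0 < D x := fun x => by
    have C : Continuous fun y => g (y⁻¹ * x) := by fun_prop
    change 0 < ∫ y, g (y⁻¹ * x) ∂μ.inv
    refine (integral_pos_iff_support_of_nonneg (f := fun y => g (y⁻¹ * x)) (fun y => hg0 (y⁻¹ * x)) ?_).2 ?_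
    · exact C.integrable_of_hasCompactSupport
        (hgc.comp_homeomorph ((Homeomorph.inv G).trans (Homeomorph.mulRight x)))
    · exact C.isOpen_support.measure_pos _ ⟨x, by simpa using hg1⟩
  obtain ⟨L, hL, hKL⟩ := exists_compact_superset hK
  obtain ⟨C', hC'⟩ := hL.exists_bound_of_continuousOn
    (hDc.inv₀ fun x => (hDpos x).ne').continuousOn
  set C := |C'| with hCdef
  have hC0 : 0 ≤ C := abs_nonneg _
  have hC : ∀ x ∈ L, ‖(D x)⁻¹‖ ≤ C := fun x hx => (hC' x hx).trans (le_abs_self _)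
  have key : ∀ ε : ℝ, 0 < ε → μ.real K ≤ C * ε * ∫ x, g x ∂μ := by
    intro ε hε
    obtain ⟨U, hKU, hUo, hUlt⟩ := K.exists_isOpen_lt_of_lt (μ := μ.inv) (ENNReal.ofReal ε)
      (by rw [hν0]; exact ENNReal.ofReal_pos.2 hε)
    obtain ⟨f, hf1, hf0, hfc, hf⟩ := exists_continuous_one_zero_of_isCompact hK
      (hUo.inter isOpen_interior).isClosed_compl
      (disjoint_compl_right_iff_subset.2 (subset_inter hKU hKL))
    have hfL : ∀ x ∉ L, f x = 0 := fun x hx => hf0 fun h => hx (interior_subset h.2)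
    have hfU : ∀ x ∉ U, f x = 0 := fun x hx => hf0 fun h => hx h.1
    have h1 : μ.real K ≤ ∫ x, f x ∂μ := by
      rw [← integral_indicator_one hK.measurableSet]
      refine integral_mono ((integrable_indicator_iff hK.measurableSet).2
        (integrableOn_const hK.measure_lt_top.ne))
        (f.continuous.integrable_of_hasCompactSupport hfc) fun x => ?_
      by_cases hx : x ∈ K
      · simp [hx, hf1 hx]
      · simpa [hx] using (hf x).1
    rw [Measure.integral_isMulLeftInvariant_isMulRightInvariant_combo (ν := μ.inv) f.continuous hfc
      g.continuous hgc hg0 hg1] at h1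
    refine h1.trans (mul_le_mul_of_nonneg_right ?_ (integral_nonneg hg0))
    have hUfin : μ.inv U ≠ ∞ := (hUlt.trans ENNReal.ofReal_lt_top).ne
    calc ∫ y, f y * (D y)⁻¹ ∂μ.inv ≤ ∫ y, U.indicator (fun _ => C) y ∂μ.inv := by
          refine integral_mono ?_ ((integrable_indicator_iff hUo.measurableSet).2
            (integrableOn_const hUfin)) fun y => ?_
          · exact (f.continuous.mul (hDc.inv₀ fun x => (hDpos x).ne')).integrable_of_hasCompactSupport
              hfc.mul_right
          · by_cases hy : y ∈ U
            · simp only [hy, indicator_of_mem]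
              by_cases hyL : y ∈ L
              · calc f y * (D y)⁻¹ ≤ 1 * (D y)⁻¹ :=
                      mul_le_mul_of_nonneg_right (hf y).2 (inv_nonneg.2 (hDpos y).le)
                  _ ≤ C := by rw [one_mul]; exact (le_abs_self _).trans (hC y hyL)
              · simp [hfL y hyL, hC0]
            · simp [hy, hfU y hy]
      _ = C * μ.inv.real U := by
          rw [integral_indicator hUo.measurableSet, setIntegral_const, smul_eq_mul, mul_comm]
      _ ≤ C * ε := by
          refine mul_le_mul_of_nonneg_left ?_ hC0
          rw [measureReal_def]
          exact ENNReal.toReal_le_of_le_ofReal hε.le hUlt.le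
  have hle : μ.real K ≤ 0 := by
    refine ge_of_tendsto (x := 𝓝[>] (0 : ℝ)) (f := fun ε => C * ε * ∫ x, g x ∂μ) ?_
      (by filter_upwards [self_mem_nhdsWithin] with ε hε using key ε hε)
    have : Continuous fun ε : ℝ => C * ε * ∫ x, g x ∂μ := by fun_prop
    simpa using (this.tendsto 0).mono_left nhdsWithin_le_nhds
  rw [measureReal_def] at hle
  exact ((ENNReal.toReal_eq_zero_iff _).1 (le_antisymm hle ENNReal.toReal_nonneg)).resolve_right
    hK.measure_lt_top.ne

theorem map_inv_absolutelyContinuous_haar (lam : Measure G) [IsFiniteMeasure lam] [lam.Regular]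
    (h : lam ≪ Measure.haar) : lam.map Inv.inv ≪ Measure.haar := by
  refine Measure.AbsolutelyContinuous.mk fun A hA h0 => ?_
  rw [Measure.map_apply measurable_inv hA]
  have hA' : MeasurableSet (Inv.inv ⁻¹' A) := measurable_inv hA
  rw [hA'.measure_eq_iSup_isCompact_of_ne_top (measure_ne_top _ _)]
  simp only [ENNReal.iSup_eq_zero]
  intro K hKA hK
  refine h (haar_eq_zero_of_isCompact_inv hK (measure_mono_null ?_ h0))
  intro x hx
  simpa using hKA hx

end Haar

section Linearity

variable {G : Type*} [TopologicalSpace G] [MeasurableSpace G] [T2Space G]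
  [LocallyCompactSpace G] [BorelSpace G]

theorem integrable_variation (μ : MG G) {f : G → ℂ} (hf : Continuous f) {C : ℝ}
    (hC : ∀ x, ‖f x‖ ≤ C) : (μ : ComplexMeasure G).Integrable f :=
  integrable_of_continuous _ hf hC

theorem cintegral_add_measure (μ ν : MG G) {f : G → ℂ} (hf : Continuous f) {C : ℝ}
    (hC : ∀ x, ‖f x‖ ≤ C) : cintegral ((μ + ν : MG G) : ComplexMeasure G) f =
      cintegral (μ : ComplexMeasure G) f + cintegral (ν : ComplexMeasure G) f :=
  VectorMeasure.integral_add_vectorMeasure (integrable_variation μ hf hC)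
    (integrable_variation ν hf hC)

theorem cintegral_smul_measure (c : ℂ) (μ : MG G) {f : G → ℂ} (hf : Continuous f) {C : ℝ}
    (hC : ∀ x, ‖f x‖ ≤ C) : cintegral ((c • μ : MG G) : ComplexMeasure G) f =
      c * cintegral (μ : ComplexMeasure G) f := by
  obtain ⟨h, hm, h1, hμ⟩ := exists_unimodular_density (μ : ComplexMeasure G)
  have hh : Integrable h (μ : ComplexMeasure G).variation :=
    .of_bound hm.aestronglyMeasurable 1 (.of_forall fun x => (h1 x).le)
  have hsmul : ((c • μ : MG G) : ComplexMeasure G) =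
      (μ : ComplexMeasure G).variation.withDensityᵥ (c • h) := by
    rw [withDensityᵥ_smul, ← hμ]; rfl
  have hint : ∀ g : G → ℂ, Integrable g (μ : ComplexMeasure G).variation →
      Integrable f ((μ : ComplexMeasure G).variation.withDensity fun x => ‖g x‖ₑ) := fun g hg =>
    have : IsFiniteMeasure ((μ : ComplexMeasure G).variation.withDensity fun x => ‖g x‖ₑ) :=
      ⟨by simpa using! hg.2⟩
    .of_bound ((aestronglyMeasurable_of_continuous _ hf).mono_ac
      (withDensity_absolutelyContinuous _ _)) C (.of_forall hC)
  have e1 := cintegral_withDensity (hh.smul c) (hint _ (hh.smul c))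
  have e2 := cintegral_withDensity hh (hint _ hh)
  rw [← hsmul] at e1
  rw [← hμ] at e2
  rw [cintegral, cintegral, e1, e2, ← integral_const_mul]
  congr 1 with x
  simp only [Pi.smul_apply, smul_eq_mul]
  ring

theorem norm_cintegral_le (μ : MG G) {f : G → ℂ} {C : ℝ} (hC : ∀ x, ‖f x‖ ≤ C) :
    ‖cintegral (μ : ComplexMeasure G) f‖ ≤ C * mnorm μ := by
  obtain ⟨h, -, h1, hμ⟩ := exists_polar μ
  rw [hμ]
  refine (norm_integral_le_of_norm_le_const (C := C) (.of_forall fun x => ?_)).trans_eq ?_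
  · simpa [h1] using hC x
  · rfl

end Linearity

section Convolution

variable {G : Type*} [TopologicalSpace G] [MeasurableSpace G] [T2Space G]
  [LocallyCompactSpace G] [BorelSpace G]

theorem continuous_integral_of_bounded (lam : Measure G) [IsFiniteMeasure lam] [lam.Regular]
    {Y : Type*} [TopologicalSpace Y] {f : Y → G → ℂ} (hf : Continuous (Function.uncurry f)) {C : ℝ}
    (hC : ∀ y x, ‖f y x‖ ≤ C) {h : G → ℂ} (hm : Measurable h) (h1 : ∀ x, ‖h x‖ ≤ 1) :
    Continuous fun y => ∫ x, f y x * h x ∂lam := by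
  have hfy : ∀ y, Continuous (f y) := fun y => hf.comp (Continuous.prodMk_right y)
  have hint : ∀ y, Integrable (fun x => f y x * h x) lam := fun y =>
    (integrable_of_continuous lam (hfy y) (hC y)).mul_bdd hm.aestronglyMeasurable (.of_forall h1)
  refine continuous_iff_continuousAt.2 fun y₀ => Metric.tendsto_nhds.2 fun ε hε => ?_
  have hC0 : 0 ≤ 2 * |C| := by positivity
  set M := lam.real univ
  have hM : 0 ≤ M := measureReal_nonneg
  obtain ⟨K, hK, hKlt⟩ := exists_isCompact_compl_lt lam (ε := ε / (2 * (2 * |C| + 1)))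
    (by positivity)
  have hev : ∀ᶠ y in 𝓝 y₀, ∀ x ∈ K, ‖f y x - f y₀ x‖ < ε / (2 * (M + 1)) := by
    refine hK.eventually_forall_of_forall_eventually fun x _ => ?_
    have hcont : Continuous fun p : Y × G => ‖f p.1 p.2 - f y₀ p.2‖ :=
      (hf.sub ((hfy y₀).comp continuous_snd)).norm
    refine hcont.continuousAt.eventually (gt_mem_nhds ?_)
    simp only [sub_self, norm_zero]
    positivity
  filter_upwards [hev] with y hy
  rw [dist_eq_norm, ← integral_sub (hint y) (hint y₀)]
  have hpt : ∀ x, ‖f y x * h x - f y₀ x * h x‖ ≤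
      ε / (2 * (M + 1)) + Kᶜ.indicator (fun _ => 2 * |C|) x := by
    intro x
    rw [← sub_mul, norm_mul]
    refine (mul_le_of_le_one_right (norm_nonneg _) (h1 x)).trans ?_
    by_cases hx : x ∈ K
    · simpa [hx] using (hy x hx).le
    · have h2 := (norm_sub_le (f y x) (f y₀ x)).trans (add_le_add (hC y x) (hC y₀ x))
      have h3 := le_abs_self C
      have h4 : 0 ≤ ε / (2 * (M + 1)) := by positivity
      simp only [mem_compl_iff, hx, not_false_eq_true, indicator_of_mem]
      linarith
  have hKm : MeasurableSet Kᶜ := hK.measurableSet.compl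
  have hi1 : Integrable (fun _ : G => ε / (2 * (M + 1))) lam := integrable_const _
  have hi2 : Integrable (Kᶜ.indicator fun _ => 2 * |C|) lam :=
    (integrable_const _).indicator hKm
  refine ((norm_integral_le_integral_norm _).trans
    (integral_mono ((hint y).sub (hint y₀)).norm (hi1.add hi2) hpt)).trans_lt ?_
  simp only [Pi.add_apply]
  rw [integral_add hi1 hi2, integral_indicator hKm, setIntegral_const, integral_const,
    smul_eq_mul, smul_eq_mul]
  have e1 : M * (ε / (2 * (M + 1))) < ε / 2 := by
    rw [mul_div_assoc', div_lt_div_iff₀ (by positivity) (by norm_num)]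
    nlinarith
  have e2 : lam.real Kᶜ * (2 * |C|) ≤ ε / 2 := by
    have : lam.real Kᶜ * (2 * |C| + 1) < ε / 2 := by
      calc lam.real Kᶜ * (2 * |C| + 1) < ε / (2 * (2 * |C| + 1)) * (2 * |C| + 1) :=
            mul_lt_mul_of_pos_right hKlt (by positivity)
        _ = ε / 2 := by field_simp
    have h5 : 0 ≤ lam.real Kᶜ := measureReal_nonneg
    nlinarith
  linarith

end Convolution

section

open scoped Pointwise

section Convolution

variable {G : Type*} [TopologicalSpace G] [MeasurableSpace G] [T2Space G]
  [LocallyCompactSpace G] [BorelSpace G] [Group G] [IsTopologicalGroup G]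

theorem continuous_cintegral_mul (μ : MG G) {φ : G → ℂ} (hφ : Continuous φ) {C : ℝ}
    (hC : ∀ x, ‖φ x‖ ≤ C) :
    Continuous fun t => cintegral (μ : ComplexMeasure G) fun s => φ (s * t) := by
  obtain ⟨h, hm, h1, hμ⟩ := exists_polar μ
  simp only [hμ]
  exact continuous_integral_of_bounded _ (f := fun t s => φ (s * t))
    (hφ.comp (continuous_snd.mul continuous_fst)) (fun _ _ => hC _) hm fun x => (h1 x).le

theorem cintegral_sub {μ : MG G} {f g : G → ℂ} (hf : Continuous f) (hg : Continuous g) {C D : ℝ}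
    (hC : ∀ x, ‖f x‖ ≤ C) (hD : ∀ x, ‖g x‖ ≤ D) :
    cintegral (μ : ComplexMeasure G) (fun x => f x - g x) =
      cintegral (μ : ComplexMeasure G) f - cintegral (μ : ComplexMeasure G) g :=
  VectorMeasure.integral_fun_sub (integrable_variation μ hf hC) (integrable_variation μ hg hD)

/-- A bound for the integral of a function that is small on a set. -/
theorem norm_cintegral_le_of_small (μ : MG G) {f : G → ℂ} (hf : Continuous f) {K : Set G}
    (hK : MeasurableSet K) {C δ : ℝ} (hδ : 0 ≤ δ) (hC : ∀ x, ‖f x‖ ≤ C)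
    (hKδ : ∀ x ∈ K, ‖f x‖ ≤ δ) :
    ‖cintegral (μ : ComplexMeasure G) f‖ ≤
      δ * mnorm μ + C * (μ : ComplexMeasure G).variation.real Kᶜ := by
  obtain ⟨h, hm, h1, hμ⟩ := exists_polar μ
  set lam := (μ : ComplexMeasure G).variation
  rw [hμ]
  have hi1 : Integrable (fun _ : G => δ) lam := integrable_const _
  have hi2 : Integrable (Kᶜ.indicator fun _ => C) lam := (integrable_const _).indicator hK.compl
  refine (norm_integral_le_integral_norm _).trans ?_
  have hpt : ∀ x, ‖f x * h x‖ ≤ δ + Kᶜ.indicator (fun _ => C) x := by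
    intro x
    rw [norm_mul, h1, mul_one]
    by_cases hx : x ∈ K
    · simpa [hx] using hKδ x hx
    · simpa [hx] using (hC x).trans (le_add_of_nonneg_left hδ)
  refine (integral_mono (((integrable_of_continuous lam hf hC).mul_bdd
    hm.aestronglyMeasurable (.of_forall fun x => (h1 x).le)).norm) (hi1.add hi2) hpt).trans_eq ?_
  simp only [Pi.add_apply]
  rw [integral_add hi1 hi2, integral_indicator hK.compl, setIntegral_const, integral_const,
    smul_eq_mul, smul_eq_mul, mul_comm, mul_comm C]
  rfl

theorem mnorm_nonneg (μ : MG G) : 0 ≤ mnorm μ := ENNReal.toReal_nonneg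

/-- An identity of convolution type extends from compactly supported to bounded functions. -/
theorem convolution_identity_of_hasCompactSupport {μ ν ρ : MG G}
    (h : ∀ φ : G → ℂ, Continuous φ → HasCompactSupport φ →
      cintegral (ρ : ComplexMeasure G) φ = cintegral (ν : ComplexMeasure G) fun t =>
        cintegral (μ : ComplexMeasure G) fun s => φ (s * t))
    {φ : G → ℂ} (hφ : Continuous φ) {C : ℝ} (hC : ∀ x, ‖φ x‖ ≤ C) :
    cintegral (ρ : ComplexMeasure G) φ = cintegral (ν : ComplexMeasure G) fun t =>
        cintegral (μ : ComplexMeasure G) fun s => φ (s * t) := by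
  have hC0 : 0 ≤ C := (norm_nonneg _).trans (hC 1)
  have key : ∀ ε : ℝ, 0 < ε → ‖cintegral (ρ : ComplexMeasure G) φ -
      cintegral (ν : ComplexMeasure G) fun t =>
        cintegral (μ : ComplexMeasure G) fun s => φ (s * t)‖ ≤
      C * ε + (C * ε * mnorm ν + C * mnorm μ * ε) := by
    intro ε hε
    obtain ⟨K₁, hK₁, h₁⟩ := exists_isCompact_compl_lt (μ : ComplexMeasure G).variation hε
    obtain ⟨K₂, hK₂, h₂⟩ := exists_isCompact_compl_lt (ν : ComplexMeasure G).variation hε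
    obtain ⟨K₃, hK₃, h₃⟩ := exists_isCompact_compl_lt (ρ : ComplexMeasure G).variation hε
    obtain ⟨χ, hχ1, -, hχc, hχ⟩ := exists_continuous_one_zero_of_isCompact
      ((hK₁.mul hK₂).union hK₃) isClosed_empty (disjoint_empty _)
    set ψ : G → ℂ := fun x => φ x * (χ x : ℂ) with hψdef
    have hψ : Continuous ψ := hφ.mul (Complex.continuous_ofReal.comp χ.continuous)
    have hψc : HasCompactSupport ψ :=
      (hχc.comp_left (g := fun r : ℝ => (r : ℂ)) Complex.ofReal_zero).mul_left
    have hψC : ∀ x, ‖ψ x‖ ≤ C := fun x => by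
      rw [hψdef, norm_mul, Complex.norm_real, Real.norm_of_nonneg (hχ x).1]
      exact (mul_le_of_le_one_right (norm_nonneg _) (hχ x).2).trans (hC x)
    have hdC : ∀ x, ‖φ x - ψ x‖ ≤ C := fun x => by
      have : φ x - ψ x = φ x * ((1 - χ x : ℝ) : ℂ) := by
        simp only [hψdef]; push_cast; ring
      rw [this, norm_mul, Complex.norm_real, Real.norm_of_nonneg (by linarith [(hχ x).2])]
      exact (mul_le_of_le_one_right (norm_nonneg _) (by linarith [(hχ x).1])).trans (hC x)
    have hd0 : ∀ x ∈ K₁ * K₂ ∪ K₃, φ x - ψ x = 0 := fun x hx => by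
      simp [hψdef, hχ1 hx]
    have hd : Continuous fun x => φ x - ψ x := hφ.sub hψ
    have hF : ∀ t, ‖cintegral (μ : ComplexMeasure G) fun s => φ (s * t) - ψ (s * t)‖ ≤
        C * mnorm μ := fun t => norm_cintegral_le μ fun s => hdC _
    have e1 : ‖cintegral (ρ : ComplexMeasure G) fun x => φ x - ψ x‖ ≤ C * ε := by
      refine (norm_cintegral_le_of_small ρ hd hK₃.measurableSet le_rfl hdC fun x hx => ?_).trans ?_
      · simp [hd0 x (Or.inr hx)]
      · rw [zero_mul, zero_add]
        exact mul_le_mul_of_nonneg_left h₃.le hC0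
    have e2 : ‖cintegral (ν : ComplexMeasure G) fun t =>
        cintegral (μ : ComplexMeasure G) fun s => φ (s * t) - ψ (s * t)‖ ≤
        C * ε * mnorm ν + C * mnorm μ * ε := by
      refine (norm_cintegral_le_of_small ν (continuous_cintegral_mul μ hd hdC)
        hK₂.measurableSet (by positivity : 0 ≤ C * ε) hF fun t ht => ?_).trans ?_
      · refine (norm_cintegral_le_of_small μ (f := fun s => φ (s * t) - ψ (s * t))
          (hd.comp (continuous_mul_const t))
          hK₁.measurableSet le_rfl (fun _ => hdC _) fun s hs => ?_).trans ?_
        · simp [hd0 _ (Or.inl (mul_mem_mul hs ht))]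
        · rw [zero_mul, zero_add]
          exact mul_le_mul_of_nonneg_left h₁.le hC0
      · have := mnorm_nonneg μ
        gcongr
    have e3 : (cintegral (ν : ComplexMeasure G) fun t =>
        cintegral (μ : ComplexMeasure G) fun s => φ (s * t) - ψ (s * t)) =
        (cintegral (ν : ComplexMeasure G) fun t =>
          cintegral (μ : ComplexMeasure G) fun s => φ (s * t)) -
        cintegral (ν : ComplexMeasure G) fun t =>
          cintegral (μ : ComplexMeasure G) fun s => ψ (s * t) := by
      rw [← cintegral_sub (continuous_cintegral_mul μ hφ hC) (continuous_cintegral_mul μ hψ hψC)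
        (fun t => norm_cintegral_le μ fun s => hC _) (fun t => norm_cintegral_le μ fun s => hψC _)]
      congr 1 with t
      exact cintegral_sub (hφ.comp (continuous_mul_const t)) (hψ.comp (continuous_mul_const t))
        (fun _ => hC _) (fun _ => hψC _)
    rw [cintegral_sub hφ hψ hC hψC] at e1
    rw [e3] at e2
    rw [h ψ hψ hψc] at e1
    refine le_trans (le_of_eq ?_) ((norm_add_le _ _).trans (add_le_add e1
      ((norm_neg _).trans_le e2)))
    congr 1
    ring
  rw [← sub_eq_zero, ← norm_le_zero_iff]
  refine ge_of_tendsto (x := 𝓝[>] (0 : ℝ))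
    (f := fun ε => C * ε + (C * ε * mnorm ν + C * mnorm μ * ε)) ?_
      (by filter_upwards [self_mem_nhdsWithin] with ε hε using key ε hε)
  have : Continuous fun ε : ℝ => C * ε + (C * ε * mnorm ν + C * mnorm μ * ε) := by fun_prop
  simpa using (this.tendsto 0).mono_left nhdsWithin_le_nhds

theorem IsConvolution.integral_eq {μ ν ρ : MG G} (h : IsConvolution μ ν ρ) {φ : G → ℂ}
    (hφ : Continuous φ) {C : ℝ} (hC : ∀ x, ‖φ x‖ ≤ C) :
    cintegral (ρ : ComplexMeasure G) φ = cintegral (ν : ComplexMeasure G) fun t =>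
        cintegral (μ : ComplexMeasure G) fun s => φ (s * t) :=
  convolution_identity_of_hasCompactSupport (fun ψ hψ hψc =>
    h ⟨⟨ψ, hψ⟩, hψc.is_zero_at_infty⟩) hφ hC

/-- The convolution of two positive measures, obtained from the Riesz representation theorem. -/
theorem exists_convolution_of_pos (m n : Measure G) [IsFiniteMeasure m] [m.Regular]
    [IsFiniteMeasure n] [n.Regular] : ∃ ρ : Measure G, IsFiniteMeasure ρ ∧ ρ.Regular ∧
      ∀ φ : G → ℂ, Continuous φ → HasCompactSupport φ →
        ∫ x, φ x ∂ρ = ∫ t, ∫ s, φ (s * t) ∂m ∂n := by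
  have hbdd : ∀ φ : CompactlySupportedContinuousMap G ℝ, ∃ C, ∀ x, ‖φ x‖ ≤ C := fun φ =>
    φ.hasCompactSupport.exists_bound_of_continuous φ.continuous
  have hint1 : ∀ (φ : CompactlySupportedContinuousMap G ℝ) (t : G),
      Integrable (fun s => φ (s * t)) m := fun φ t => by
    obtain ⟨C, hC⟩ := hbdd φ
    exact integrable_of_continuous m (φ.continuous.comp (continuous_mul_const t)) fun x => hC _
  have hint2 : ∀ (φ : CompactlySupportedContinuousMap G ℝ),
      Integrable (fun t => ∫ s, φ (s * t) ∂m) n := fun φ => by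
    obtain ⟨C, hC⟩ := hbdd φ
    have hc := continuous_integral_of_bounded m (f := fun t s => ((φ (s * t) : ℝ) : ℂ))
      (Complex.continuous_ofReal.comp (φ.continuous.comp (continuous_snd.mul continuous_fst)))
      (C := C) (fun t s => by simpa using hC (s * t)) (h := fun _ => 1) measurable_const (by simp)
    simp only [mul_one, integral_complex_ofReal] at hc
    refine integrable_of_continuous n (C := C * m.real univ) (Complex.continuous_re.comp hc) fun t => ?_
    exact norm_integral_le_of_norm_le_const (.of_forall fun s => hC _)
  let Λ : CompactlySupportedContinuousMap G ℝ →ₚ[ℝ] ℝ := PositiveLinearMap.mk₀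
    { toFun := fun φ => ∫ t, ∫ s, φ (s * t) ∂m ∂n
      map_add' := fun φ ψ => by
        rw [← integral_add (hint2 φ) (hint2 ψ)]
        congr 1 with t
        rw [← integral_add (hint1 φ t) (hint1 ψ t)]
        rfl
      map_smul' := fun c φ => by
        simp only [CompactlySupportedContinuousMap.smul_apply, smul_eq_mul, integral_const_mul,
          RingHom.id_apply] }
    fun φ hφ => integral_nonneg fun t => integral_nonneg fun s => hφ _
  have hΛ : ∀ φ, Λ φ = ∫ t, ∫ s, φ (s * t) ∂m ∂n := fun φ => rfl
  set ρ := RealRMK.rieszMeasure Λ with hρ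
  have hfin : IsFiniteMeasure ρ := by
    refine ⟨lt_of_le_of_lt (b := ENNReal.ofReal (m.real univ * n.real univ)) ?_
      ENNReal.ofReal_lt_top⟩
    rw [isOpen_univ.measure_eq_iSup_isCompact]
    refine iSup₂_le fun K _ => iSup_le fun hK => ?_
    obtain ⟨χ, hχ1, -, hχc, hχ⟩ := exists_continuous_one_zero_of_isCompact
      hK isClosed_empty (disjoint_empty _)
    let χ' : CompactlySupportedContinuousMap G ℝ := ⟨χ, hχc⟩
    refine (RealRMK.rieszMeasure_le_of_eq_one Λ (f := χ') (fun x => (hχ x).1) hK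
      fun x hx => hχ1 hx).trans (ENNReal.ofReal_le_ofReal ?_)
    rw [hΛ]
    have h1 : ∀ t, ‖∫ s, χ' (s * t) ∂m‖ ≤ 1 * m.real univ := fun t =>
      norm_integral_le_of_norm_le_const (.of_forall fun s => (Real.norm_of_nonneg (hχ (s * t)).1).trans_le (hχ (s * t)).2)
    refine (le_abs_self _).trans ((norm_integral_le_of_norm_le_const (.of_forall h1)).trans_eq ?_)
    rw [one_mul]
  refine ⟨ρ, hfin, inferInstance, fun φ hφ hφc => ?_⟩
  obtain ⟨C, hC⟩ := hφc.exists_bound_of_continuous hφ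
  let φr : CompactlySupportedContinuousMap G ℝ :=
    ⟨⟨fun x => (φ x).re, Complex.continuous_re.comp hφ⟩, hφc.comp_left Complex.zero_re⟩
  let φi : CompactlySupportedContinuousMap G ℝ :=
    ⟨⟨fun x => (φ x).im, Complex.continuous_im.comp hφ⟩, hφc.comp_left Complex.zero_im⟩
  have hsplit : ∀ x, φ x = ((φr x : ℝ) : ℂ) + ((φi x : ℝ) : ℂ) * Complex.I := fun x =>
    (Complex.re_add_im (φ x)).symm
  have hρi : ∀ ψ : CompactlySupportedContinuousMap G ℝ, Integrable (fun x => ψ x) ρ := fun ψ => by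
    obtain ⟨C, hC⟩ := hbdd ψ
    exact integrable_of_continuous ρ ψ.continuous hC
  simp only [hsplit]
  rw [integral_add (hρi φr).ofReal ((hρi φi).ofReal.mul_const _), integral_mul_const,
    integral_complex_ofReal, integral_complex_ofReal, RealRMK.integral_rieszMeasure, RealRMK.integral_rieszMeasure,
    hΛ, hΛ]
  have h1 : ∀ t, ∫ s, (((φr (s * t) : ℝ) : ℂ) + ((φi (s * t) : ℝ) : ℂ) * Complex.I) ∂m =
      ((∫ s, φr (s * t) ∂m : ℝ) : ℂ) + ((∫ s, φi (s * t) ∂m : ℝ) : ℂ) * Complex.I := fun t => by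
    rw [integral_add (hint1 φr t).ofReal ((hint1 φi t).ofReal.mul_const _), integral_mul_const,
      integral_complex_ofReal, integral_complex_ofReal]
  simp only [h1]
  rw [integral_add (hint2 φr).ofReal ((hint2 φi).ofReal.mul_const _), integral_mul_const,
      integral_complex_ofReal, integral_complex_ofReal]

/-- A complex measure is a combination of four positive measures. -/
theorem exists_pos_decomposition (μ : MG G) : ∃ (c : Fin 4 → ℂ) (m : Fin 4 → Measure G),
    (∀ k, IsFiniteMeasure (m k)) ∧ (∀ k, (m k).Regular) ∧ ∀ f : G → ℂ, Continuous f →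
      (∃ C, ∀ x, ‖f x‖ ≤ C) →
      cintegral (μ : ComplexMeasure G) f = ∑ k, c k * ∫ x, f x ∂(m k) := by
  obtain ⟨h, hm, h1, hμ⟩ := exists_polar μ
  set lam := (μ : ComplexMeasure G).variation
  have hre : ∀ x, |(h x).re| ≤ 1 := fun x => (Complex.abs_re_le_norm _).trans (h1 x).le
  have him : ∀ x, |(h x).im| ≤ 1 := fun x => (Complex.abs_im_le_norm _).trans (h1 x).le
  let p : Fin 4 → G → NNReal := ![fun x => (h x).re.toNNReal, fun x => (-(h x).re).toNNReal,
    fun x => (h x).im.toNNReal, fun x => (-(h x).im).toNNReal]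
  have hre' := Complex.measurable_re.comp hm
  have him' := Complex.measurable_im.comp hm
  have hpm : ∀ k, Measurable (p k) := by
    intro k
    fin_cases k
    · exact hre'.real_toNNReal
    · exact hre'.neg.real_toNNReal
    · exact him'.real_toNNReal
    · exact him'.neg.real_toNNReal
  have hp1 : ∀ k x, p k x ≤ 1 := by
    intro k x
    have := abs_le.1 (hre x)
    have := abs_le.1 (him x)
    fin_cases k <;> simp [p, Real.toNNReal_le_one] <;> linarith
  have hfin : ∀ k, IsFiniteMeasure (lam.withDensity fun x => p k x) := fun k =>
    ⟨by
      rw [withDensity_apply _ MeasurableSet.univ]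
      refine (lintegral_mono (g := fun _ => 1) fun x => ?_).trans_lt (by simp)
      exact ENNReal.coe_le_one_iff.2 (hp1 k x)⟩
  refine ⟨![1, -1, Complex.I, -Complex.I], fun k => lam.withDensity fun x => p k x, hfin,
    fun k => regular_of_absolutelyContinuous (withDensity_absolutelyContinuous lam _),
    fun f hf ⟨C, hC⟩ => ?_⟩
  have hfi : Integrable f lam := integrable_of_continuous lam hf hC
  have hi : ∀ k, Integrable (fun x => p k x • f x) lam := fun k => by
    have : Integrable (fun x => f x * (((p k x : NNReal) : ℝ) : ℂ)) lam :=
      hfi.mul_bdd (c := 1) (Complex.measurable_ofReal.comp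
        (hpm k).coe_nnreal_real).aestronglyMeasurable (.of_forall fun x => by
          rw [Complex.norm_real, Real.norm_of_nonneg (NNReal.coe_nonneg _)]
          exact_mod_cast hp1 k x)
    refine this.congr (.of_forall fun x => ?_)
    simp [NNReal.smul_def, mul_comm]
  have hint : ∀ k, ∫ x, f x ∂(lam.withDensity fun x => p k x) = ∫ x, p k x • f x ∂lam := fun k =>
    integral_withDensity_eq_integral_smul (hpm k) f
  rw [hμ]
  simp only [hint, ← integral_const_mul]
  rw [← integral_finsetSum _ fun k _ => (hi k).const_mul _]
  congr 1 with x
  have r1 : ((max (h x).re 0 : ℝ) : ℂ) - ((max (-(h x).re) 0 : ℝ) : ℂ) = ((h x).re : ℂ) := by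
    rw [← Complex.ofReal_sub, max_zero_sub_max_neg_zero_eq_self]
  have r2 : ((max (h x).im 0 : ℝ) : ℂ) - ((max (-(h x).im) 0 : ℝ) : ℂ) = ((h x).im : ℂ) := by
    rw [← Complex.ofReal_sub, max_zero_sub_max_neg_zero_eq_self]
  have r3 := Complex.re_add_im (h x)
  rw [Fin.sum_univ_four]
  change f x * h x = 1 * ((((max (h x).re 0 : ℝ)) : ℂ) * f x) +
    -1 * (((max (-(h x).re) 0 : ℝ) : ℂ) * f x) +
    Complex.I * (((max (h x).im 0 : ℝ) : ℂ) * f x) +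
    -Complex.I * (((max (-(h x).im) 0 : ℝ) : ℂ) * f x)
  conv_lhs => rw [← r3, ← r1, ← r2]
  ring

theorem exists_isConvolution (μ ν : MG G) : ∃ ρ : MG G, IsConvolution μ ν ρ := by
  obtain ⟨c, m, hm, hm', hμ⟩ := exists_pos_decomposition μ
  obtain ⟨d, n, hn, hn', hν⟩ := exists_pos_decomposition ν
  choose r hr hr' hrφ using fun k l => exists_convolution_of_pos (m k) (n l)
  choose σ _ hσ using fun k l => exists_density (r k l) (g := fun _ => 1) (integrable_const 1)
  have hadd : ∀ (s : Finset (Fin 4 × Fin 4)) (f : G → ℂ), Continuous f → (∃ C, ∀ x, ‖f x‖ ≤ C) →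
      cintegral ((∑ p ∈ s, (c p.1 * d p.2) • σ p.1 p.2 : MG G) : ComplexMeasure G) f =
        ∑ p ∈ s, c p.1 * d p.2 * cintegral (σ p.1 p.2 : ComplexMeasure G) f := by
    rintro s f hf ⟨C, hC⟩
    induction s using Finset.induction_on with
    | empty =>
      have := cintegral_smul_measure 0 (0 : MG G) hf hC
      simpa using this
    | insert p s hp ih =>
      rw [Finset.sum_insert hp, Finset.sum_insert hp, cintegral_add_measure _ _ hf hC, ih,
        cintegral_smul_measure _ _ hf hC]
  refine ⟨∑ p : Fin 4 × Fin 4, (c p.1 * d p.2) • σ p.1 p.2, fun φ => ?_⟩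
  have hbdd : ∀ f : G → ℂ, Continuous f → HasCompactSupport f → ∃ C, ∀ x, ‖f x‖ ≤ C :=
    fun f hf hfc => hfc.exists_bound_of_continuous hf
  obtain ⟨C, hC⟩ : ∃ C, ∀ x, ‖φ x‖ ≤ C := ⟨‖φ.toBCF‖, φ.toBCF.norm_coe_le_norm⟩
  refine convolution_identity_of_hasCompactSupport (fun ψ hψ hψc => ?_) φ.continuous hC
  obtain ⟨D, hD⟩ := hbdd ψ hψ hψc
  rw [hadd _ _ hψ ⟨D, hD⟩, hν _ (continuous_cintegral_mul μ hψ hD)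
    ⟨_, fun t => norm_cintegral_le μ fun s => hD _⟩, ← Finset.univ_product_univ,
    Finset.sum_product_right]
  refine Finset.sum_congr rfl fun l _ => ?_
  have hinner : ∀ k, Continuous fun t => ∫ s, ψ (s * t) ∂(m k) := fun k => by
    have := continuous_integral_of_bounded (m k) (f := fun t s => ψ (s * t))
      (hψ.comp (continuous_snd.mul continuous_fst)) (fun _ _ => hD _)
      (h := fun _ => 1) measurable_const (by simp)
    simpa using this
  have e : ∀ t, cintegral (μ : ComplexMeasure G) (fun s => ψ (s * t)) =
      ∑ k, c k * ∫ s, ψ (s * t) ∂(m k) := fun t =>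
    hμ _ (hψ.comp (continuous_mul_const t)) ⟨D, fun _ => hD _⟩
  simp only [e]
  rw [integral_finsetSum _ fun k _ => ?_]
  · rw [Finset.mul_sum]
    refine Finset.sum_congr rfl fun k _ => ?_
    rw [hσ k l ψ (aestronglyMeasurable_of_continuous _ hψ) ⟨D, hD⟩, integral_const_mul,
      ← hrφ k l ψ hψ hψc]
    simp only [mul_one]
    ring
  · exact (integrable_of_continuous (n l) (hinner k) (C := D * (m k).real univ) fun t =>
      norm_integral_le_of_norm_le_const (.of_forall fun s => hD _)).const_mul _

end Convolution

end

section Matrices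

open WithCStarModule CStarModule
open scoped NNReal

variable {H : Type*} [NormedAddCommGroup H] [InnerProductSpace ℂ H] [CompleteSpace H]
variable {p q : Type*} [Fintype p] [Fintype q]

theorem norm_sq_complex_column (v : WithCStarModule ℂ (p → ℂ)) : ‖v‖ ^ 2 = ∑ i, ‖v i‖ ^ 2 := by
  rw [pi_norm_sq]
  have : ∑ i, inner ℂ (v i) (v i) = ((∑ i, ‖v i‖ ^ 2 : ℝ) : ℂ) := by
    push_cast
    refine Finset.sum_congr rfl fun i _ => ?_
    exact Complex.mul_conj' (v i)
  refine (congrArg norm this).trans ?_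
  rw [Complex.norm_real, Real.norm_of_nonneg (by positivity)]

theorem sum_row_sq_le (M : CStarMatrix p q ℂ) (k : p) : ∑ l, ‖M k l‖ ^ 2 ≤ ‖M‖ ^ 2 := by
  classical
  have h := (CStarMatrix.toCLM M).le_opNorm
    ((WithCStarModule.equiv ℂ (p → ℂ)).symm (Pi.single k 1))
  rw [CStarMatrix.toCLM_apply_single, ← CStarMatrix.norm_def, norm_single, norm_one, mul_one] at h
  have h2 := pow_le_pow_left₀ (norm_nonneg _) h 2
  rw [norm_sq_complex_column] at h2
  simpa using h2

theorem sum_column_sq_le (M : CStarMatrix p q ℂ) (l : q) : ∑ k, ‖M k l‖ ^ 2 ≤ ‖M‖ ^ 2 := by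
  set S := ∑ k, ‖M k l‖ ^ 2 with hS
  have hS0 : 0 ≤ S := by positivity
  let v : WithCStarModule ℂ (p → ℂ) := (WithCStarModule.equiv ℂ (p → ℂ)).symm
    fun k => star (M k l)
  have hv : ‖v‖ ^ 2 = S := by
    rw [norm_sq_complex_column]
    simp [v, hS]
  have h := (CStarMatrix.toCLM M).le_opNorm v
  have h1 := (norm_apply_le_norm (CStarMatrix.toCLM M v) l).trans h
  have h2 : (CStarMatrix.toCLM M v) l = (S : ℂ) := by
    rw [CStarMatrix.toCLM_apply_eq_sum]
    simp only [equiv_symm_pi_apply, v, hS, Complex.ofReal_sum]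
    refine Finset.sum_congr rfl fun k _ => ?_
    push_cast
    exact Complex.conj_mul' (M k l)
  rw [h2, ← CStarMatrix.norm_def, Complex.norm_real, Real.norm_of_nonneg hS0] at h1
  have h3 : S * S ≤ ‖M‖ ^ 2 * S := by
    calc S * S ≤ (‖M‖ * ‖v‖) * (‖M‖ * ‖v‖) := mul_self_le_mul_self hS0 h1
      _ = ‖M‖ ^ 2 * ‖v‖ ^ 2 := by ring
      _ = _ := by rw [hv]
  rcases hS0.eq_or_lt with h0 | h0
  · rw [← h0]; positivity
  · exact le_of_mul_le_mul_right h3 h0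

variable {m : ℕ}

/-- A matrix with one nonzero row. -/
noncomputable def rowMatrix (i₀ : Fin m) (a : Fin m → BH H) :
    CStarMatrix (Fin m) (Fin m) (BH H) :=
  CStarMatrix.ofMatrix (Matrix.of fun i j => if i = i₀ then a j else 0)

theorem norm_rowMatrix_le (i₀ : Fin m) (a : Fin m → BH H) :
    ‖rowMatrix i₀ a‖ ≤ √‖∑ j, a j * star (a j)‖ := by
  rw [CStarMatrix.norm_def]
  refine ContinuousLinearMap.opNorm_le_bound _ (Real.sqrt_nonneg _) fun v => ?_
  have hv : CStarMatrix.toCLM (rowMatrix i₀ a) v =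
      (WithCStarModule.equiv _ _).symm fun j => v i₀ * a j := by
    rw [CStarMatrix.toCLM_apply_eq_sum]
    congr 1 with j
    simp [rowMatrix, CStarMatrix.ofMatrix_apply, mul_ite]
  have h1 : ‖CStarMatrix.toCLM (rowMatrix i₀ a) v‖ ^ 2 ≤
      ‖∑ j, a j * star (a j)‖ * ‖v‖ ^ 2 := by
    rw [hv, pi_norm_sq]
    have : ∑ j, inner (BH H) (((WithCStarModule.equiv (BH H) (Fin m → BH H)).symm
        fun j => v i₀ * a j) j) (((WithCStarModule.equiv (BH H) (Fin m → BH H)).symm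
        fun j => v i₀ * a j) j) = v i₀ * (∑ j, a j * star (a j)) * star (v i₀) := by
      rw [Finset.mul_sum, Finset.sum_mul]
      refine Finset.sum_congr rfl fun j _ => ?_
      simp only [equiv_symm_pi_apply, inner_def, star_mul, mul_assoc]
    rw [this]
    calc ‖v i₀ * (∑ j, a j * star (a j)) * star (v i₀)‖
        ≤ ‖v i₀‖ * ‖∑ j, a j * star (a j)‖ * ‖star (v i₀)‖ :=
          (norm_mul_le _ _).trans (mul_le_mul_of_nonneg_right (norm_mul_le _ _) (norm_nonneg _))
      _ = ‖∑ j, a j * star (a j)‖ * ‖v i₀‖ ^ 2 := by rw [norm_star]; ring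
      _ ≤ _ := by
          gcongr
          exact norm_apply_le_norm v i₀
  refine (abs_le_of_sq_le_sq' ?_ (by positivity)).2
  rwa [mul_pow, Real.sq_sqrt (norm_nonneg _)]

theorem norm_star_rowMatrix_le (i₀ : Fin m) (a : Fin m → BH H) :
    ‖star (rowMatrix i₀ fun j => star (a j))‖ ≤ √‖∑ j, star (a j) * a j‖ := by
  refine (norm_star (rowMatrix i₀ fun j => star (a j))).trans_le ?_
  simpa using norm_rowMatrix_le i₀ fun j => star (a j)

variable {p q : Type} [Fintype p] [Fintype q]

theorem MatrixNormLE.sum_row_le {ω : q → predual H} {C : ℝ} (hC : 0 ≤ C)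
    (h : MatrixNormLE (fun (_ : Unit) k => ω k) C) (a : Fin m → BH H) :
    ∑ i, ∑ k, ‖(ω k : StrongDual ℂ (BH H)) (a i)‖ ^ 2 ≤ C ^ 2 * ‖∑ i, a i * star (a i)‖ := by
  rcases Nat.eq_zero_or_pos m with rfl | hm
  · simp
  let i₀ : Fin m := ⟨0, hm⟩
  have h1 := h m (rowMatrix i₀ a)
  have h2 := sum_row_sq_le (CStarMatrix.ofMatrix (Matrix.of fun (k : Fin m × Unit)
    (l : Fin m × q) => (ω l.2 : StrongDual ℂ (BH H)) (rowMatrix i₀ a k.1 l.1))) (i₀, ())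
  have h3 := h1.trans (mul_le_mul_of_nonneg_left (norm_rowMatrix_le i₀ a) hC)
  have h4 := h2.trans (pow_le_pow_left₀ (norm_nonneg _) h3 2)
  rw [mul_pow, Real.sq_sqrt (norm_nonneg _)] at h4
  refine le_trans (le_of_eq ?_) h4
  rw [Fintype.sum_prod_type]
  simp [rowMatrix, CStarMatrix.ofMatrix_apply]

theorem MatrixNormLE.sum_column_le {ω : q → predual H} {C : ℝ} (hC : 0 ≤ C)
    (h : MatrixNormLE (fun k (_ : Unit) => ω k) C) (a : Fin m → BH H) :
    ∑ i, ∑ k, ‖(ω k : StrongDual ℂ (BH H)) (a i)‖ ^ 2 ≤ C ^ 2 * ‖∑ i, star (a i) * a i‖ := by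
  rcases Nat.eq_zero_or_pos m with rfl | hm
  · simp
  let i₀ : Fin m := ⟨0, hm⟩
  let x := star (rowMatrix i₀ fun j => star (a j))
  have h1 := h m x
  have h2 := sum_column_sq_le (CStarMatrix.ofMatrix (Matrix.of fun (k : Fin m × q)
    (l : Fin m × Unit) => (ω k.2 : StrongDual ℂ (BH H)) (x k.1 l.1))) (i₀, ())
  have h3 := h1.trans (mul_le_mul_of_nonneg_left (norm_star_rowMatrix_le i₀ a) hC)
  have h4 := h2.trans (pow_le_pow_left₀ (norm_nonneg _) h3 2)
  rw [mul_pow, Real.sq_sqrt (norm_nonneg _)] at h4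
  refine le_trans (le_of_eq ?_) h4
  rw [Fintype.sum_prod_type]
  simp [x, rowMatrix, CStarMatrix.ofMatrix_apply, CStarMatrix.star_apply]

theorem norm_sum_smul_apply_le (x : CStarMatrix (Fin m) (Fin m) (BH H)) (α β : Fin m → ℂ) :
    ‖∑ i, ∑ j, (α i * β j) • x i j‖ ≤
      √(∑ i, ‖α i‖ ^ 2) * √(∑ i, ‖β i‖ ^ 2) * ‖x‖ := by
  let e : (Fin m → ℂ) → WithCStarModule (BH H) (Fin m → BH H) := fun α =>
    (WithCStarModule.equiv _ _).symm fun i => α i • 1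
  have hnorm : ∀ α : Fin m → ℂ, ‖e α‖ ≤ √(∑ i, ‖α i‖ ^ 2) := fun α => by
    refine Real.le_sqrt_of_sq_le ?_
    rw [pi_norm_sq]
    refine (norm_sum_le _ _).trans (Finset.sum_le_sum fun i _ => ?_)
    simp only [e, equiv_symm_pi_apply, inner_def]
    refine (norm_mul_le _ _).trans ?_
    rw [norm_star, ← sq]
    refine pow_le_pow_left₀ (norm_nonneg _) ?_ 2
    rw [norm_smul]
    exact mul_le_of_le_one_right (norm_nonneg _) ContinuousLinearMap.norm_id_le
  have h1 : inner (BH H) (e fun j => star (β j)) (CStarMatrix.toCLM x (e α)) =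
      ∑ i, ∑ j, (α i * β j) • x i j := by
    rw [CStarMatrix.toCLM_apply_eq_sum, pi_inner, Finset.sum_comm]
    refine Finset.sum_congr rfl fun j _ => ?_
    simp only [e, equiv_symm_pi_apply, inner_def, star_smul, star_star, star_one,
      smul_mul_assoc, one_mul, mul_smul_comm, mul_one, Finset.smul_sum, smul_smul]
    exact Finset.sum_congr rfl fun i _ => by rw [mul_comm]
  rw [← h1]
  refine (CStarModule.norm_inner_le _).trans ?_
  have h2 := (CStarMatrix.toCLM x).le_opNorm (e α)
  rw [← CStarMatrix.norm_def] at h2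
  have h3 := hnorm fun j => star (β j)
  simp only [norm_star] at h3
  calc ‖e fun j => star (β j)‖ * ‖CStarMatrix.toCLM x (e α)‖
      ≤ √(∑ i, ‖β i‖ ^ 2) * (‖x‖ * √(∑ i, ‖α i‖ ^ 2)) :=
        mul_le_mul h3 (h2.trans (mul_le_mul_of_nonneg_left (hnorm α) (norm_nonneg _)))
          (norm_nonneg _) (Real.sqrt_nonneg _)
    _ = _ := by ring

/-- Normal functionals are completely bounded. -/
theorem matrixNormLE_sum_norm (ω : p → q → predual H) :
    MatrixNormLE ω (∑ k, ∑ l, ‖ω k l‖) := by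
  intro m x
  have hnn : 0 ≤ (∑ k, ∑ l, ‖ω k l‖) * ‖x‖ := by positivity
  refine CStarMatrix.norm_le_of_forall_inner_le (C := ⟨_, hnn⟩) fun v w => ?_
  have h1 : inner ℂ w (CStarMatrix.toCLM (CStarMatrix.ofMatrix (Matrix.of
      fun (k : Fin m × p) (l : Fin m × q) =>
        (ω k.2 l.2 : StrongDual ℂ (BH H)) (x k.1 l.1))) v) =
      ∑ k, ∑ l, (ω k l : StrongDual ℂ (BH H))
        (∑ i, ∑ j, (v (i, k) * star (w (j, l))) • x i j) := by
    rw [CStarMatrix.toCLM_apply_eq_sum, pi_inner]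
    simp only [equiv_symm_pi_apply, inner_def, CStarMatrix.ofMatrix_apply, Matrix.of_apply,
      map_sum, map_smul, smul_eq_mul, Fintype.sum_prod_type, Finset.sum_mul]
    rw [Finset.sum_comm]
    rw [Finset.sum_congr rfl fun (l : q) _ => Finset.sum_comm]
    rw [Finset.sum_congr rfl fun (l : q) _ => Finset.sum_congr rfl fun (i : Fin m) _ =>
      Finset.sum_comm]
    rw [Finset.sum_congr rfl fun (l : q) _ => Finset.sum_comm]
    rw [Finset.sum_comm]
    refine Finset.sum_congr rfl fun k _ => Finset.sum_congr rfl fun l _ =>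
      Finset.sum_congr rfl fun i _ => Finset.sum_congr rfl fun j _ => ?_
    ring
  rw [h1]
  have hle : ∀ {r : Type} [Fintype r] (u : WithCStarModule ℂ (Fin m × r → ℂ)) (k : r),
      √(∑ i, ‖u (i, k)‖ ^ 2) ≤ ‖u‖ := fun {r} _ u k => by
    classical
    refine Real.sqrt_le_iff.2 ⟨norm_nonneg _, ?_⟩
    rw [norm_sq_complex_column, Fintype.sum_prod_type]
    exact Finset.sum_le_sum fun i _ =>
      Finset.single_le_sum (f := fun k => ‖u (i, k)‖ ^ 2) (fun _ _ => by positivity)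
        (Finset.mem_univ k)
  refine (norm_sum_le _ _).trans ?_
  change _ ≤ (∑ k, ∑ l, ‖ω k l‖) * ‖x‖ * ‖v‖ * ‖w‖
  simp only [Finset.sum_mul]
  refine Finset.sum_le_sum fun k _ => (norm_sum_le _ _).trans (Finset.sum_le_sum fun l _ => ?_)
  refine ((ω k l : StrongDual ℂ (BH H)).le_opNorm _).trans ?_
  have h2 := norm_sum_smul_apply_le x (fun i => v (i, k)) fun j => star (w (j, l))
  simp only [norm_star] at h2
  have h3 : √(∑ i, ‖v (i, k)‖ ^ 2) * √(∑ j, ‖w (j, l)‖ ^ 2) * ‖x‖ ≤ ‖v‖ * ‖w‖ * ‖x‖ := by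
    gcongr
    · exact hle v k
    · exact hle w l
  calc ‖(ω k l : StrongDual ℂ (BH H))‖ * _ ≤ ‖ω k l‖ * (‖v‖ * ‖w‖ * ‖x‖) :=
        mul_le_mul_of_nonneg_left (h2.trans h3) (norm_nonneg _)
    _ = _ := by ring

end Matrices

section Predual

universe u

variable {H : Type u} [NormedAddCommGroup H] [InnerProductSpace ℂ H] [CompleteSpace H]

@[simp]
theorem vectorFunctional_apply (ξ η : H) (x : BH H) :
    vectorFunctional ξ η x = inner ℂ η (x ξ) := rfl

theorem vectorFunctional_mem (ξ η : H) : vectorFunctional ξ η ∈ predual H :=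
  Submodule.le_topologicalClosure _ (Submodule.subset_span ⟨(ξ, η), rfl⟩)

theorem norm_vectorFunctional_le (ξ η : H) : ‖vectorFunctional ξ η‖ ≤ ‖ξ‖ * ‖η‖ := by
  refine ContinuousLinearMap.opNorm_le_bound _ (by positivity) fun x => ?_
  rw [vectorFunctional_apply]
  calc ‖inner ℂ η (x ξ)‖ ≤ ‖η‖ * ‖x ξ‖ := norm_inner_le_norm _ _
    _ ≤ ‖η‖ * (‖x‖ * ‖ξ‖) := by gcongr; exact x.le_opNorm ξ
    _ = _ := by ring

/-- A closed subspace of functionals that contains the vector functionals contains the predual. -/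
theorem predual_le {S : Submodule ℂ (StrongDual ℂ (BH H))} (hS : IsClosed (S : Set (StrongDual ℂ (BH H))))
    (h : ∀ ξ η, vectorFunctional ξ η ∈ S) : predual H ≤ S := by
  refine Submodule.topologicalClosure_minimal _ (Submodule.span_le.2 ?_) hS
  rintro _ ⟨p, rfl⟩
  exact h _ _

theorem isClosed_predual : IsClosed (predual H : Set (StrongDual ℂ (BH H))) :=
  Submodule.isClosed_topologicalClosure _

set_option maxSynthPendingDepth 3 in
/-- Two bounded linear functionals on the predual agree if they agree on vector functionals. -/
theorem predual_ext {f g : predual H →ₗ[ℂ] ℂ} {K L : ℝ} (hf : ∀ ω, ‖f ω‖ ≤ K * ‖ω‖)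
    (hg : ∀ ω, ‖g ω‖ ≤ L * ‖ω‖)
    (h : ∀ ξ η, f ⟨_, vectorFunctional_mem ξ η⟩ = g ⟨_, vectorFunctional_mem ξ η⟩) : f = g := by
  let f' : predual H →L[ℂ] ℂ := f.mkContinuous K hf
  let g' : predual H →L[ℂ] ℂ := g.mkContinuous L hg
  let d : predual H →L[ℂ] ℂ := f' - g'
  have hd : ∀ ω, d ω = f ω - g ω := fun ω => rfl
  obtain ⟨d', hd', -⟩ := exists_extension_norm_eq (predual H) d
  have hle : predual H ≤ d'.ker := predual_le d'.isClosed_ker fun ξ η => by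
    have := hd' ⟨_, vectorFunctional_mem ξ η⟩
    simp only [] at this
    rw [LinearMap.mem_ker]
    refine this.trans ?_
    rw [hd, h, sub_self]
  ext ω
  have h1 := hd' ω
  rw [hd] at h1
  have h2 : d' (ω : StrongDual ℂ (BH H)) = 0 := hle ω.2
  exact sub_eq_zero.1 (h1.symm.trans h2)

theorem tendsto_predual {ι : Type*} {l : Filter ι} {A : ι → BH H} {a : BH H} {C : ℝ}
    (hC : ∀ j, ‖A j‖ ≤ C)
    (hv : ∀ ξ η, Tendsto (fun j => inner ℂ η (A j ξ)) l (𝓝 (inner ℂ η (a ξ))))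
    {ω : StrongDual ℂ (BH H)} (hω : ω ∈ predual H) : Tendsto (fun j => ω (A j)) l (𝓝 (ω a)) := by
  let S : Submodule ℂ (StrongDual ℂ (BH H)) :=
    { carrier := {ω | Tendsto (fun j => ω (A j)) l (𝓝 (ω a))}
      add_mem' := fun h h' => h.add h'
      zero_mem' := tendsto_const_nhds
      smul_mem' := fun c _ h => h.const_mul c }
  refine predual_le (S := S) (isClosed_of_closure_subset fun ω hω => ?_) (fun ξ η => hv ξ η) hω
  refine Metric.tendsto_nhds.2 fun ε hε => ?_
  have hpos : 0 < |C| + ‖a‖ + 1 := by positivity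
  obtain ⟨ω', hω', hlt⟩ := Metric.mem_closure_iff.1 hω (ε / (2 * (|C| + ‖a‖ + 1))) (by positivity)
  have h1 : Tendsto (fun j => ω' (A j)) l (𝓝 (ω' a)) := hω'
  filter_upwards [Metric.tendsto_nhds.1 h1 (ε / 2) (by positivity)] with j hj
  have e : ω (A j) - ω a = (ω - ω') (A j) + (ω' (A j) - ω' a) + (ω' - ω) a := by
    simp only [_root_.sub_apply]; ring
  rw [dist_eq_norm] at hj hlt ⊢
  rw [e]
  have h2 := (ω - ω').le_opNorm (A j)
  have h3 := (ω' - ω).le_opNorm a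
  rw [norm_sub_rev] at h3
  have h4 : ‖ω - ω'‖ * ‖A j‖ ≤ ‖ω - ω'‖ * |C| := by
    gcongr; exact (hC j).trans (le_abs_self C)
  have h5 : ‖ω - ω'‖ * (|C| + ‖a‖ + 1) < ε / 2 := by
    calc _ < ε / (2 * (|C| + ‖a‖ + 1)) * (|C| + ‖a‖ + 1) := mul_lt_mul_of_pos_right hlt hpos
      _ = ε / 2 := by field_simp
  have h6 := norm_nonneg (ω - ω')
  calc ‖(ω - ω') (A j) + (ω' (A j) - ω' a) + (ω' - ω) a‖
      ≤ ‖(ω - ω') (A j)‖ + ‖ω' (A j) - ω' a‖ + ‖(ω' - ω) a‖ := norm_add₃_le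
    _ < ε := by nlinarith

theorem weakStarHasSum_of_inner {ι : Type*} {f : ι → BH H} {a : BH H} {C : ℝ}
    (hC : ∀ s : Finset ι, ‖∑ i ∈ s, f i‖ ≤ C)
    (hv : ∀ ξ η, HasSum (fun i => inner ℂ η (f i ξ)) (inner ℂ η (a ξ))) : WeakStarHasSum f a := by
  intro ω hω
  have := tendsto_predual (l := atTop) (A := fun s : Finset ι => ∑ i ∈ s, f i) (a := a) hC
    (fun ξ η => ?_) hω
  · simp only [map_sum] at this
    exact this
  · simp only [_root_.sum_apply, inner_sum]
    exact hv ξ η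

theorem WeakStarHasSum.inner {ι : Type*} {f : ι → BH H} {a : BH H} (h : WeakStarHasSum f a)
    (ξ η : H) : HasSum (fun i => inner ℂ η (f i ξ)) (inner ℂ η (a ξ)) :=
  h _ (vectorFunctional_mem ξ η)

theorem opNorm_le_of_inner {T : BH H} {K : ℝ} (hK : 0 ≤ K)
    (h : ∀ ξ η, ‖inner ℂ η (T ξ)‖ ≤ K * ‖ξ‖ * ‖η‖) : ‖T‖ ≤ K := by
  refine T.opNorm_le_bound hK fun ξ => ?_
  have h1 := h ξ (T ξ)
  rw [inner_self_eq_norm_sq_to_K, ← RCLike.ofReal_pow, RCLike.norm_ofReal, abs_of_nonneg (by positivity), sq] at h1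
  rcases (norm_nonneg (T ξ)).eq_or_lt with h0 | h0
  · rw [← h0]; positivity
  · exact le_of_mul_le_mul_right h1 h0

theorem norm_sum_star_mul_mul_le {ι : Type*} (s : Finset ι) {r c : ι → BH H} (x : BH H) {A B : ℝ}
    (hA : 0 ≤ A) (hB : 0 ≤ B) (hr : ∀ η, ∑ i ∈ s, ‖r i η‖ ^ 2 ≤ (A * ‖η‖) ^ 2)
    (hc : ∀ ξ, ∑ i ∈ s, ‖c i ξ‖ ^ 2 ≤ (B * ‖ξ‖) ^ 2) :
    ‖∑ i ∈ s, star (r i) * x * c i‖ ≤ A * B * ‖x‖ := by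
  refine opNorm_le_of_inner (by positivity) fun ξ η => ?_
  rw [_root_.sum_apply, inner_sum]
  refine (norm_sum_le _ _).trans ?_
  have h1 : ∀ i ∈ s, ‖inner ℂ η ((star (r i) * x * c i) ξ)‖ ≤ ‖x‖ * (‖r i η‖ * ‖c i ξ‖) := by
    intro i _
    have : inner ℂ η ((star (r i) * x * c i) ξ) = inner ℂ (r i η) (x (c i ξ)) :=
      ContinuousLinearMap.adjoint_inner_right (r i) η (x (c i ξ))
    rw [this]
    calc _ ≤ ‖r i η‖ * ‖x (c i ξ)‖ := norm_inner_le_norm _ _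
      _ ≤ ‖r i η‖ * (‖x‖ * ‖c i ξ‖) := by gcongr; exact x.le_opNorm _
      _ = _ := by ring
  refine (Finset.sum_le_sum h1).trans ?_
  rw [← Finset.mul_sum]
  have h2 := Finset.sum_mul_sq_le_sq_mul_sq s (fun i => ‖r i η‖) fun i => ‖c i ξ‖
  have h3 : ∑ i ∈ s, ‖r i η‖ * ‖c i ξ‖ ≤ (A * ‖η‖) * (B * ‖ξ‖) := by
    refine (abs_le_of_sq_le_sq' (h2.trans ?_) (by positivity)).2
    rw [mul_pow]
    exact mul_le_mul (hr η) (hc ξ) (by positivity) (by positivity)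
  calc ‖x‖ * ∑ i ∈ s, ‖r i η‖ * ‖c i ξ‖ ≤ ‖x‖ * ((A * ‖η‖) * (B * ‖ξ‖)) := by gcongr
    _ = _ := by ring

end Predual

section Series

universe u

variable {H : Type u} [NormedAddCommGroup H] [InnerProductSpace ℂ H] [CompleteSpace H]
variable {ι : Type*} {v w : ι → BH H} {a b : BH H} {T : BH H →L[ℂ] BH H}

theorem hasSum_norm_sq_of_weakStarHasSum {c : ι → BH H}
    (h : WeakStarHasSum (fun i => star (c i) * c i) b) (ξ : H) :
    HasSum (fun i => ‖c i ξ‖ ^ 2) (inner ℂ ξ (b ξ)).re := by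
  have h1 := Complex.hasSum_re (h.inner ξ ξ)
  convert h1 using 2 with i
  have : inner ℂ ξ ((star (c i) * c i) ξ) = inner ℂ (c i ξ) (c i ξ) :=
    ContinuousLinearMap.adjoint_inner_right (c i) ξ (c i ξ)
  rw [this]
  exact (inner_self_eq_norm_sq (𝕜 := ℂ) (c i ξ)).symm

theorem sum_norm_sq_le_of_weakStarHasSum {c : ι → BH H}
    (h : WeakStarHasSum (fun i => star (c i) * c i) b) (s : Finset ι) (ξ : H) :
    ∑ i ∈ s, ‖c i ξ‖ ^ 2 ≤ (√‖b‖ * ‖ξ‖) ^ 2 := by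
  refine (sum_le_hasSum s (fun i _ => by positivity) (hasSum_norm_sq_of_weakStarHasSum h ξ)).trans ?_
  rw [mul_pow, Real.sq_sqrt (norm_nonneg _)]
  calc (inner ℂ ξ (b ξ)).re ≤ ‖inner ℂ ξ (b ξ)‖ := Complex.re_le_norm _
    _ ≤ ‖ξ‖ * ‖b ξ‖ := norm_inner_le_norm _ _
    _ ≤ ‖ξ‖ * (‖b‖ * ‖ξ‖) := by gcongr; exact b.le_opNorm ξ
    _ = _ := by ring

theorem norm_sum_le_of_weakStarHasSum {c : ι → BH H}
    (h : WeakStarHasSum (fun i => star (c i) * c i) b) (s : Finset ι) :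
    ‖∑ i ∈ s, star (c i) * c i‖ ≤ ‖b‖ := by
  have h1 := norm_sum_star_mul_mul_le s (r := c) (c := c) 1 (Real.sqrt_nonneg _)
    (Real.sqrt_nonneg _) (sum_norm_sq_le_of_weakStarHasSum h s)
    (sum_norm_sq_le_of_weakStarHasSum h s)
  rw [Real.mul_self_sqrt (norm_nonneg _)] at h1
  simp only [mul_one] at h1
  exact h1.trans (mul_le_of_le_one_right (norm_nonneg _) ContinuousLinearMap.norm_id_le)

namespace IsEHSeries

theorem row' (h : IsEHSeries v w a b T) :
    WeakStarHasSum (fun i => star (star (v i)) * star (v i)) a := by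
  simpa only [star_star] using h.row

theorem sum_row_le {q : Type} [Fintype q] (h : IsEHSeries v w a b T) {ω : q → predual H} {C : ℝ}
    (hC : 0 ≤ C) (hω : MatrixNormLE (fun (_ : Unit) k => ω k) C) (s : Finset ι) :
    ∑ i ∈ s, ∑ k, ‖(ω k : StrongDual ℂ (BH H)) (v i)‖ ^ 2 ≤ C ^ 2 * ‖a‖ := by
  have h1 := hω.sum_row_le hC fun j : Fin s.card => v (s.equivFin.symm j)
  have e1 : ∑ j, ∑ k, ‖(ω k : StrongDual ℂ (BH H)) (v (s.equivFin.symm j))‖ ^ 2 =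
      ∑ i ∈ s, ∑ k, ‖(ω k : StrongDual ℂ (BH H)) (v i)‖ ^ 2 :=
    (s.equivFin.symm.sum_comp fun i : s =>
      ∑ k, ‖(ω k : StrongDual ℂ (BH H)) (v i)‖ ^ 2).trans
      (s.sum_coe_sort fun i => ∑ k, ‖(ω k : StrongDual ℂ (BH H)) (v i)‖ ^ 2)
  have e2 : ∑ j, v (s.equivFin.symm j) * star (v (s.equivFin.symm j)) =
      ∑ i ∈ s, v i * star (v i) :=
    (s.equivFin.symm.sum_comp fun i : s => v i * star (v i)).trans
      (s.sum_coe_sort fun i => v i * star (v i))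
  rw [e1, e2] at h1
  refine h1.trans (mul_le_mul_of_nonneg_left ?_ (by positivity))
  simpa only [star_star] using norm_sum_le_of_weakStarHasSum h.row' s

theorem sum_column_le {q : Type} [Fintype q] (h : IsEHSeries v w a b T) {ω : q → predual H} {C : ℝ}
    (hC : 0 ≤ C) (hω : MatrixNormLE (fun k (_ : Unit) => ω k) C) (s : Finset ι) :
    ∑ i ∈ s, ∑ k, ‖(ω k : StrongDual ℂ (BH H)) (w i)‖ ^ 2 ≤ C ^ 2 * ‖b‖ := by
  have h1 := hω.sum_column_le hC fun j : Fin s.card => w (s.equivFin.symm j)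
  have e1 : ∑ j, ∑ k, ‖(ω k : StrongDual ℂ (BH H)) (w (s.equivFin.symm j))‖ ^ 2 =
      ∑ i ∈ s, ∑ k, ‖(ω k : StrongDual ℂ (BH H)) (w i)‖ ^ 2 :=
    (s.equivFin.symm.sum_comp fun i : s =>
      ∑ k, ‖(ω k : StrongDual ℂ (BH H)) (w i)‖ ^ 2).trans
      (s.sum_coe_sort fun i => ∑ k, ‖(ω k : StrongDual ℂ (BH H)) (w i)‖ ^ 2)
  have e2 : ∑ j, star (w (s.equivFin.symm j)) * w (s.equivFin.symm j) =
      ∑ i ∈ s, star (w i) * w i :=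
    (s.equivFin.symm.sum_comp fun i : s => star (w i) * w i).trans
      (s.sum_coe_sort fun i => star (w i) * w i)
  rw [e1, e2] at h1
  exact h1.trans (mul_le_mul_of_nonneg_left (norm_sum_le_of_weakStarHasSum h.col s) (by positivity))

theorem sum_norm_evalPair_le {n : ℕ} (h : IsEHSeries v w a b T) {ω ν : Fin n → predual H}
    {C D : ℝ} (hC : 0 ≤ C) (hD : 0 ≤ D) (hω : MatrixNormLE (fun (_ : Unit) k => ω k) C)
    (hν : MatrixNormLE (fun k (_ : Unit) => ν k) D) (s : Finset ι) :
    ∑ i ∈ s, ‖evalPair (v i) (w i) (∑ k, ω k ⊗ₜ[ℂ] ν k)‖ ≤ √‖a‖ * √‖b‖ * (C * D) := by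
  have hpt : ∀ i ∈ s, ‖evalPair (v i) (w i) (∑ k, ω k ⊗ₜ[ℂ] ν k)‖ ≤
      ∑ k, ‖(ω k : StrongDual ℂ (BH H)) (v i)‖ * ‖(ν k : StrongDual ℂ (BH H)) (w i)‖ := by
    intro i _
    rw [map_sum]
    refine (norm_sum_le _ _).trans (Finset.sum_le_sum fun k _ => ?_)
    exact norm_mul_le ((ω k : StrongDual ℂ (BH H)) (v i)) ((ν k : StrongDual ℂ (BH H)) (w i))
  refine (Finset.sum_le_sum hpt).trans ?_
  have h1 := h.sum_row_le hC hω s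
  have h2 := h.sum_column_le hD hν s
  rw [← Finset.sum_product'] at h1 h2 ⊢
  have h3 := Finset.sum_mul_sq_le_sq_mul_sq (s ×ˢ Finset.univ)
    (fun p : ι × Fin n => ‖(ω p.2 : StrongDual ℂ (BH H)) (v p.1)‖)
    fun p => ‖(ν p.2 : StrongDual ℂ (BH H)) (w p.1)‖
  refine (abs_le_of_sq_le_sq' (h3.trans ((mul_le_mul h1 h2 (by positivity) (by positivity)).trans_eq
    ?_)) (by positivity)).2
  rw [mul_pow, mul_pow, mul_pow, Real.sq_sqrt (norm_nonneg _), Real.sq_sqrt (norm_nonneg _)]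
  ring

end IsEHSeries

theorem exists_representation (z : predual H ⊗[ℂ] predual H) :
    ∃ (n : ℕ) (ω ν : Fin n → predual H) (C D : ℝ), 0 ≤ C ∧ 0 ≤ D ∧
    MatrixNormLE (fun (_ : Unit) k => ω k) C ∧ MatrixNormLE (fun k (_ : Unit) => ν k) D ∧
    z = ∑ k, ω k ⊗ₜ[ℂ] ν k := by
  obtain ⟨n, s, t, rfl⟩ := TensorProduct.exists_sum_tmul_eq z
  exact ⟨n, s, t, _, _, by positivity, by positivity, matrixNormLE_sum_norm _,
    matrixNormLE_sum_norm _, rfl⟩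

theorem hNorm_nonneg (z : predual H ⊗[ℂ] predual H) : 0 ≤ hNorm z := by
  refine Real.sInf_nonneg ?_
  rintro r ⟨n, ω, ν, C, D, hC, hD, -, -, -, rfl⟩
  positivity

theorem hNorm_zero : hNorm (0 : predual H ⊗[ℂ] predual H) = 0 := by
  refine le_antisymm (csInf_le ⟨0, ?_⟩ ⟨0, Fin.elim0, Fin.elim0, 0, 0, le_rfl, le_rfl, ?_, ?_, by simp, by simp⟩) (hNorm_nonneg _)
  · rintro r ⟨n, ω, ν, C, D, hC, hD, -, -, -, rfl⟩
    positivity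
  · simpa using matrixNormLE_sum_norm (fun (_ : Unit) (k : Fin 0) => (Fin.elim0 k : predual H))
  · simpa using matrixNormLE_sum_norm (fun (k : Fin 0) (_ : Unit) => (Fin.elim0 k : predual H))

theorem exists_lt_of_hNorm_lt {z : predual H ⊗[ℂ] predual H} {r : ℝ} (hr : hNorm z < r) :
    ∃ (n : ℕ) (ω ν : Fin n → predual H) (C D : ℝ), 0 ≤ C ∧ 0 ≤ D ∧
    MatrixNormLE (fun (_ : Unit) k => ω k) C ∧ MatrixNormLE (fun k (_ : Unit) => ν k) D ∧
    z = ∑ k, ω k ⊗ₜ[ℂ] ν k ∧ C * D < r := by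
  obtain ⟨n, ω, ν, C, D, hC, hD, hω, hν, hz⟩ := exists_representation z
  have hne : {r | ∃ (n : ℕ) (ω ν : Fin n → predual H) (C D : ℝ), 0 ≤ C ∧ 0 ≤ D ∧
    MatrixNormLE (fun (_ : Unit) k => ω k) C ∧ MatrixNormLE (fun k (_ : Unit) => ν k) D ∧
    z = ∑ k, ω k ⊗ₜ[ℂ] ν k ∧ r = C * D}.Nonempty :=
    ⟨C * D, n, ω, ν, C, D, hC, hD, hω, hν, hz, rfl⟩
  obtain ⟨_, ⟨n, ω, ν, C, D, hC, hD, hω, hν, hz, rfl⟩, hlt⟩ := exists_lt_of_csInf_lt hne hr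
  exact ⟨n, ω, ν, C, D, hC, hD, hω, hν, hz, hlt⟩

namespace IsEHSeries

theorem sum_norm_evalPair_le_hNorm (h : IsEHSeries v w a b T) (z : predual H ⊗[ℂ] predual H)
    (s : Finset ι) : ∑ i ∈ s, ‖evalPair (v i) (w i) z‖ ≤ √‖a‖ * √‖b‖ * hNorm z := by
  refine ge_of_tendsto (x := 𝓝[>] (hNorm z)) (f := fun r => √‖a‖ * √‖b‖ * r) ?_ ?_
  · exact ((continuous_const.mul continuous_id).tendsto _).mono_left nhdsWithin_le_nhds
  · filter_upwards [self_mem_nhdsWithin] with r hr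
    obtain ⟨n, ω, ν, C, D, hC, hD, hω, hν, rfl, hlt⟩ := exists_lt_of_hNorm_lt hr
    refine (h.sum_norm_evalPair_le hC hD hω hν s).trans ?_
    gcongr

theorem summable_evalPair (h : IsEHSeries v w a b T) (z : predual H ⊗[ℂ] predual H) :
    Summable fun i => ‖evalPair (v i) (w i) z‖ :=
  summable_of_sum_le (fun _ => norm_nonneg _) (h.sum_norm_evalPair_le_hNorm z)

theorem norm_tsum_evalPair_le (h : IsEHSeries v w a b T) (z : predual H ⊗[ℂ] predual H) :
    ‖∑' i, evalPair (v i) (w i) z‖ ≤ √‖a‖ * √‖b‖ * hNorm z :=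
  (norm_tsum_le_tsum_norm (h.summable_evalPair z)).trans
    ((h.summable_evalPair z).tsum_le_of_sum_le (h.sum_norm_evalPair_le_hNorm z))

/-- The functional on the algebraic tensor product defined by a series. -/
noncomputable def pairing (h : IsEHSeries v w a b T) : predual H ⊗[ℂ] predual H →ₗ[ℂ] ℂ where
  toFun z := ∑' i, evalPair (v i) (w i) z
  map_add' z z' := by
    simp only [map_add]
    exact (h.summable_evalPair z).of_norm.tsum_add (h.summable_evalPair z').of_norm
  map_smul' c z := by
    simp only [map_smul, smul_eq_mul, RingHom.id_apply, tsum_mul_left]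

theorem hasSum_pairing (h : IsEHSeries v w a b T) (z : predual H ⊗[ℂ] predual H) :
    HasSum (fun i => evalPair (v i) (w i) z) (h.pairing z) :=
  (h.summable_evalPair z).of_norm.hasSum

theorem norm_pairing_le (h : IsEHSeries v w a b T) (z : predual H ⊗[ℂ] predual H) :
    ‖h.pairing z‖ ≤ √‖a‖ * √‖b‖ * hNorm z := h.norm_tsum_evalPair_le z

end IsEHSeries

theorem hNorm_tmul_le (ω ν : predual H) : hNorm (ω ⊗ₜ[ℂ] ν) ≤ ‖ω‖ * ‖ν‖ := by
  refine csInf_le ⟨0, ?_⟩ ⟨1, fun _ => ω, fun _ => ν, ‖ω‖, ‖ν‖, by positivity, by positivity,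
    ?_, ?_, by simp, rfl⟩
  · rintro r ⟨n, ω, ν, C, D, hC, hD, -, -, -, rfl⟩
    positivity
  · simpa using matrixNormLE_sum_norm (fun (_ : Unit) (_ : Fin 1) => ω)
  · simpa using matrixNormLE_sum_norm (fun (_ : Fin 1) (_ : Unit) => ν)

/-- The rank one operator `ζ ↦ ⟨ζ, θ⟩ ξ`. -/
noncomputable def rankOne (ξ θ : H) : BH H := (innerSL ℂ θ).smulRight ξ

@[simp] theorem rankOne_apply (ξ θ ζ : H) : rankOne ξ θ ζ = (inner ℂ θ ζ : ℂ) • ξ := rfl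

theorem IsEHSeries.pairing_vectorFunctional (h : IsEHSeries v w a b T) (ξ η ζ θ : H) :
    h.pairing (⟨_, vectorFunctional_mem ξ η⟩ ⊗ₜ ⟨_, vectorFunctional_mem ζ θ⟩) =
      inner ℂ η (T (rankOne ξ θ) ζ) := by
  refine (h.hasSum_pairing _).unique ?_
  convert (h.apply (rankOne ξ θ)).inner ζ η using 2 with i
  have : (v i * rankOne ξ θ * w i) ζ = (inner ℂ θ (w i ζ) : ℂ) • v i ξ := by
    change v i ((inner ℂ θ (w i ζ) : ℂ) • ξ) = _
    rw [map_smul]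
  rw [this, inner_smul_right, mul_comm]
  rfl

/-- The pairing of an element of the extended Haagerup tensor product with the algebraic tensor
product is determined by the values of the operator at rank one operators. -/
theorem IsEHSeries.pairing_eq (h : IsEHSeries v w a b T)
    {L : predual H ⊗[ℂ] predual H →ₗ[ℂ] ℂ} {K : ℝ} (hL : ∀ ω ν, ‖L (ω ⊗ₜ ν)‖ ≤ K * ‖ω‖ * ‖ν‖)
    (hv : ∀ ξ η ζ θ, L (⟨_, vectorFunctional_mem ξ η⟩ ⊗ₜ ⟨_, vectorFunctional_mem ζ θ⟩) =
      inner ℂ η (T (rankOne ξ θ) ζ)) : h.pairing = L := by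
  have hP : ∀ ω ν, ‖h.pairing (ω ⊗ₜ ν)‖ ≤ √‖a‖ * √‖b‖ * ‖ω‖ * ‖ν‖ := fun ω ν => by
    rw [mul_assoc]
    exact (h.norm_pairing_le _).trans (mul_le_mul_of_nonneg_left (hNorm_tmul_le ω ν) (by positivity))
  have step1 : ∀ (ν : predual H) (ξ η : H), h.pairing (⟨_, vectorFunctional_mem ξ η⟩ ⊗ₜ ν) =
      L (⟨_, vectorFunctional_mem ξ η⟩ ⊗ₜ ν) := by
    intro ν ξ η
    have := predual_ext
      (f := h.pairing ∘ₗ TensorProduct.mk ℂ _ _ ⟨_, vectorFunctional_mem ξ η⟩)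
      (g := L ∘ₗ TensorProduct.mk ℂ _ _ ⟨_, vectorFunctional_mem ξ η⟩)
      (fun ν => hP _ ν) (fun ν => hL _ ν) (fun ζ θ => ?_)
    · exact LinearMap.congr_fun this ν
    · exact (h.pairing_vectorFunctional ξ η ζ θ).trans (hv ξ η ζ θ).symm
  refine TensorProduct.ext' fun ω ν => ?_
  have := predual_ext
    (f := h.pairing ∘ₗ (TensorProduct.mk ℂ _ _).flip ν)
    (g := L ∘ₗ (TensorProduct.mk ℂ _ _).flip ν) (K := √‖a‖ * √‖b‖ * ‖ν‖) (L := K * ‖ν‖)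
    (fun ω => (hP ω ν).trans_eq (by ring)) (fun ω => (hL ω ν).trans_eq (by ring))
    (fun ξ η => step1 ν ξ η)
  exact LinearMap.congr_fun this ω

end Series

section Normality

universe u

variable {H : Type u} [NormedAddCommGroup H] [InnerProductSpace ℂ H] [CompleteSpace H]

/-- Operators defined by extended Haagerup series are normal. -/
theorem IsEHSeries.comp_mem_predual {ι : Type*} {v w : ι → BH H} {a b : BH H}
    {T : BH H →L[ℂ] BH H} (h : IsEHSeries v w a b T) {ω : StrongDual ℂ (BH H)}
    (hω : ω ∈ predual H) : ω.comp T ∈ predual H := by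
  let L : StrongDual ℂ (BH H) →L[ℂ] StrongDual ℂ (BH H) :=
    (ContinuousLinearMap.compL ℂ (BH H) (BH H) ℂ).flip T
  refine predual_le (S := (predual H).comap L.toLinearMap) (isClosed_predual.preimage L.continuous)
    (fun ζ η => ?_) hω
  change (vectorFunctional ζ η).comp T ∈ predual H
  have hs : Summable fun i => vectorFunctional (w i ζ) (star (v i) η) := by
    refine Summable.of_norm_bounded (((hasSum_norm_sq_of_weakStarHasSum h.col ζ).add
      (hasSum_norm_sq_of_weakStarHasSum h.row' η)).summable.div_const 2) fun i => ?_
    refine (norm_vectorFunctional_le _ _).trans ?_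
    nlinarith [sq_nonneg (‖w i ζ‖ - ‖star (v i) η‖)]
  have hsum : HasSum (fun i => vectorFunctional (w i ζ) (star (v i) η))
      ((vectorFunctional ζ η).comp T) := by
    convert hs.hasSum
    ext x
    refine ((h.apply x).inner ζ η).unique ?_
    refine ((ContinuousLinearMap.apply ℂ ℂ x).hasSum hs.hasSum).congr_fun fun i => ?_
    exact (ContinuousLinearMap.adjoint_inner_left (v i) (x (w i ζ)) η).symm
  exact isClosed_predual.mem_of_tendsto hsum
    (Eventually.of_forall fun s => sum_mem fun i _ => vectorFunctional_mem _ _)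

theorem weakStarHasSum_rankOne {ι : Type*} (e : HilbertBasis ι ℂ H) (x : BH H) :
    WeakStarHasSum (fun k => rankOne (x (e k)) (e k)) x := by
  refine weakStarHasSum_of_inner (C := ‖x‖) (fun s => ?_) fun ζ η => ?_
  · have e1 : ∑ k ∈ s, rankOne (x (e k)) (e k) = x * ∑ k ∈ s, rankOne (e k) (e k) := by
      ext ζ
      simp [_root_.sum_apply, map_sum]
    have e2 : ‖∑ k ∈ s, rankOne (e k) (e k)‖ ≤ 1 := by
      refine opNorm_le_of_inner zero_le_one fun ζ η => ?_
      rw [_root_.sum_apply, inner_sum]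
      refine (norm_sum_le _ _).trans ?_
      have h1 := e.orthonormal.sum_inner_products_le ζ (s := s)
      have h2 := e.orthonormal.sum_inner_products_le η (s := s)
      have h3 := Finset.sum_mul_sq_le_sq_mul_sq s (fun k => ‖inner ℂ (e k) ζ‖)
        fun k => ‖inner ℂ (e k) η‖
      have h4 : ∑ k ∈ s, ‖inner ℂ η (rankOne (e k) (e k) ζ)‖ =
          ∑ k ∈ s, ‖inner ℂ (e k) ζ‖ * ‖inner ℂ (e k) η‖ := by
        refine Finset.sum_congr rfl fun k _ => ?_
        rw [rankOne_apply, inner_smul_right, norm_mul, norm_inner_symm η]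
      rw [h4, one_mul]
      refine (abs_le_of_sq_le_sq' (h3.trans ?_) (by positivity)).2
      rw [mul_pow]
      exact mul_le_mul h1 h2 (by positivity) (by positivity)
    rw [e1]
    exact (norm_mul_le _ _).trans (mul_le_of_le_one_right (norm_nonneg _) e2)
  · have := ((innerSL ℂ η).comp x).hasSum (e.hasSum_repr ζ)
    refine this.congr_fun fun k => ?_
    simp [e.repr_apply_apply]

/-- A normal functional is determined by its values at rank one operators. -/
theorem eq_of_rankOne {ω ω' : StrongDual ℂ (BH H)} (hω : ω ∈ predual H) (hω' : ω' ∈ predual H)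
    (h : ∀ ξ θ, ω (rankOne ξ θ) = ω' (rankOne ξ θ)) : ω = ω' := by
  obtain ⟨s, e, -⟩ := exists_hilbertBasis ℂ H
  ext x
  have h1 := weakStarHasSum_rankOne e x ω hω
  simp only [h] at h1
  exact h1.unique (weakStarHasSum_rankOne e x ω' hω')

theorem ext_of_rankOne {T T' : BH H →L[ℂ] BH H}
    (hT : ∀ ω ∈ predual H, ω.comp T ∈ predual H) (hT' : ∀ ω ∈ predual H, ω.comp T' ∈ predual H)
    (h : ∀ ξ θ ζ η, inner ℂ η (T (rankOne ξ θ) ζ) = inner ℂ η (T' (rankOne ξ θ) ζ)) : T = T' := by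
  ext x ζ
  refine ext_inner_left ℂ fun η => ?_
  exact DFunLike.congr_fun (eq_of_rankOne (hT _ (vectorFunctional_mem ζ η))
    (hT' _ (vectorFunctional_mem ζ η)) fun ξ θ => h ξ θ ζ η) x

end Normality

section WeakIntegral

universe u v

variable {G : Type v} [TopologicalSpace G] [MeasurableSpace G] [T2Space G]
  [LocallyCompactSpace G] [BorelSpace G]
variable {H : Type u} [NormedAddCommGroup H] [InnerProductSpace ℂ H] [CompleteSpace H]

theorem continuous_predual_apply {X : Type*} [TopologicalSpace X] {F : X → BH H}
    (hF : ∀ ξ, Continuous fun s => F s ξ) {C : ℝ} (hC : ∀ s, ‖F s‖ ≤ C)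
    {ω : StrongDual ℂ (BH H)} (hω : ω ∈ predual H) : Continuous fun s => ω (F s) :=
  continuous_iff_continuousAt.2 fun _ => tendsto_predual hC
    (fun ξ _ => ((continuous_const.inner (hF ξ)).tendsto _)) hω

theorem continuous_apply_apply {X : Type*} [TopologicalSpace X] {F : X → BH H}
    (hF : ∀ ξ, Continuous fun s => F s ξ) {C : ℝ} (hC : ∀ s, ‖F s‖ ≤ C) {y : X → H}
    (hy : Continuous y) : Continuous fun s => F s (y s) := by
  refine continuous_iff_continuousAt.2 fun t => ?_
  have h1 : Tendsto (fun s => F s (y s - y t)) (𝓝 t) (𝓝 0) := by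
    refine squeeze_zero_norm (a := fun s => C * ‖y s - y t‖) (fun s => ?_) ?_
    · exact (F s).le_of_opNorm_le (hC s) _
    · have := ((hy.sub continuous_const).norm.const_mul C).tendsto (f := fun s => C * ‖y s - y t‖) t
      simpa using this
  have h2 := h1.add ((hF (y t)).tendsto t)
  simpa [ContinuousAt, map_sub] using h2

theorem _root_.MeasureTheory.Integrable.smul_bounded {X E : Type*} [MeasurableSpace X]
    {lam : Measure X} [NormedAddCommGroup E] [NormedSpace ℂ E] {g : X → ℂ} (hg : Integrable g lam)
    {f : X → E} (hf : AEStronglyMeasurable f lam) {C : ℝ} (hC : ∀ x, ‖f x‖ ≤ C) :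
    Integrable (fun x => g x • f x) lam := by
  refine (hg.norm.mul_const C).mono' (hg.aestronglyMeasurable.smul hf) (.of_forall fun x => ?_)
  rw [norm_smul]
  exact mul_le_mul_of_nonneg_left (hC x) (norm_nonneg _)

theorem exists_weakIntegral (lam : Measure G) [IsFiniteMeasure lam] [lam.Regular] {g : G → ℂ}
    (hg : Integrable g lam) {F : G → BH H} (hF : ∀ ξ, Continuous fun s => F s ξ) {C : ℝ}
    (hC : ∀ s, ‖F s‖ ≤ C) (hC0 : 0 ≤ C) :
    ∃ A : BH H, (∀ ξ, A ξ = ∫ s, g s • F s ξ ∂lam) ∧ ‖A‖ ≤ C * ∫ s, ‖g s‖ ∂lam ∧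
      ∀ ω ∈ predual H, ω A = ∫ s, ω (F s) * g s ∂lam := by
  have hbd : ∀ ξ s, ‖F s ξ‖ ≤ C * ‖ξ‖ := fun ξ s => (F s).le_of_opNorm_le (hC s) ξ
  have hint : ∀ ξ, Integrable (fun s => g s • F s ξ) lam := fun ξ =>
    hg.smul_bounded (aestronglyMeasurable_of_continuous lam (hF ξ)) (hbd ξ)
  have hnorm : ∀ ξ, ‖∫ s, g s • F s ξ ∂lam‖ ≤ (C * ∫ s, ‖g s‖ ∂lam) * ‖ξ‖ := by
    intro ξ
    calc _ ≤ ∫ s, ‖g s‖ * (C * ‖ξ‖) ∂lam :=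
          norm_integral_le_of_norm_le (hg.norm.mul_const _) (.of_forall fun s => by
            rw [norm_smul]; exact mul_le_mul_of_nonneg_left (hbd ξ s) (norm_nonneg _))
      _ = _ := by rw [integral_mul_const]; ring
  let A : BH H := LinearMap.mkContinuous
    { toFun := fun ξ => ∫ s, g s • F s ξ ∂lam
      map_add' := fun ξ η => by
        simp only [map_add, smul_add]
        exact integral_add (hint ξ) (hint η)
      map_smul' := fun c ξ => by
        simp only [map_smul, smul_comm _ c, RingHom.id_apply]
        exact integral_smul c _ } (C * ∫ s, ‖g s‖ ∂lam) hnorm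
  have hpos : 0 ≤ C * ∫ s, ‖g s‖ ∂lam := by positivity
  refine ⟨A, fun _ => rfl, LinearMap.mkContinuous_norm_le _ hpos _, fun ω hω => ?_⟩
  have hω' : ∀ ω : predual H, Integrable (fun s => (ω : StrongDual ℂ (BH H)) (F s) * g s) lam := by
    intro ω
    have := hg.smul_bounded (aestronglyMeasurable_of_continuous lam
      (continuous_predual_apply hF hC ω.2)) (C := ‖(ω : StrongDual ℂ (BH H))‖ * C)
      fun s => (ω : StrongDual ℂ (BH H)).le_opNorm_of_le (hC s)
    simpa only [smul_eq_mul, mul_comm] using this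
  let q : predual H →ₗ[ℂ] ℂ :=
    { toFun := fun ω => ∫ s, (ω : StrongDual ℂ (BH H)) (F s) * g s ∂lam
      map_add' := fun ω ω' => by
        simp only [Submodule.coe_add, _root_.add_apply, add_mul]
        exact integral_add (hω' ω) (hω' ω')
      map_smul' := fun c ω => by
        simp only [Submodule.coe_smul, _root_.smul_apply, smul_eq_mul, RingHom.id_apply, mul_assoc]
        exact integral_const_mul c _ }
  have key := predual_ext (f := evalAt A) (g := q) (K := ‖A‖) (L := C * ∫ s, ‖g s‖ ∂lam)
    (fun ω => ?_) (fun ω => ?_) (fun ξ η => ?_)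
  · exact LinearMap.congr_fun key ⟨ω, hω⟩
  · rw [mul_comm]
    exact (ω : StrongDual ℂ (BH H)).le_opNorm A
  · calc ‖q ω‖ ≤ ∫ s, ‖(ω : StrongDual ℂ (BH H))‖ * C * ‖g s‖ ∂lam :=
          norm_integral_le_of_norm_le (hg.norm.const_mul _) (.of_forall fun s => by
            rw [norm_mul]
            exact mul_le_mul_of_nonneg_right
              ((ω : StrongDual ℂ (BH H)).le_opNorm_of_le (hC s)) (norm_nonneg _))
      _ = _ := by rw [integral_const_mul, ← Submodule.coe_norm]; ring
  · change inner ℂ η (∫ s, g s • F s ξ ∂lam) = ∫ s, inner ℂ η (F s ξ) * g s ∂lam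
    rw [← integral_inner (hint ξ)]
    simp only [inner_smul_right, mul_comm]

theorem eq_of_predual {A B : BH H} (h : ∀ ω ∈ predual H, ω A = ω B) : A = B := by
  ext ξ
  exact ext_inner_left ℂ fun η => h _ (vectorFunctional_mem ξ η)

theorem exists_weakIntegral_measure (μ : MG G) {F : G → BH H} (hF : ∀ ξ, Continuous fun s => F s ξ)
    {C : ℝ} (hC : ∀ s, ‖F s‖ ≤ C) (hC0 : 0 ≤ C) : ∃ A : BH H, ‖A‖ ≤ C * mnorm μ ∧
      ∀ ω ∈ predual H, ω A = cintegral (μ : ComplexMeasure G) fun s => ω (F s) := by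
  obtain ⟨h, hm, h1, hμ⟩ := exists_polar μ
  obtain ⟨A, -, hA, hω⟩ := exists_weakIntegral (μ : ComplexMeasure G).variation
    (g := h) (.of_bound hm.aestronglyMeasurable 1 (.of_forall fun x => (h1 x).le)) hF hC hC0
  refine ⟨A, ?_, fun ω h => (hω ω h).trans (hμ _).symm⟩
  simpa [h1, mnorm, measureReal_def] using hA

end WeakIntegral

section Representation

universe u v

variable {G : Type v} [TopologicalSpace G] [MeasurableSpace G] [T2Space G]
  [LocallyCompactSpace G] [BorelSpace G] [Group G] [IsTopologicalGroup G]
variable {H : Type u} [NormedAddCommGroup H] [InnerProductSpace ℂ H] [CompleteSpace H]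
variable (π : G →* unitary (BH H))

theorem star_rep (s : G) : star (π s : BH H) = (π s⁻¹ : BH H) := by
  rw [map_inv]; rfl

theorem norm_rep_apply (s : G) (ξ : H) : ‖(π s : BH H) ξ‖ = ‖ξ‖ :=
  Unitary.norm_map (π s) ξ

theorem norm_star_rep_apply (s : G) (ξ : H) : ‖(star (π s : BH H)) ξ‖ = ‖ξ‖ := by
  rw [star_rep, norm_rep_apply]

theorem norm_rep_le (s : G) : ‖(π s : BH H)‖ ≤ 1 :=
  ContinuousLinearMap.opNorm_le_bound _ zero_le_one fun ξ => by rw [norm_rep_apply, one_mul]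

theorem norm_conj_le (s : G) (x : BH H) : ‖(π s : BH H) * x * star (π s : BH H)‖ ≤ ‖x‖ := by
  calc _ ≤ ‖(π s : BH H)‖ * ‖x‖ * ‖(π s⁻¹ : BH H)‖ := by
        rw [star_rep]; exact (norm_mul_le _ _).trans (by gcongr; exact norm_mul_le _ _)
    _ ≤ 1 * ‖x‖ * 1 := by gcongr <;> exact norm_rep_le π _
    _ = _ := by ring

variable {π} (hπ : ∀ ξ : H, Continuous fun s => (π s : BH H) ξ)
include hπ

theorem continuous_star_rep (ξ : H) : Continuous fun s => (star (π s : BH H)) ξ := by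
  simp only [star_rep]
  exact (hπ ξ).comp continuous_inv

theorem continuous_conj (x : BH H) (ξ : H) :
    Continuous fun s => ((π s : BH H) * x * star (π s : BH H)) ξ :=
  continuous_apply_apply hπ (norm_rep_le π) (x.continuous.comp (continuous_star_rep hπ ξ))

theorem exists_conjIntegral (μ : MG G) : ∃ T : BH H →L[ℂ] BH H, ∀ x, ∀ ω ∈ predual H,
    ω (T x) = cintegral (μ : ComplexMeasure G) fun s =>
      ω ((π s : BH H) * x * star (π s : BH H)) := by
  choose T hT hω using fun x : BH H => exists_weakIntegral_measure μ
    (F := fun s => (π s : BH H) * x * star (π s : BH H)) (continuous_conj hπ x)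
    (fun s => norm_conj_le π s x) (norm_nonneg x)
  have hc : ∀ (x : BH H), ∀ ω ∈ predual H,
      Continuous fun s => ω ((π s : BH H) * x * star (π s : BH H)) := fun x ω h =>
    continuous_predual_apply (continuous_conj hπ x) (fun s => norm_conj_le π s x) h
  have hb : ∀ (x : BH H) (ω : StrongDual ℂ (BH H)) (s : G),
      ‖ω ((π s : BH H) * x * star (π s : BH H))‖ ≤ ‖ω‖ * ‖x‖ := fun x ω s =>
    ω.le_opNorm_of_le (norm_conj_le π s x)
  refine ⟨LinearMap.mkContinuous
    { toFun := T
      map_add' := fun x y => eq_of_predual fun ω h => ?_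
      map_smul' := fun c x => eq_of_predual fun ω h => ?_ } (mnorm μ) fun x => ?_, hω⟩
  · rw [map_add, hω _ ω h, hω _ ω h, hω _ ω h]
    simp only [mul_add, add_mul, map_add]
    exact VectorMeasure.integral_fun_add (integrable_variation μ (hc x ω h) (hb x ω))
      (integrable_variation μ (hc y ω h) (hb y ω))
  · simp only [RingHom.id_apply]
    rw [map_smul, hω _ ω h, hω _ ω h, smul_eq_mul]
    simp only [mul_smul_comm, smul_mul_assoc, map_smul, smul_eq_mul]
    obtain ⟨k, hm, h1, hμ⟩ := exists_polar μ
    rw [hμ, hμ, ← integral_const_mul]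
    simp only [mul_assoc]
  · rw [mul_comm]
    exact hT x

/-- The operator `x ↦ ∫ π(s) x π(s)* dμ(s)`. -/
noncomputable def conjIntegral : MG G →ₗ[ℂ] (BH H →L[ℂ] BH H) where
  toFun μ := (exists_conjIntegral hπ μ).choose
  map_add' μ ν := by
    ext1 x
    refine eq_of_predual fun ω h => ?_
    rw [_root_.add_apply, map_add, (exists_conjIntegral hπ _).choose_spec x ω h,
      (exists_conjIntegral hπ _).choose_spec x ω h, (exists_conjIntegral hπ _).choose_spec x ω h]
    exact cintegral_add_measure μ ν
      (continuous_predual_apply (continuous_conj hπ x) (fun s => norm_conj_le π s x) h)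
      fun s => ω.le_opNorm_of_le (norm_conj_le π s x)
  map_smul' c μ := by
    ext1 x
    refine eq_of_predual fun ω h => ?_
    rw [RingHom.id_apply, _root_.smul_apply, map_smul, (exists_conjIntegral hπ _).choose_spec x ω h,
      (exists_conjIntegral hπ _).choose_spec x ω h]
    exact cintegral_smul_measure c μ
      (continuous_predual_apply (continuous_conj hπ x) (fun s => norm_conj_le π s x) h)
      fun s => ω.le_opNorm_of_le (norm_conj_le π s x)

theorem predual_conjIntegral (μ : MG G) (x : BH H) {ω : StrongDual ℂ (BH H)} (h : ω ∈ predual H) :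
    ω (conjIntegral hπ μ x) = cintegral (μ : ComplexMeasure G) fun s =>
      ω ((π s : BH H) * x * star (π s : BH H)) :=
  (exists_conjIntegral hπ μ).choose_spec x ω h

theorem conjIntegral_comp (hnormal : ∀ μ, ∀ ω ∈ predual H, ω.comp (conjIntegral hπ μ) ∈ predual H)
    {μ ν ρ : MG G} (h : IsConvolution μ ν ρ) :
    conjIntegral hπ ρ = (conjIntegral hπ μ).comp (conjIntegral hπ ν) := by
  ext1 x
  refine eq_of_predual fun ω hω => ?_
  have h1 := predual_conjIntegral hπ ν x (hnormal μ ω hω)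
  refine Eq.trans ?_ h1.symm
  rw [predual_conjIntegral hπ ρ x hω, h.integral_eq
    (continuous_predual_apply (continuous_conj hπ x) (fun s => norm_conj_le π s x) hω)
    fun s => ω.le_opNorm_of_le (norm_conj_le π s x)]
  congr 1
  ext t
  refine Eq.trans ?_ (predual_conjIntegral hπ μ _ hω).symm
  simp only [map_mul, Submonoid.coe_mul, star_mul, mul_assoc]

end Representation

section Parseval

variable {X : Type*} [MeasurableSpace X] {lam : Measure X} [IsFiniteMeasure lam]
variable {H : Type*} [NormedAddCommGroup H] [InnerProductSpace ℂ H] [CompleteSpace H]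

/-- The function `s ↦ f s • e` as an element of the vector valued `L²` space. -/
noncomputable def lpTensor (f : Lp ℂ 2 lam) (e : H) : Lp H 2 lam :=
  (ContinuousLinearMap.toSpanSingleton ℂ e).compLp f

theorem coeFn_lpTensor (f : Lp ℂ 2 lam) (e : H) : lpTensor f e =ᵐ[lam] fun s => f s • e :=
  ContinuousLinearMap.coeFn_compLp _ f

theorem integrable_conj_smul (f : Lp ℂ 2 lam) {F : X → H} (hF : MemLp F 2 lam) :
    Integrable (fun s => (starRingEnd ℂ (f s)) • F s) lam :=
  memLp_one_iff_integrable.1 (hF.smul (Lp.memLp f).star)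

theorem inner_lpTensor (f : Lp ℂ 2 lam) (e : H) (F : Lp H 2 lam) :
    inner ℂ (lpTensor f e) F = inner ℂ e (∫ s, (starRingEnd ℂ (f s)) • F s ∂lam) := by
  rw [L2.inner_def, ← integral_inner (integrable_conj_smul f (Lp.memLp F))]
  refine integral_congr_ae ((coeFn_lpTensor f e).mono fun s hs => ?_)
  simp only [hs, inner_smul_left, inner_smul_right]

theorem inner_lpTensor_lpTensor (f g : Lp ℂ 2 lam) (e e' : H) :
    inner ℂ (lpTensor f e) (lpTensor g e') = inner ℂ f g * inner ℂ e e' := by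
  rw [L2.inner_def, L2.inner_def, ← integral_mul_const]
  refine integral_congr_ae ?_
  filter_upwards [coeFn_lpTensor f e, coeFn_lpTensor g e'] with s h1 h2
  simp only [h1, h2, inner_smul_left, inner_smul_right, RCLike.inner_apply]
  ring

theorem orthonormal_lpTensor {I J : Type*} {b : I → Lp ℂ 2 lam} (hb : Orthonormal ℂ b)
    {e : J → H} (he : Orthonormal ℂ e) :
    Orthonormal ℂ fun p : I × J => lpTensor (b p.1) (e p.2) := by
  classical
  rw [orthonormal_iff_ite] at hb he ⊢
  intro p q
  rw [inner_lpTensor_lpTensor, hb, he]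
  by_cases h1 : p.1 = q.1 <;> by_cases h2 : p.2 = q.2 <;> simp [h1, h2, Prod.ext_iff]

theorem eq_zero_of_inner_lpTensor {I J : Type*} (b : HilbertBasis I ℂ (Lp ℂ 2 lam))
    (e : HilbertBasis J ℂ H) {F : Lp H 2 lam}
    (h : ∀ i j, inner ℂ (lpTensor (b i) (e j)) F = 0) : F = 0 := by
  have hFi : Integrable F lam := (Lp.memLp F).integrable one_le_two
  have h1 : ∀ j, (fun s => inner ℂ (e j) (F s)) =ᵐ[lam] 0 := by
    intro j
    have hm : MemLp (fun s => inner ℂ (e j) (F s)) 2 lam := (Lp.memLp F).const_inner (e j)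
    have hz : hm.toLp = 0 := by
      refine b.repr.injective ?_
      ext i
      rw [b.repr_apply_apply, map_zero, L2.inner_def]
      refine Eq.trans ?_ ((inner_lpTensor (b i) (e j) F).symm.trans (h i j))
      rw [← integral_inner (integrable_conj_smul (b i) (Lp.memLp F))]
      refine integral_congr_ae (hm.coeFn_toLp.mono fun s hs => ?_)
      simp only [hs, inner_smul_right, RCLike.inner_apply]
      exact mul_comm _ _
    exact hm.coeFn_toLp.symm.trans (hz ▸ Lp.coeFn_zero ..)
  have h2 : F =ᵐ[lam] 0 := by
    refine hFi.ae_eq_zero_of_forall_setIntegral_eq_zero fun E hE _ => ?_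
    refine e.repr.injective ?_
    ext j
    rw [e.repr_apply_apply, map_zero, ← integral_inner hFi.integrableOn]
    exact integral_eq_zero_of_ae (ae_restrict_of_ae (h1 j))
  exact Lp.eq_zero_iff_ae_eq_zero.2 h2

theorem hasSum_inner_integral {I : Type*} (b : HilbertBasis I ℂ (Lp ℂ 2 lam)) {F K : X → H}
    (hF : MemLp F 2 lam) (hK : MemLp K 2 lam) :
    HasSum (fun i => inner ℂ (∫ s, (starRingEnd ℂ (b i s)) • F s ∂lam)
      (∫ s, (starRingEnd ℂ (b i s)) • K s ∂lam)) (∫ s, inner ℂ (F s) (K s) ∂lam) := by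
  obtain ⟨J, e, -⟩ := exists_hilbertBasis ℂ H
  let B : HilbertBasis (I × J) ℂ (Lp H 2 lam) := HilbertBasis.mkOfOrthogonalEqBot
    (orthonormal_lpTensor b.orthonormal e.orthonormal) (by
      refine (Submodule.eq_bot_iff _).2 fun F hF => eq_zero_of_inner_lpTensor b e fun i j => ?_
      exact (Submodule.mem_orthogonal _ _).1 hF _ (Submodule.subset_span ⟨(i, j), rfl⟩))
  have hB : ∀ p, B p = lpTensor (b p.1) (e p.2) := fun p => by
    simp only [B, HilbertBasis.coe_mkOfOrthogonalEqBot]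
  have hco : ∀ {F : X → H} (hF : MemLp F 2 lam) (i : I),
      ∫ s, (starRingEnd ℂ (b i s)) • hF.toLp F s ∂lam = ∫ s, (starRingEnd ℂ (b i s)) • F s ∂lam :=
    fun hF i => integral_congr_ae (hF.coeFn_toLp.mono fun s hs => by
      change _ • _ = _ • _
      rw [hs])
  have h1 := B.hasSum_inner_mul_inner hF.toLp hK.toLp
  have h2 : inner ℂ hF.toLp hK.toLp = ∫ s, inner ℂ (F s) (K s) ∂lam := by
    rw [L2.inner_def]
    refine integral_congr_ae ?_
    filter_upwards [hF.coeFn_toLp, hK.coeFn_toLp] with s h h'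
    rw [h, h']
  rw [h2] at h1
  refine h1.prod_fiberwise fun i => ?_
  refine (e.hasSum_inner_mul_inner (∫ s, (starRingEnd ℂ (b i s)) • F s ∂lam)
      (∫ s, (starRingEnd ℂ (b i s)) • K s ∂lam)).congr_fun fun j => ?_
  rw [hB, inner_lpTensor, ← inner_conj_symm, inner_lpTensor, inner_conj_symm, hco, hco]

end Parseval

section Index

universe u

variable {H : Type u} [NormedAddCommGroup H] [InnerProductSpace ℂ H] [CompleteSpace H]
variable {ι : Type*} {v w : ι → BH H} {a b : BH H} {T : BH H →L[ℂ] BH H}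

theorem IsEHSeries.comp_injective (h : IsEHSeries v w a b T) {κ : Type*} {f : κ → ι}
    (hf : Function.Injective f) (hv : ∀ i ∉ range f, v i = 0) (hw : ∀ i ∉ range f, w i = 0) :
    IsEHSeries (fun k => v (f k)) (fun k => w (f k)) a b T where
  row ω hω := (hf.hasSum_iff fun i hi => by simp [hv i hi]).2 (h.row ω hω)
  col ω hω := (hf.hasSum_iff fun i hi => by simp [hw i hi]).2 (h.col ω hω)
  apply x ω hω := (hf.hasSum_iff fun i hi => by simp [hw i hi]).2 (h.apply x ω hω)

theorem small_support_of_weakStarHasSum {c : ι → BH H}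
    (h : WeakStarHasSum (fun i => star (c i) * c i) b) : Small.{u} {i | c i ≠ 0} := by
  have : {i | c i ≠ 0} ⊆ ⋃ ξ : H, {i | ‖c i ξ‖ ^ 2 ≠ 0} := by
    intro i hi
    by_contra hn
    simp only [mem_iUnion, mem_ofPred_eq, not_exists, not_not] at hn
    exact hi (by ext ξ; simpa using hn ξ)
  have hc : ∀ ξ : H, Small.{u} {i | ‖c i ξ‖ ^ 2 ≠ 0} := fun ξ =>
    have : Countable {i | ‖c i ξ‖ ^ 2 ≠ 0} :=
      (hasSum_norm_sq_of_weakStarHasSum h ξ).summable.countable_support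
    inferInstance
  exact small_subset this

/-- The index type of a series can be chosen in the universe of the Hilbert space. -/
theorem IsEHSeries.exists_index (h : IsEHSeries v w a b T) :
    ∃ (κ : Type u) (f : κ → ι), IsEHSeries (fun k => v (f k)) (fun k => w (f k)) a b T := by
  have h1 : Small.{u} {i | v i ≠ 0} := by
    have := small_support_of_weakStarHasSum h.row'
    simpa only [ne_eq, star_eq_zero] using this
  have h2 : Small.{u} {i | w i ≠ 0} := small_support_of_weakStarHasSum h.col
  let J := {i | v i ≠ 0} ∪ {i | w i ≠ 0}
  have h3 : Small.{u} J := small_union _ _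
  have hr : ∀ i ∉ range (fun k : Shrink.{u} J => ((equivShrink J).symm k : ι)), i ∉ J := by
    intro i hi hJ
    exact hi ⟨equivShrink J ⟨i, hJ⟩, by simp⟩
  refine ⟨Shrink.{u} J, fun k => (equivShrink J).symm k, h.comp_injective
    (Subtype.val_injective.comp (equivShrink J).symm.injective) (fun i hi => ?_) fun i hi => ?_⟩
  · by_contra hne
    exact hr i hi (Or.inl hne)
  · by_contra hne
    exact hr i hi (Or.inr hne)

theorem IsEHSeries.mem_extHaagerup (h : IsEHSeries v w a b T) {V W : Set (BH H)}
    (hv : ∀ i, v i ∈ V) (hw : ∀ i, w i ∈ W) : T ∈ extHaagerup V W := by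
  obtain ⟨κ, f, hf⟩ := h.exists_index
  exact ⟨κ, _, _, a, b, fun k => hv (f k), fun k => hw (f k), hf⟩

theorem IsEHSeries.ehNorm_le (h : IsEHSeries v w a b T) : ehNorm T ≤ √‖a‖ * √‖b‖ := by
  obtain ⟨κ, f, hf⟩ := h.exists_index
  refine csInf_le ⟨0, ?_⟩ ⟨κ, _, _, a, b, hf, rfl⟩
  rintro r ⟨κ, v, w, a, b, -, rfl⟩
  positivity

end Index

section Factorization

universe u v

variable {G : Type v} [TopologicalSpace G] [MeasurableSpace G] [T2Space G]
  [LocallyCompactSpace G] [BorelSpace G] [Group G] [IsTopologicalGroup G]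
variable {H : Type u} [NormedAddCommGroup H] [InnerProductSpace ℂ H] [CompleteSpace H]
variable {π : G →* unitary (BH H)} (hπ : ∀ ξ : H, Continuous fun s => (π s : BH H) ξ)
include hπ

/-- The series `∑ᵢ (∫ bᵢ(s) h(s) π(s) d|μ|(s)) ⊗ (∫ conj (bᵢ(s)) π(s)* d|μ|(s))`, where `h` is the
phase of `μ` and `b` is a Hilbert basis of `L²(|μ|)`. -/
theorem exists_series_conjIntegral (μ : MG G) :
    ∃ (I : Type v) (v w : I → BH H) (a b : BH H), IsEHSeries v w a b (conjIntegral hπ μ) ∧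
      ‖a‖ ≤ mnorm μ ∧ ‖b‖ ≤ mnorm μ ∧
      (∀ i, ∃ g : G → ℂ, Integrable g (μ : ComplexMeasure G).variation ∧ ∀ ω ∈ predual H,
        ω (v i) = ∫ s, ω (π s : BH H) * g s ∂(μ : ComplexMeasure G).variation) ∧
      ∀ i, ∃ g : G → ℂ, Integrable g (μ : ComplexMeasure G).variation ∧ ∀ ω ∈ predual H,
        ω (w i) = ∫ s, ω (star (π s : BH H)) * g s ∂(μ : ComplexMeasure G).variation := by
  obtain ⟨h, hm, h1, hμ⟩ := exists_polar μ
  have hcoe : mnorm μ = (μ : ComplexMeasure G).variation.real univ := rfl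
  set lam := (μ : ComplexMeasure G).variation
  obtain ⟨S, b, -⟩ := exists_hilbertBasis ℂ (Lp ℂ 2 lam)
  have hb : ∀ i, Integrable (b i) lam := fun i => (Lp.memLp (b i)).integrable one_le_two
  have hbc : ∀ i, Integrable (fun s => starRingEnd ℂ (b i s)) lam := fun i =>
    (Lp.memLp (b i)).star.integrable one_le_two
  have hbh : ∀ i, Integrable (fun s => b i s * h s) lam := fun i => by
    simpa only [smul_eq_mul] using
      (hb i).smul_bounded hm.aestronglyMeasurable (fun s => (h1 s).le)
  choose v hv hvn hvω using fun i => exists_weakIntegral lam (hbh i) hπ (norm_rep_le π) zero_le_one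
  choose w hw hwn hwω using fun i => exists_weakIntegral lam (hbc i) (continuous_star_rep hπ)
    (fun s => by rw [star_rep]; exact norm_rep_le π s⁻¹) zero_le_one
  have hF : ∀ ζ : H, MemLp (fun s => (star (π s : BH H)) ζ) 2 lam := fun ζ =>
    .of_bound (aestronglyMeasurable_of_continuous lam (continuous_star_rep hπ ζ)) ‖ζ‖
      (.of_forall fun s => (norm_star_rep_apply π s ζ).le)
  have hK : ∀ ζ : H, MemLp (fun s => (starRingEnd ℂ (h s)) • (star (π s : BH H)) ζ) 2 lam :=
    fun ζ => .of_bound ((Complex.continuous_conj.measurable.comp hm).aestronglyMeasurable.smul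
      (aestronglyMeasurable_of_continuous lam (continuous_star_rep hπ ζ))) ‖ζ‖
      (.of_forall fun s => by rw [norm_smul, RCLike.norm_conj, h1, one_mul, norm_star_rep_apply])
  have hvs : ∀ i η, (star (v i)) η =
      ∫ s, (starRingEnd ℂ (b i s)) • ((starRingEnd ℂ (h s)) • (star (π s : BH H)) η) ∂lam := by
    intro i η
    refine ext_inner_right ℂ fun ξ => ?_
    have e1 : inner ℂ ((star (v i)) η) ξ = inner ℂ η (v i ξ) :=
      ContinuousLinearMap.adjoint_inner_left (v i) ξ η
    rw [e1, hv, ← inner_conj_symm _ ξ, ← integral_inner (integrable_conj_smul (b i) (hK η)),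
      ← integral_conj, ← integral_inner ((hbh i).smul_bounded
        (aestronglyMeasurable_of_continuous lam (hπ ξ)) fun s => (norm_rep_apply π s ξ).le)]
    congr 1
    ext s
    have e2 : inner ℂ ((star (π s : BH H)) η) ξ = inner ℂ η ((π s : BH H) ξ) :=
      ContinuousLinearMap.adjoint_inner_left (π s : BH H) ξ η
    rw [inner_conj_symm, smul_smul, inner_smul_left, inner_smul_right, e2]
    simp
  have hinner : ∀ ζ η : H, ∀ s : G, inner ℂ ((star (π s : BH H)) ζ) ((star (π s : BH H)) η) =
      inner ℂ ζ η := fun ζ η s => by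
    rw [star_rep]
    exact Unitary.inner_map_map (π s⁻¹) ζ η
  have hcol : ∀ ζ η, HasSum (fun i => inner ℂ (w i η) (w i ζ)) (lam.real univ * inner ℂ η ζ) := by
    intro ζ η
    have := hasSum_inner_integral b (hF η) (hF ζ)
    simp only [← hw, hinner, integral_const] at this
    simpa using this
  have hrow : ∀ ζ η, HasSum (fun i => inner ℂ ((star (v i)) η) ((star (v i)) ζ))
      (lam.real univ * inner ℂ η ζ) := by
    intro ζ η
    have := hasSum_inner_integral b (hK η) (hK ζ)
    simp only [← hvs, inner_smul_left, inner_smul_right, hinner, ← mul_assoc, RingHomCompTriple.comp_apply,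
      RingHom.id_apply] at this
    have e : ∀ s, starRingEnd ℂ (h s) * h s = 1 := fun s => by
      rw [RCLike.conj_mul, h1]; simp
    simp only [e, one_mul, integral_const] at this
    simpa using this
  have hbound : ∀ {c : S → BH H} (_ : ∀ ζ η, HasSum (fun i => inner ℂ (c i η) (c i ζ))
      (lam.real univ * inner ℂ η ζ)) (s : Finset S) (ζ : H),
      ∑ i ∈ s, ‖c i ζ‖ ^ 2 ≤ (√(lam.real univ) * ‖ζ‖) ^ 2 := by
    intro c hc s ζ
    have h2 := Complex.hasSum_re (hc ζ ζ)
    have h3 : HasSum (fun i => ‖c i ζ‖ ^ 2) ((√(lam.real univ) * ‖ζ‖) ^ 2) := by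
      convert h2 using 1
      · ext i
        exact (inner_self_eq_norm_sq (𝕜 := ℂ) (c i ζ)).symm
      · rw [mul_pow, Real.sq_sqrt measureReal_nonneg, Complex.re_ofReal_mul]
        congr 1
        exact (inner_self_eq_norm_sq (𝕜 := ℂ) ζ).symm
    exact sum_le_hasSum s (fun i _ => by positivity) h3
  have hsum : ∀ {r c : S → BH H} (_ : ∀ ζ η, HasSum (fun i => inner ℂ (r i η) (r i ζ))
      (lam.real univ * inner ℂ η ζ)) (_ : ∀ ζ η, HasSum (fun i => inner ℂ (c i η) (c i ζ))
      (lam.real univ * inner ℂ η ζ)) (x y : BH H)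
      (_ : ∀ ζ η, HasSum (fun i => inner ℂ (r i η) (x (c i ζ))) (inner ℂ η (y ζ))),
      WeakStarHasSum (fun i => star (r i) * x * c i) y := by
    intro r c hr hc x y hy
    refine weakStarHasSum_of_inner (C := √(lam.real univ) * √(lam.real univ) * ‖x‖) (fun s =>
      norm_sum_star_mul_mul_le s x (by positivity) (by positivity) (hbound hr s) (hbound hc s))
      fun ζ η => (hy ζ η).congr_fun fun i => ?_
    exact ContinuousLinearMap.adjoint_inner_right (r i) η (x (c i ζ))
  have hone : ∀ {c : S → BH H} (_ : ∀ ζ η, HasSum (fun i => inner ℂ (c i η) (c i ζ))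
      (lam.real univ * inner ℂ η ζ)),
      WeakStarHasSum (fun i => star (c i) * c i) ((lam.real univ : ℂ) • (1 : BH H)) := by
    intro c hc
    have := hsum hc hc 1 ((lam.real univ : ℂ) • (1 : BH H)) fun ζ η => by
      simpa [inner_smul_right] using hc ζ η
    simpa only [mul_one] using this
  have hn : ‖(lam.real univ : ℂ) • (1 : BH H)‖ ≤ lam.real univ := by
    rw [norm_smul, Complex.norm_real, Real.norm_of_nonneg measureReal_nonneg]
    exact mul_le_of_le_one_right measureReal_nonneg ContinuousLinearMap.norm_id_le
  refine ⟨S, v, w, (lam.real univ : ℂ) • (1 : BH H), (lam.real univ : ℂ) • (1 : BH H),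
    ⟨?_, hone hcol, fun x => ?_⟩, hn, hn, fun i => ⟨_, hbh i, hvω i⟩, fun i => ⟨_, hbc i, hwω i⟩⟩
  · simpa only [star_star] using hone hrow
  · have := hsum (r := fun i => star (v i)) hrow hcol x (conjIntegral hπ μ x) fun ζ η => ?_
    · simpa only [star_star] using this
    · have hx : MemLp (fun s => x ((star (π s : BH H)) ζ)) 2 lam := x.comp_memLp' (hF ζ)
      have h2 := hasSum_inner_integral b (hK η) hx
      have h3 : ∀ i, ∫ s, (starRingEnd ℂ (b i s)) • x ((star (π s : BH H)) ζ) ∂lam =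
          x (w i ζ) := fun i => by
        rw [hw, ← x.integral_comp_comm (integrable_conj_smul (b i) (hF ζ))]
        simp only [map_smul]
      simp only [← hvs, h3] at h2
      convert h2 using 1
      refine (predual_conjIntegral hπ μ x (vectorFunctional_mem ζ η)).trans ?_
      rw [hμ]
      congr 1
      ext s
      rw [inner_smul_left, RCLike.conj_conj, mul_comm]
      congr 1
      exact (ContinuousLinearMap.adjoint_inner_left (π s : BH H)
        (x ((star (π s : BH H)) ζ)) η).symm

theorem comp_conjIntegral_mem_predual (μ : MG G) {ω : StrongDual ℂ (BH H)} (h : ω ∈ predual H) :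
    ω.comp (conjIntegral hπ μ) ∈ predual H := by
  obtain ⟨I, v, w, a, b, hs, -⟩ := exists_series_conjIntegral hπ μ
  exact hs.comp_mem_predual h

theorem ehNorm_conjIntegral_le (μ : MG G) : ehNorm (conjIntegral hπ μ) ≤ mnorm μ := by
  obtain ⟨I, v, w, a, b, hs, ha, hb, -⟩ := exists_series_conjIntegral hπ μ
  refine hs.ehNorm_le.trans ?_
  calc √‖a‖ * √‖b‖ ≤ √(mnorm μ) * √(mnorm μ) := by gcongr
    _ = mnorm μ := Real.mul_self_sqrt (mnorm_nonneg μ)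

theorem exists_isPi1_of_density (lam : Measure G) [IsFiniteMeasure lam] [lam.Regular] {A : BH H}
    {g : G → ℂ} (hg : Integrable g lam)
    (hA : ∀ ω ∈ predual H, ω A = ∫ s, ω (π s : BH H) * g s ∂lam) :
    ∃ ν : MG G, (ν : ComplexMeasure G).variation ≪ lam ∧ IsPi1 π ν A := by
  obtain ⟨ν, hν, hf⟩ := exists_density lam hg
  refine ⟨ν, hν, fun ω hω => ?_⟩
  rw [hA ω hω, hf _ (aestronglyMeasurable_of_continuous lam
    (continuous_predual_apply hπ (norm_rep_le π) hω))
    ⟨‖ω‖ * 1, fun s => ω.le_opNorm_of_le (norm_rep_le π s)⟩]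

theorem exists_isPi1_of_density_star (lam : Measure G) [IsFiniteMeasure lam] [lam.Regular]
    {A : BH H} {g : G → ℂ} (hg : Integrable g lam)
    (hA : ∀ ω ∈ predual H, ω A = ∫ s, ω (star (π s : BH H)) * g s ∂lam) :
    ∃ ν : MG G, (ν : ComplexMeasure G).variation ≪ lam.map Inv.inv ∧ IsPi1 π ν A := by
  have hfin : IsFiniteMeasure (lam.map Inv.inv) := inferInstance
  have hreg : (lam.map Inv.inv).Regular := Measure.Regular.map (Homeomorph.inv G)
  have hemb : MeasurableEmbedding (Inv.inv : G → G) := (Homeomorph.inv G).measurableEmbedding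
  refine exists_isPi1_of_density hπ (lam.map Inv.inv) (g := fun s => g s⁻¹)
    (hemb.integrable_map_iff.2 ?_) fun ω hω => ?_
  · simpa [Function.comp_def] using hg
  · rw [hA ω hω, hemb.integral_map]
    simp only [inv_inv, star_rep]

theorem conjIntegral_mem_extHaagerup {S : Set (MG G)} (μ : MG G)
    (h1 : ∀ ν : MG G, (ν : ComplexMeasure G).variation ≪ (μ : ComplexMeasure G).variation → ν ∈ S)
    (h2 : ∀ ν : MG G, (ν : ComplexMeasure G).variation ≪
      (μ : ComplexMeasure G).variation.map Inv.inv → ν ∈ S) :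
    conjIntegral hπ μ ∈ extHaagerup (closedRange π S) (closedRange π S) := by
  obtain ⟨I, v, w, a, b, hs, -, -, hv, hw⟩ := exists_series_conjIntegral hπ μ
  refine hs.mem_extHaagerup (fun i => subset_closure ?_) fun i => subset_closure ?_
  · obtain ⟨g, hg, hA⟩ := hv i
    obtain ⟨ν, hν, hp⟩ := exists_isPi1_of_density hπ _ hg hA
    exact ⟨ν, h1 ν hν, hp⟩
  · obtain ⟨g, hg, hA⟩ := hw i
    obtain ⟨ν, hν, hp⟩ := exists_isPi1_of_density_star hπ _ hg hA
    exact ⟨ν, h2 ν hν, hp⟩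

theorem conjIntegral_mem_Mstar (μ : MG G) :
    conjIntegral hπ μ ∈ extHaagerup (Mstar π) (Mstar π) :=
  conjIntegral_mem_extHaagerup hπ μ (fun _ _ => mem_univ _) fun _ _ => mem_univ _

theorem conjIntegral_mem_Cstar {μ : MG G} (hμ : μ ∈ L1 G) :
    conjIntegral hπ μ ∈ extHaagerup (Cstar π) (Cstar π) :=
  conjIntegral_mem_extHaagerup hπ μ (fun _ h => h.trans hμ) fun _ h =>
    h.trans (map_inv_absolutelyContinuous_haar _ hμ)

end Factorization

section Pairing

universe u

variable {H : Type u} [NormedAddCommGroup H] [InnerProductSpace ℂ H] [CompleteSpace H]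
variable {ι : Type*} {v w : ι → BH H} {a b : BH H} {T : BH H →L[ℂ] BH H}

theorem IsEHSeries.norm_pairing_tmul_le (h : IsEHSeries v w a b T) (ω ν : predual H) :
    ‖h.pairing (ω ⊗ₜ ν)‖ ≤ √‖a‖ * √‖b‖ * ‖ω‖ * ‖ν‖ := by
  rw [mul_assoc]
  exact (h.norm_pairing_le _).trans (mul_le_mul_of_nonneg_left (hNorm_tmul_le ω ν) (by positivity))

theorem IsEHSeries.pairing_eq_pairing (h : IsEHSeries v w a b T) {κ : Type*} {v' w' : κ → BH H}
    {a' b' : BH H} (h' : IsEHSeries v' w' a' b' T) : h.pairing = h'.pairing :=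
  h.pairing_eq h'.norm_pairing_tmul_le h'.pairing_vectorFunctional

theorem IsEHSeries.pairsTo (h : IsEHSeries v w a b T) {z : ℕ → predual H ⊗[ℂ] predual H} {c : ℂ}
    (hc : Tendsto (fun n => h.pairing (z n)) atTop (𝓝 c)) : PairsTo T z c := by
  intro κ v' w' a' b' h'
  rw [h.pairing_eq_pairing h'] at hc
  exact ⟨_, fun n => h'.hasSum_pairing (z n), hc⟩

theorem PairsTo.tendsto {ι : Type u} {v w : ι → BH H} {z : ℕ → predual H ⊗[ℂ] predual H} {c : ℂ}
    (hc : PairsTo T z c) (h : IsEHSeries v w a b T) :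
    Tendsto (fun n => h.pairing (z n)) atTop (𝓝 c) := by
  obtain ⟨p, hp, ht⟩ := hc _ _ _ _ _ h
  rwa [funext fun n => (hp n).unique (h.hasSum_pairing (z n))] at ht

theorem isEHSeries_mulLeftRight (x y : BH H) :
    IsEHSeries (fun _ : PUnit.{u + 1} => x) (fun _ => y) (x * star x) (star y * y)
      (ContinuousLinearMap.mulLeftRight ℂ (BH H) x y) where
  row _ _ := hasSum_unique _
  col _ _ := hasSum_unique _
  apply _ _ _ := hasSum_unique _

theorem pairing_mulLeftRight (x y : BH H) (z : predual H ⊗[ℂ] predual H) :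
    (isEHSeries_mulLeftRight x y).pairing z = evalPair x y z :=
  ((isEHSeries_mulLeftRight x y).hasSum_pairing z).unique (hasSum_unique _)

theorem norm_evalPair_le (x y : BH H) (hx : ‖x‖ ≤ 1) (hy : ‖y‖ ≤ 1)
    (z : predual H ⊗[ℂ] predual H) : ‖evalPair x y z‖ ≤ hNorm z := by
  rw [← pairing_mulLeftRight]
  refine ((isEHSeries_mulLeftRight x y).norm_pairing_le z).trans
    (mul_le_of_le_one_left (hNorm_nonneg z) ?_)
  have h1 : ‖x * star x‖ ≤ 1 := (norm_mul_le _ _).trans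
    (mul_le_one₀ hx (norm_nonneg _) (by rwa [norm_star]))
  have h2 : ‖star y * y‖ ≤ 1 := (norm_mul_le _ _).trans
    (mul_le_one₀ (by rwa [norm_star]) (norm_nonneg _) hy)
  exact mul_le_one₀ (Real.sqrt_le_one.2 h1) (Real.sqrt_nonneg _) (Real.sqrt_le_one.2 h2)

end Pairing

section Gamma

universe u v

variable {G : Type v} [TopologicalSpace G] [MeasurableSpace G] [T2Space G]
  [LocallyCompactSpace G] [BorelSpace G] [Group G] [IsTopologicalGroup G]
variable {H : Type u} [NormedAddCommGroup H] [InnerProductSpace ℂ H] [CompleteSpace H]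
variable {π : G →* unitary (BH H)}

theorem norm_evalPair_rep_le (s : G) (z : predual H ⊗[ℂ] predual H) :
    ‖evalPair (π s : BH H) (star (π s : BH H)) z‖ ≤ hNorm z :=
  norm_evalPair_le _ _ (norm_rep_le π s) (by rw [star_rep]; exact norm_rep_le π s⁻¹) z

variable (hπ : ∀ ξ : H, Continuous fun s => (π s : BH H) ξ)
include hπ

theorem continuous_evalPair (z : predual H ⊗[ℂ] predual H) :
    Continuous fun s => evalPair (π s : BH H) (star (π s : BH H)) z := by
  obtain ⟨n, ω, ν, rfl⟩ := TensorProduct.exists_sum_tmul_eq z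
  simp only [map_sum]
  refine continuous_finsetSum _ fun k _ => ?_
  exact (continuous_predual_apply hπ (norm_rep_le π) (ω k).2).mul
    (continuous_predual_apply (continuous_star_rep hπ)
      (fun s => by rw [star_rep]; exact norm_rep_le π s⁻¹) (ν k).2)

theorem pairing_conjIntegral (μ : MG G) {ι : Type*} {v w : ι → BH H} {a b : BH H}
    (h : IsEHSeries v w a b (conjIntegral hπ μ)) (z : predual H ⊗[ℂ] predual H) :
    h.pairing z = cintegral (μ : ComplexMeasure G) fun s =>
      evalPair (π s : BH H) (star (π s : BH H)) z := by
  let L : predual H ⊗[ℂ] predual H →ₗ[ℂ] ℂ :=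
    { toFun := fun z => cintegral (μ : ComplexMeasure G) fun s =>
        evalPair (π s : BH H) (star (π s : BH H)) z
      map_add' := fun z z' => by
        simp only [map_add]
        exact VectorMeasure.integral_fun_add
          (integrable_variation μ (continuous_evalPair hπ z) fun s => norm_evalPair_rep_le s z)
          (integrable_variation μ (continuous_evalPair hπ z') fun s => norm_evalPair_rep_le s z')
      map_smul' := fun c z => by
        simp only [map_smul, smul_eq_mul, RingHom.id_apply]
        obtain ⟨k, hm, h1, hμ⟩ := exists_polar μ
        rw [hμ, hμ, ← integral_const_mul]
        simp only [mul_assoc] }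
  refine LinearMap.congr_fun (h.pairing_eq (L := L) (K := mnorm μ) (fun ω ν => ?_)
    fun ξ η ζ θ => ?_) z
  · refine (norm_cintegral_le μ fun s => norm_evalPair_rep_le s _).trans ?_
    rw [mul_assoc, mul_comm]
    exact mul_le_mul_of_nonneg_left (hNorm_tmul_le ω ν) (mnorm_nonneg μ)
  · refine Eq.trans ?_ (predual_conjIntegral hπ μ (rankOne ξ θ) (vectorFunctional_mem ζ η)).symm
    change cintegral _ _ = cintegral _ _
    congr 1
    ext s
    have e : ((π s : BH H) * rankOne ξ θ * star (π s : BH H)) ζ =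
        (inner ℂ θ ((star (π s : BH H)) ζ) : ℂ) • (π s : BH H) ξ := by
      change (π s : BH H) ((inner ℂ θ ((star (π s : BH H)) ζ) : ℂ) • ξ) = _
      rw [map_smul]
    rw [vectorFunctional_apply, e, inner_smul_right, mul_comm]
    rfl

theorem isGamma_conjIntegral (μ : MG G) : IsGamma π μ (conjIntegral hπ μ) := by
  obtain ⟨I, v, w, a, b, hs, -⟩ := exists_series_conjIntegral hπ μ
  refine ⟨hs.mem_extHaagerup (fun _ => mem_univ _) fun _ => mem_univ _, fun z hz => ?_⟩
  let F : ℕ → G → ℂ := fun n s => evalPair (π s : BH H) (star (π s : BH H)) (z n)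
  have hF : ∀ m n s, dist (F m s) (F n s) ≤ hNorm (z m - z n) := fun m n s => by
    rw [dist_eq_norm, ← map_sub]
    exact norm_evalPair_rep_le s _
  have hcau : UniformCauchySeqOn F atTop univ := by
    refine Metric.uniformCauchySeqOn_iff.2 fun ε hε => ?_
    obtain ⟨N, hN⟩ := hz ε hε
    exact ⟨N, fun m hm n hn s _ => (hF m n s).trans_lt (hN m hm n hn)⟩
  choose f hf using fun s => cauchySeq_tendsto_of_complete (hcau.cauchySeq (mem_univ s))
  have hunif : TendstoUniformly F f atTop :=
    tendstoUniformlyOn_univ.1 (hcau.tendstoUniformlyOn_of_tendsto fun s _ => hf s)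
  have hFc : ∀ n, Continuous (F n) := fun n => continuous_evalPair hπ (z n)
  have hFb : ∀ n s, ‖F n s‖ ≤ hNorm (z n) := fun n s => norm_evalPair_rep_le s (z n)
  have hfc : Continuous f := hunif.continuous (Frequently.of_forall hFc)
  obtain ⟨N, hN⟩ := eventually_atTop.1 (Metric.tendstoUniformly_iff.1 hunif 1 one_pos)
  have hfb : ∀ s, ‖f s‖ ≤ 1 + hNorm (z N) := fun s => by
    have h1 := (hN N le_rfl s).le
    rw [dist_eq_norm] at h1
    have h2 := norm_add_le (f s - F N s) (F N s)
    rw [sub_add_cancel] at h2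
    linarith [hFb N s]
  refine ⟨f, fun s => (isEHSeries_mulLeftRight _ _).pairsTo ?_,
    integrable_variation μ hfc hfb, hs.pairsTo ?_⟩
  · simp only [pairing_mulLeftRight]
    exact hf s
  · simp only [pairing_conjIntegral hπ μ hs]
    refine Metric.tendsto_atTop.2 fun ε hε => ?_
    have hm := mnorm_nonneg μ
    obtain ⟨M, hM⟩ := eventually_atTop.1
      (Metric.tendstoUniformly_iff.1 hunif (ε / (mnorm μ + 1)) (by positivity))
    refine ⟨M, fun n hn => ?_⟩
    rw [dist_eq_norm, ← cintegral_sub (hFc n) hfc (hFb n) hfb]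
    calc _ ≤ ε / (mnorm μ + 1) * mnorm μ := norm_cintegral_le μ fun s => by
          rw [← dist_eq_norm, dist_comm]; exact (hM n hn s).le
      _ < ε / (mnorm μ + 1) * (mnorm μ + 1) := by gcongr; linarith
      _ = ε := by field_simp

theorem isGamma_iff (μ : MG G) (T : BH H →L[ℂ] BH H) :
    IsGamma π μ T ↔ T = conjIntegral hπ μ := by
  refine ⟨fun hT => ?_, fun hT => hT ▸ isGamma_conjIntegral hπ μ⟩
  obtain ⟨⟨ι, v, w, a, b, -, -, h⟩, hz⟩ := hT
  obtain ⟨I, v', w', a', b', h', -⟩ := exists_series_conjIntegral hπ μ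
  refine ext_of_rankOne (fun ω => h.comp_mem_predual) (fun ω => h'.comp_mem_predual)
    fun ξ θ ζ η => ?_
  rw [← h.pairing_vectorFunctional, ← h'.pairing_vectorFunctional, pairing_conjIntegral hπ]
  set z₀ : predual H ⊗[ℂ] predual H :=
    ⟨_, vectorFunctional_mem ξ η⟩ ⊗ₜ ⟨_, vectorFunctional_mem ζ θ⟩
  obtain ⟨f, hf, -, hp⟩ := hz (fun _ => z₀) fun ε hε => ⟨0, fun m _ n _ => by
    rwa [sub_self, hNorm_zero]⟩
  have h1 := tendsto_nhds_unique tendsto_const_nhds (hp.tendsto h)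
  rw [h1]
  congr 1
  ext s
  have h2 := tendsto_nhds_unique tendsto_const_nhds
    ((hf s).tendsto (isEHSeries_mulLeftRight _ _))
  rw [← h2, pairing_mulLeftRight]

end Gamma

section Nuclear

universe u

variable {H : Type u} [NormedAddCommGroup H] [InnerProductSpace ℂ H] [CompleteSpace H]

theorem exists_balanced_smul {V W : Submodule ℂ (BH H)} {x y : BH H} (hx : x ∈ V) (hy : y ∈ W) :
    ∃ x' ∈ V, ∃ y' ∈ W, ‖x'‖ ^ 2 = ‖x‖ * ‖y‖ ∧ ‖y'‖ ^ 2 = ‖x‖ * ‖y‖ ∧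
      ∀ z, x' * z * y' = x * z * y := by
  rcases eq_or_ne x 0 with rfl | hx0
  · exact ⟨0, V.zero_mem, 0, W.zero_mem, by simp, by simp, by simp⟩
  rcases eq_or_ne y 0 with rfl | hy0
  · exact ⟨0, V.zero_mem, 0, W.zero_mem, by simp, by simp, by simp⟩
  have hxn : 0 < ‖x‖ := norm_pos_iff.2 hx0
  have hyn : 0 < ‖y‖ := norm_pos_iff.2 hy0
  set t : ℝ := √(‖y‖ / ‖x‖)
  have ht : 0 < t := Real.sqrt_pos.2 (by positivity)
  have ht2 : t ^ 2 = ‖y‖ / ‖x‖ := Real.sq_sqrt (by positivity)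
  refine ⟨(t : ℂ) • x, V.smul_mem _ hx, (t : ℂ)⁻¹ • y, W.smul_mem _ hy, ?_, ?_, fun z => ?_⟩
  · rw [norm_smul, Complex.norm_real, Real.norm_of_nonneg ht.le, mul_pow, ht2]
    field_simp
  · rw [norm_smul, norm_inv, Complex.norm_real, Real.norm_of_nonneg ht.le, mul_pow, inv_pow, ht2]
    field_simp
  · have : (t : ℂ) ≠ 0 := by exact_mod_cast ht.ne'
    rw [smul_mul_assoc, smul_mul_assoc, mul_smul_comm, smul_smul, mul_inv_cancel₀ this, one_smul]

/-- A series with `∑ ‖xⱼ‖ ‖yⱼ‖ < ∞` defines an element of the Haagerup tensor product. -/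
theorem mem_haagerup_of_summable {V W : Submodule ℂ (BH H)} {J : Type*} [Countable J]
    {x y : J → BH H} (hx : ∀ j, x j ∈ V) (hy : ∀ j, y j ∈ W)
    (hs : Summable fun j => ‖x j‖ * ‖y j‖) {T : BH H →L[ℂ] BH H}
    (hT : ∀ z, HasSum (fun j => x j * z * y j) (T z)) :
    T ∈ haagerup (V : Set (BH H)) (W : Set (BH H)) := by
  choose x' hx' y' hy' hxn hyn hz using fun j => exists_balanced_smul (hx j) (hy j)
  obtain ⟨f, hf⟩ := Countable.exists_injective_nat J
  let v : ℕ → BH H := Function.extend f x' 0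
  let w : ℕ → BH H := Function.extend f y' 0
  have hv : ∀ n, (∃ j, f j = n ∧ v n = x' j ∧ w n = y' j) ∨ (v n = 0 ∧ w n = 0) := by
    intro n
    by_cases h : ∃ j, f j = n
    · obtain ⟨j, rfl⟩ := h
      exact Or.inl ⟨j, rfl, hf.extend_apply _ _ _, hf.extend_apply _ _ _⟩
    · exact Or.inr ⟨Function.extend_apply' _ _ _ h, Function.extend_apply' _ _ _ h⟩
  have hext : ∀ (φ : BH H → BH H → BH H) (a : BH H), φ 0 0 = 0 →
      HasSum (fun j => φ (x' j) (y' j)) a → HasSum (fun n => φ (v n) (w n)) a := by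
    intro φ a h0 h
    refine (hf.hasSum_iff fun n hn => ?_).1 (h.congr_fun fun j => ?_)
    · rcases hv n with ⟨j, rfl, -⟩ | ⟨h1, h2⟩
      · exact (hn ⟨j, rfl⟩).elim
      · rw [h1, h2, h0]
    · simp only [Function.comp_apply, v, w, hf.extend_apply]
  have hr : Summable fun j => x' j * star (x' j) := .of_norm_bounded hs fun j => by
    rw [CStarRing.norm_self_mul_star, ← sq, hxn]
  have hc : Summable fun j => star (y' j) * y' j := .of_norm_bounded hs fun j => by
    rw [CStarRing.norm_star_mul_self, ← sq, hyn]
  have hr' := hext (fun a _ => a * star a) _ (by simp) hr.hasSum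
  have hc' := hext (fun _ b => star b * b) _ (by simp) hc.hasSum
  have ha : ∀ z, HasSum (fun n => v n * z * w n) (T z) := fun z =>
    hext (fun a b => a * z * b) _ (by simp) (by simpa only [hz] using hT z)
  refine ⟨v, w, _, _, fun n => ?_, fun n => ?_, hr', hc', fun ω _ => ω.hasSum hr',
    fun ω _ => ω.hasSum hc', fun z ω _ => ω.hasSum (ha z)⟩
  · rcases hv n with ⟨j, -, h, -⟩ | ⟨h, -⟩
    · rw [h]; exact hx' j
    · rw [h]; exact V.zero_mem
  · rcases hv n with ⟨j, -, -, h⟩ | ⟨-, h⟩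
    · rw [h]; exact hy' j
    · rw [h]; exact W.zero_mem

end Nuclear

section Discrete

universe u v

variable {G : Type v} [TopologicalSpace G] [MeasurableSpace G] [T2Space G]
  [LocallyCompactSpace G] [BorelSpace G]

theorem zero_mem_ell1 : (0 : MG G) ∈ ell1 G :=
  ⟨0, by simp, fun E _ => by simp⟩

theorem add_mem_ell1 {μ ν : MG G} (hμ : μ ∈ ell1 G) (hν : ν ∈ ell1 G) : μ + ν ∈ ell1 G := by
  classical
  obtain ⟨α, hα, h⟩ := hμ
  obtain ⟨β, hβ, h'⟩ := hν
  refine ⟨α + β, .of_nonneg_of_le (fun _ => norm_nonneg _) (fun s => norm_add_le (α s) (β s))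
    (hα.add hβ), fun E hE => ?_⟩
  refine ((h E hE).add (h' E hE)).congr_fun fun s => ?_
  by_cases hs : s ∈ E <;> simp [hs]

theorem smul_mem_ell1 (c : ℂ) {μ : MG G} (hμ : μ ∈ ell1 G) : c • μ ∈ ell1 G := by
  classical
  obtain ⟨α, hα, h⟩ := hμ
  refine ⟨c • α, by simpa [norm_smul] using hα.mul_left ‖c‖, fun E hE => ?_⟩
  refine ((h E hE).mul_left c).congr_fun fun s => ?_
  by_cases hs : s ∈ E <;> simp [hs]

theorem exists_hasSum_cintegral_of_ell1 {μ : MG G} (hμ : μ ∈ ell1 G) :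
    ∃ α : G → ℂ, Summable (fun s => ‖α s‖) ∧ ∀ f : G → ℂ, Continuous f →
      (∃ C, ∀ s, ‖f s‖ ≤ C) →
      HasSum (fun s => α s * f s) (cintegral (μ : ComplexMeasure G) f) := by
  classical
  obtain ⟨α, hα, hE⟩ := hμ
  refine ⟨α, hα, fun f hf ⟨C, hC⟩ => ?_⟩
  obtain ⟨h, hm, h1, hd⟩ := exists_unimodular_density (μ : ComplexMeasure G)
  set lam := (μ : ComplexMeasure G).variation with hlam
  have hh : Integrable h lam := .of_bound hm.aestronglyMeasurable 1 (.of_forall fun x => (h1 x).le)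
  have hfi : Integrable f lam := integrable_of_continuous lam hf hC
  have hint : Integrable (fun x => f x * h x) lam := by
    have := hfi.smul_bounded hm.aestronglyMeasurable fun s => (h1 s).le
    simpa only [smul_eq_mul] using this
  have hval : cintegral (μ : ComplexMeasure G) f = ∫ x, f x * h x ∂lam := by
    obtain ⟨h', hm', h1', hμ'⟩ := exists_polar μ
    have e : lam.withDensity (fun x => ‖h x‖ₑ) = lam := by
      have : ∀ x, ‖h x‖ₑ = 1 := fun x => by rw [← ofReal_norm, h1]; simp
      simp [this]
    have := cintegral_withDensity (f := f) hh (by rwa [e])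
    rw [← this, ← hd, cintegral]
  let S : Set G := Function.support α
  have hSc : S.Countable := by
    have := hα.countable_support
    simpa [Function.support, S] using this
  have hSm : MeasurableSet S := hSc.measurableSet
  have h0 : lam Sᶜ = 0 := by
    refine (VectorMeasure.variation_apply_eq_zero hSm.compl).2 fun E hES hEm => ?_
    refine (hE E hEm).unique ?_
    convert hasSum_zero with s
    by_cases hs : s ∈ E
    · rw [if_pos hs]
      by_contra hne
      exact hES hs hne
    · rw [if_neg hs]
  have hsing : ∀ s, lam.real {s} • h s = α s := by
    intro s
    have e1 : (μ : ComplexMeasure G) {s} = α s := by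
      refine (hE {s} (measurableSet_singleton s)).unique ?_
      convert hasSum_ite_eq s (α s) using 2 with t
      by_cases hts : t = s <;> simp [hts]
    rw [← e1, hd, withDensityᵥ_apply hh (measurableSet_singleton s), integral_singleton]
  have hS := hSc.to_subtype
  have key := hasSum_integral_iUnion (μ := lam) (f := fun x => f x * h x)
    (s := fun s : S => {(s : G)}) (fun s => measurableSet_singleton _)
    (fun s t hst => by simpa [Function.onFun, Subtype.ext_iff] using hst) hint.integrableOn
  have hU : ⋃ s : S, {(s : G)} = S := by ext; simp
  rw [hU, setIntegral_eq_integral_of_ae_compl_eq_zero] at key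
  · rw [hval]
    refine (hasSum_subtype_iff_of_support_subset (s := S) fun s hs hs' => ?_).1
      (key.congr_fun fun s => ?_)
    · exact hs (by simp [show α s = 0 by simpa [S] using hs'])
    · rw [Function.comp_apply, integral_singleton, ← hsing, Complex.real_smul, Complex.real_smul]
      ring
  · rw [ae_iff]
    refine measure_mono_null (fun s hs => ?_) h0
    simp only [mem_ofPred_eq, Classical.not_imp] at hs
    exact hs.1

end Discrete

section DiscreteRange

universe u v

variable {G : Type v} [TopologicalSpace G] [MeasurableSpace G] [T2Space G]
  [LocallyCompactSpace G] [BorelSpace G] [Group G] [IsTopologicalGroup G]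
variable {H : Type u} [NormedAddCommGroup H] [InnerProductSpace ℂ H] [CompleteSpace H]
variable {π : G →* unitary (BH H)}

variable (π) in
theorem rep_mem_Dstar (s : G) : (π s : BH H) ∈ Dstar π := by
  obtain ⟨ν, hν, h⟩ := exists_dirac s
  exact subset_closure ⟨ν, hν, fun ω _ => (h fun s => ω (π s : BH H)).symm⟩

variable (hπ : ∀ ξ : H, Continuous fun s => (π s : BH H) ξ)
include hπ

theorem exists_submodule_eq_Dstar : ∃ D : Submodule ℂ (BH H), (D : Set (BH H)) = Dstar π := by
  have hc : ∀ ω ∈ predual H, Continuous fun s => ω (π s : BH H) := fun ω h =>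
    continuous_predual_apply hπ (norm_rep_le π) h
  have hb : ∀ (ω : StrongDual ℂ (BH H)) (s : G), ‖ω (π s : BH H)‖ ≤ ‖ω‖ * 1 := fun ω s =>
    ω.le_opNorm_of_le (norm_rep_le π s)
  let D : Submodule ℂ (BH H) :=
    { carrier := {A | ∃ μ ∈ ell1 G, IsPi1 π μ A}
      zero_mem' := ⟨0, zero_mem_ell1, fun ω h => by
        have := cintegral_smul_measure 0 (0 : MG G) (hc ω h) (hb ω)
        rw [smul_zero, zero_mul] at this
        rw [map_zero, this]⟩
      add_mem' := by
        rintro A B ⟨μ, hμ, hA⟩ ⟨ν, hν, hB⟩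
        exact ⟨μ + ν, add_mem_ell1 hμ hν, fun ω h => by
          rw [map_add, hA ω h, hB ω h, cintegral_add_measure μ ν (hc ω h) (hb ω)]⟩
      smul_mem' := by
        rintro c A ⟨μ, hμ, hA⟩
        exact ⟨c • μ, smul_mem_ell1 c hμ, fun ω h => by
          rw [map_smul, hA ω h, cintegral_smul_measure c μ (hc ω h) (hb ω), smul_eq_mul]⟩ }
  exact ⟨D.topologicalClosure, rfl⟩

theorem conjIntegral_mem_haagerup_of_ell1 {μ : MG G} (hμ : μ ∈ ell1 G) :
    conjIntegral hπ μ ∈ haagerup (Dstar π) (Dstar π) := by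
  obtain ⟨D, hD⟩ := exists_submodule_eq_Dstar hπ
  have hmem : ∀ s, (π s : BH H) ∈ D := fun s => by
    rw [← SetLike.mem_coe, hD]; exact rep_mem_Dstar π s
  obtain ⟨α, hα, hsum⟩ := exists_hasSum_cintegral_of_ell1 hμ
  have hc : Countable (Function.support α) := by
    have := hα.countable_support
    exact (show (Function.support α).Countable by simpa [Function.support] using this).to_subtype
  rw [← hD]
  have hs : ∀ z : BH H, Summable fun s => α s • ((π s : BH H) * z * star (π s : BH H)) := fun z =>
    .of_norm_bounded (hα.mul_right ‖z‖) fun s => by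
      rw [norm_smul]
      exact mul_le_mul_of_nonneg_left (norm_conj_le π s z) (norm_nonneg _)
  refine mem_haagerup_of_summable (J := Function.support α) (x := fun s => α s • (π s : BH H))
    (y := fun s => star (π s : BH H)) (fun s => D.smul_mem _ (hmem s))
    (fun s => by simp only [star_rep]; exact hmem _) ?_ fun z => ?_
  · refine .of_nonneg_of_le (fun _ => by positivity) (fun s => ?_) (hα.subtype (Function.support α))
    rw [norm_smul, Function.comp_apply, mul_assoc]
    refine mul_le_of_le_one_right (norm_nonneg _) (mul_le_one₀ (norm_rep_le π _) (norm_nonneg _) ?_)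
    rw [star_rep]; exact norm_rep_le π _
  · have h1 : conjIntegral hπ μ z = ∑' s, α s • ((π s : BH H) * z * star (π s : BH H)) := by
      refine eq_of_predual fun ω hω => ?_
      rw [predual_conjIntegral hπ μ z hω]
      refine (hsum _ (continuous_predual_apply (continuous_conj hπ z)
        (fun s => norm_conj_le π s z) hω) ⟨‖ω‖ * ‖z‖,
        fun s => ω.le_opNorm_of_le (norm_conj_le π s z)⟩).unique ?_
      exact (ω.hasSum (hs z).hasSum).congr_fun fun s => by
        rw [map_smul, smul_eq_mul]
    rw [h1]
    refine ((hasSum_subtype_iff_of_support_subset (s := Function.support α) fun s hs' => ?_).2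
      (hs z).hasSum).congr_fun fun s => ?_
    · intro h0
      exact hs' (by simp [h0])
    · simp only [Function.comp_apply, smul_mul_assoc]

end DiscreteRange

section Telescoping

universe u

variable {H : Type u} [NormedAddCommGroup H] [InnerProductSpace ℂ H] [CompleteSpace H]
variable {X : Type*} [MeasurableSpace X]

theorem hasSum_setIntegral_fiber {J E : Type*} [Countable J] [MeasurableSpace J]
    [MeasurableSingletonClass J] [NormedAddCommGroup E] [NormedSpace ℝ E] {lam : Measure X}
    {κ : X → J} (hκ : Measurable κ) {f : X → E} (hf : Integrable f lam) :
    HasSum (fun p => ∫ s in κ ⁻¹' {p}, f s ∂lam) (∫ s, f s ∂lam) := by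
  have := hasSum_integral_iUnion (μ := lam) (f := f) (s := fun p => κ ⁻¹' {p})
    (fun p => hκ (measurableSet_singleton p))
    (fun p q hpq => Disjoint.preimage κ (by simpa using hpq)) hf.integrableOn
  rwa [← preimage_iUnion, iUnion_of_singleton, preimage_univ, setIntegral_univ] at this

theorem norm_mul_mul_star_le (x z y : BH H) {r t : ℝ} (hx : ‖x‖ ≤ r) (hy : ‖y‖ ≤ t) (hr : 0 ≤ r) :
    ‖x * z * star y‖ ≤ r * ‖z‖ * t := by
  refine (norm_mul_le _ _).trans ?_
  rw [norm_star]
  exact mul_le_mul ((norm_mul_le _ _).trans (by gcongr)) hy (norm_nonneg _) (by positivity)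

set_option maxHeartbeats 800000 in
/-- If `P` is approximated by countably valued functions `s ↦ D (k n s)` at a geometric rate, then
`∫ h(s) P(s) ⊗ P(s)* dλ(s)` belongs to the Haagerup tensor product. -/
theorem mem_haagerup_of_approx {lam : Measure X} [IsFiniteMeasure lam] {V W : Submodule ℂ (BH H)}
    {h : X → ℂ} (hm : Measurable h) (h1 : ∀ s, ‖h s‖ = 1) {P : X → BH H} {D : ℕ → BH H}
    (hDV : ∀ k, D k ∈ V) (hDW : ∀ k, star (D k) ∈ W) (hD1 : ∀ k, ‖D k‖ ≤ 1) (hD0 : D 0 = 0)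
    {k : ℕ → X → ℕ} (hk : ∀ n, Measurable (k n)) (hk0 : ∀ s, k 0 s = 0) {A : Set X}
    (hA : lam Aᶜ = 0) (hkA : ∀ s ∈ A, ∀ n, ‖P s - D (k n s)‖ ≤ (1 / 2) ^ n)
    {T : BH H →L[ℂ] BH H} (hT : ∀ z, T z = ∫ s, h s • (P s * z * star (P s)) ∂lam) :
    T ∈ haagerup (V : Set (BH H)) (W : Set (BH H)) := by
  let κ : ℕ → X → ℕ × ℕ := fun n s => (k n s, k (n + 1) s)
  have hκ : ∀ n, Measurable (κ n) := fun n => (hk n).prodMk (hk (n + 1))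
  let c : ℕ × (ℕ × ℕ) → ℂ := fun q => ∫ s in κ q.1 ⁻¹' {q.2}, h s ∂lam
  let B : ℕ × (ℕ × ℕ) → ℝ := fun q => lam.real (κ q.1 ⁻¹' {q.2}) * (2 * (1 / 2) ^ q.1)
  have hAae : ∀ᵐ s ∂lam, s ∈ A := hA
  have hdiffA : ∀ s ∈ A, ∀ n, ‖D (k (n + 1) s) - D (k n s)‖ ≤ 2 * (1 / 2) ^ n := by
    intro s hs n
    have e : D (k (n + 1) s) - D (k n s) = (P s - D (k n s)) - (P s - D (k (n + 1) s)) := by abel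
    rw [e]
    refine (norm_sub_le _ _).trans ?_
    have := hkA s hs n
    have h2 := hkA s hs (n + 1)
    have h3 : ((1 : ℝ) / 2) ^ (n + 1) ≤ (1 / 2) ^ n :=
      pow_le_pow_of_le_one (by norm_num) (by norm_num) n.le_succ
    linarith
  have hcB : ∀ q, ‖c q‖ * ‖D q.2.2 - D q.2.1‖ ≤ B q := by
    intro q
    have hc : ‖c q‖ ≤ lam.real (κ q.1 ⁻¹' {q.2}) := by
      refine (norm_setIntegral_le_of_norm_le_const (measure_lt_top _ _)
        (fun s _ => (h1 s).le)).trans_eq (one_mul _)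
    rcases (κ q.1 ⁻¹' {q.2} ∩ A).eq_empty_or_nonempty with he | ⟨s, hs, hsA⟩
    · have h0 : lam.real (κ q.1 ⁻¹' {q.2}) = 0 := by
        rw [measureReal_def, measure_mono_null (fun s hs hsA => ?_) hA, ENNReal.toReal_zero]
        exact (he ▸ (⟨hs, hsA⟩ : s ∈ κ q.1 ⁻¹' {q.2} ∩ A) : s ∈ (∅ : Set X))
      have : ‖c q‖ = 0 := le_antisymm (hc.trans_eq h0) (norm_nonneg _)
      simp only [B, this, h0, zero_mul, le_refl]
    · refine mul_le_mul hc ?_ (norm_nonneg _) measureReal_nonneg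
      have hs' : (k q.1 s, k (q.1 + 1) s) = q.2 := hs
      rw [← hs']
      exact hdiffA s hsA q.1
  have hfib : ∀ n, HasSum (fun p => lam.real (κ n ⁻¹' {p})) (lam.real univ) := by
    intro n
    have := hasSum_setIntegral_fiber (lam := lam) (hκ n) (integrable_const (1 : ℝ))
    simpa using this
  have hgeo : Summable fun n : ℕ => (2 * (1 / 2 : ℝ) ^ n) :=
    (summable_geometric_of_lt_one (by norm_num) (by norm_num)).mul_left 2
  have hB : Summable B := by
    have hBn : ∀ n, HasSum (fun p => B (n, p)) (lam.real univ * (2 * (1 / 2) ^ n)) := fun n =>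
      (hfib n).mul_right (2 * (1 / 2) ^ n)
    refine (summable_prod_of_nonneg fun q => mul_nonneg measureReal_nonneg (by positivity)).2
      ⟨fun n => (hBn n).summable, ?_⟩
    have e : (fun n => ∑' p, B (n, p)) = fun n => lam.real univ * (2 * (1 / 2) ^ n) :=
      funext fun n => (hBn n).tsum_eq
    change Summable fun n => ∑' p, B (n, p)
    rw [e]
    exact hgeo.mul_left _
  let x : (ℕ × (ℕ × ℕ)) ⊕ (ℕ × (ℕ × ℕ)) → BH H :=
    Sum.elim (fun q => c q • (D q.2.2 - D q.2.1)) (fun q => c q • D q.2.1)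
  let y : (ℕ × (ℕ × ℕ)) ⊕ (ℕ × (ℕ × ℕ)) → BH H :=
    Sum.elim (fun q => star (D q.2.2)) (fun q => star (D q.2.2 - D q.2.1))
  have hn1 : ∀ q, ‖x (Sum.inl q)‖ * ‖y (Sum.inl q)‖ ≤ B q := fun q => by
    simp only [x, y, Sum.elim_inl, norm_smul, norm_star]
    exact (mul_le_of_le_one_right (by positivity) (hD1 _)).trans (hcB q)
  have hn2 : ∀ q, ‖x (Sum.inr q)‖ * ‖y (Sum.inr q)‖ ≤ B q := fun q => by
    simp only [x, y, Sum.elim_inr, norm_smul, norm_star]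
    rw [mul_right_comm]
    exact (mul_le_of_le_one_right (by positivity) (hD1 _)).trans (hcB q)
  have hxyz : ∀ z j, ‖x j * z * y j‖ ≤ ‖x j‖ * ‖y j‖ * ‖z‖ := fun z j => by
    rw [mul_right_comm]
    exact (norm_mul_le _ _).trans (by gcongr; exact norm_mul_le _ _)
  refine mem_haagerup_of_summable (x := x) (y := y) ?_ ?_ ?_ fun z => ?_
  · rintro (q | q)
    · exact V.smul_mem _ (V.sub_mem (hDV _) (hDV _))
    · exact V.smul_mem _ (hDV _)
  · rintro (q | q)
    · exact hDW _
    · simp only [y, Sum.elim_inr, star_sub]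
      exact W.sub_mem (hDW _) (hDW _)
  · exact Summable.sum _ (.of_nonneg_of_le (fun _ => mul_nonneg (norm_nonneg _) (norm_nonneg _)) hn1 hB)
      (.of_nonneg_of_le (fun _ => mul_nonneg (norm_nonneg _) (norm_nonneg _)) hn2 hB)
  have hs1 : Summable fun q => x (Sum.inl q) * z * y (Sum.inl q) :=
    .of_norm_bounded (hB.mul_right ‖z‖) fun q => (hxyz z _).trans (by gcongr; exact hn1 q)
  have hs2 : Summable fun q => x (Sum.inr q) * z * y (Sum.inr q) :=
    .of_norm_bounded (hB.mul_right ‖z‖) fun q => (hxyz z _).trans (by gcongr; exact hn2 q)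
  let Δ : ℕ × ℕ → BH H := fun p => D p.2 * z * star (D p.2) - D p.1 * z * star (D p.1)
  have hΔ : ∀ q, x (Sum.inl q) * z * y (Sum.inl q) + x (Sum.inr q) * z * y (Sum.inr q) =
      c q • Δ q.2 := fun q => by
    simp only [x, y, Δ, Sum.elim_inl, Sum.elim_inr, smul_mul_assoc, smul_sub, star_sub, sub_mul,
      mul_sub]
    abel
  have hint : ∀ n, Integrable (fun s => h s • Δ (κ n s)) lam := fun n => by
    refine .of_bound (hm.aestronglyMeasurable.smul
      ((StronglyMeasurable.of_discrete (f := Δ)).comp_measurable (hκ n)).aestronglyMeasurable)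
      (1 * ‖z‖ * 1 + 1 * ‖z‖ * 1) (.of_forall fun s => ?_)
    rw [norm_smul, h1, one_mul]
    exact (norm_sub_le _ _).trans (add_le_add
      (norm_mul_mul_star_le _ _ _ (hD1 _) (hD1 _) zero_le_one)
      (norm_mul_mul_star_le _ _ _ (hD1 _) (hD1 _) zero_le_one))
  have hinner : ∀ n, HasSum (fun p => c (n, p) • Δ p) (∫ s, h s • Δ (κ n s) ∂lam) := by
    intro n
    refine (hasSum_setIntegral_fiber (hκ n) (hint n)).congr_fun fun p => ?_
    rw [← integral_smul_const]
    refine setIntegral_congr_fun ((hκ n) (measurableSet_singleton p)) fun s hs => ?_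
    have : κ n s = p := hs
    simp only [this]
  have hΔA : ∀ s ∈ A, ∀ n, ‖Δ (κ n s)‖ ≤ 2 * (1 / 2) ^ n * (2 * ‖z‖) := by
    intro s hs n
    have e : Δ (κ n s) = (D (k (n + 1) s) - D (k n s)) * z * star (D (k (n + 1) s)) +
        D (k n s) * z * star (D (k (n + 1) s) - D (k n s)) := by
      simp only [Δ, κ, star_sub, sub_mul, mul_sub]
      abel
    rw [e]
    refine (norm_add_le _ _).trans ((add_le_add
      (norm_mul_mul_star_le _ _ _ (hdiffA s hs n) (hD1 _) (by positivity))
      (norm_mul_mul_star_le _ _ _ (hD1 _) (hdiffA s hs n) zero_le_one)).trans_eq ?_)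
    ring
  have houter : HasSum (fun n => ∫ s, h s • Δ (κ n s) ∂lam) (T z) := by
    have h3 := hasSum_integral_of_summable_integral_norm hint (by
      refine .of_nonneg_of_le (fun n => by positivity) (fun n => ?_)
        ((hgeo.mul_right (2 * ‖z‖)).mul_left (lam.real univ))
      refine (integral_mono_ae (hint n).norm (integrable_const (2 * (1 / 2) ^ n * (2 * ‖z‖)))
        ?_).trans_eq (by rw [integral_const, smul_eq_mul])
      filter_upwards [hAae] with s hs
      rw [norm_smul, h1, one_mul]
      exact hΔA s hs n)
    refine (?_ : T z = _) ▸ h3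
    rw [hT]
    refine integral_congr_ae ?_
    filter_upwards [hAae] with s hs
    have h4 : Summable fun n => Δ (κ n s) :=
      .of_norm_bounded (hgeo.mul_right (2 * ‖z‖)) (hΔA s hs)
    have h5 : Tendsto (fun n => D (k n s)) atTop (𝓝 (P s)) := by
      refine tendsto_iff_norm_sub_tendsto_zero.2 (squeeze_zero (fun _ => norm_nonneg _) (fun n => ?_)
        (tendsto_pow_atTop_nhds_zero_of_lt_one (r := (1 / 2 : ℝ)) (by norm_num) (by norm_num)))
      rw [norm_sub_rev]
      exact hkA s hs n
    have h6 : HasSum (fun n => Δ (κ n s)) (P s * z * star (P s)) := by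
      refine h4.hasSum_iff_tendsto_nat.2 ?_
      have e : ∀ N, ∑ n ∈ Finset.range N, Δ (κ n s) = D (k N s) * z * star (D (k N s)) := by
        intro N
        have := Finset.sum_range_sub (fun n => D (k n s) * z * star (D (k n s))) N
        refine this.trans ?_
        simp only [hk0, hD0, zero_mul, sub_zero]
      simp only [e]
      exact (h5.mul_const z).mul h5.star
    exact ((h6.const_smul (h s)).tsum_eq).symm
  refine (?_ : T z = ∑' q, x (Sum.inl q) * z * y (Sum.inl q) +
    ∑' q, x (Sum.inr q) * z * y (Sum.inr q)) ▸ HasSum.sum hs1.hasSum hs2.hasSum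
  have h7 := hs1.hasSum.add hs2.hasSum
  simp only [hΔ] at h7
  exact houter.unique (h7.prod_fiberwise hinner)

end Telescoping

section NormContinuous

universe u v

variable {G : Type v} [TopologicalSpace G] [MeasurableSpace G] [T2Space G]
  [LocallyCompactSpace G] [BorelSpace G] [Group G] [IsTopologicalGroup G]
variable {H : Type u} [NormedAddCommGroup H] [InnerProductSpace ℂ H] [CompleteSpace H]
variable {π : G →* unitary (BH H)}

/-- A norm continuous representation has separable range up to a null set. -/
theorem exists_dense_sequence (hc : Continuous fun s => (π s : BH H)) (lam : Measure G)
    [IsFiniteMeasure lam] [lam.Regular] : ∃ (A : Set G) (t : ℕ → G), MeasurableSet A ∧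
      lam Aᶜ = 0 ∧ ∀ s ∈ A, ∀ ε > 0, ∃ j, ‖(π s : BH H) - π (t j)‖ < ε := by
  obtain ⟨K, hK, h0⟩ := exists_sigmaCompact_full lam
  have hsep : TopologicalSpace.IsSeparable ((fun s => (π s : BH H)) '' ⋃ n, K n) := by
    rw [image_iUnion]
    exact .iUnion fun n => ((hK n).image hc).isSeparable
  obtain ⟨t, hts, htc, hst⟩ := hsep.exists_countable_dense_subset
  obtain ⟨f, hf⟩ := (htc.insert (π 1 : BH H)).exists_eq_range (insert_nonempty _ _)
  have hr : ∀ j, ∃ s : G, (π s : BH H) = f j := fun j => by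
    have : f j ∈ insert (π 1 : BH H) t := hf ▸ mem_range_self j
    rcases this with h | h
    · exact ⟨1, h.symm⟩
    · obtain ⟨s, -, hs⟩ := hts h
      exact ⟨s, hs⟩
  choose g hg using hr
  refine ⟨⋃ n, K n, g, .iUnion fun n => (hK n).measurableSet, h0, fun s hs ε hε => ?_⟩
  obtain ⟨d, hd, hlt⟩ := Metric.mem_closure_iff.1 (hst (mem_image_of_mem _ hs)) ε hε
  obtain ⟨j, rfl⟩ : d ∈ range f := hf ▸ mem_insert_of_mem _ hd
  exact ⟨j, by rwa [hg, ← dist_eq_norm]⟩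

theorem conjIntegral_mem_haagerup_of_continuous
    (hπ : ∀ ξ : H, Continuous fun s => (π s : BH H) ξ) (hc : Continuous fun s => (π s : BH H))
    (μ : MG G) : conjIntegral hπ μ ∈ haagerup (Dstar π) (Dstar π) := by
  classical
  obtain ⟨V, hV⟩ := exists_submodule_eq_Dstar hπ
  have hmem : ∀ s, (π s : BH H) ∈ V := fun s => by
    rw [← SetLike.mem_coe, hV]; exact rep_mem_Dstar π s
  obtain ⟨h, hm, h1, hμ⟩ := exists_polar μ
  set lam := (μ : ComplexMeasure G).variation
  obtain ⟨A, t, hAm, hA, hAt⟩ := exists_dense_sequence hc lam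
  let D : ℕ → BH H := fun j => j.casesOn 0 fun i => (π (t i) : BH H)
  have hex : ∀ (n : ℕ) (s : G), ∃ j, ‖(π s : BH H) - D j‖ < (1 / 2) ^ n ∨ s ∉ A := by
    intro n s
    by_cases hs : s ∈ A
    · obtain ⟨j, hj⟩ := hAt s hs ((1 / 2) ^ n) (by positivity)
      exact ⟨j + 1, Or.inl hj⟩
    · exact ⟨0, Or.inr hs⟩
  let k : ℕ → G → ℕ := fun n s => n.casesOn 0 fun i => Nat.find (hex (i + 1) s)
  rw [← hV]
  refine mem_haagerup_of_approx (lam := lam) hm h1 (P := fun s => (π s : BH H)) (D := D) (k := k)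
    ?_ ?_ ?_ rfl ?_ (fun s => rfl) hA ?_ fun z => ?_
  · rintro (_ | j)
    · exact V.zero_mem
    · exact hmem _
  · rintro (_ | j)
    · simp [D]
    · simp only [D, star_rep]
      exact hmem _
  · rintro (_ | j)
    · simp [D]
    · exact norm_rep_le π _
  · rintro (_ | n)
    · exact measurable_const
    · refine measurable_find (hex (n + 1)) fun j => ?_
      exact ((isOpen_lt (hc.sub continuous_const).norm continuous_const).measurableSet).union
        hAm.compl
  · rintro s hs (_ | n)
    · simpa [k, D] using norm_rep_le π s
    · exact ((Nat.find_spec (hex (n + 1) s)).resolve_right (not_not.2 hs)).le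
  · have hcz : Continuous fun s => (π s : BH H) * z * star (π s : BH H) :=
      (hc.mul continuous_const).mul hc.star
    have hint : Integrable (fun s => h s • ((π s : BH H) * z * star (π s : BH H))) lam :=
      (Integrable.of_bound hm.aestronglyMeasurable 1 (.of_forall fun x => (h1 x).le)).smul_bounded
        (aestronglyMeasurable_of_continuous lam hcz) fun s => norm_conj_le π s z
    refine eq_of_predual fun ω hω => ?_
    rw [predual_conjIntegral hπ μ z hω, hμ, ← ω.integral_comp_comm hint]
    simp only [map_smul, smul_eq_mul, mul_comm]

end NormContinuous

end GroupCB

theorem proposition3p5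
    {G : Type*} [Group G] [TopologicalSpace G] [IsTopologicalGroup G] [T2Space G]
    [LocallyCompactSpace G] [MeasurableSpace G] [BorelSpace G]
    {H : Type*} [NormedAddCommGroup H] [InnerProductSpace ℂ H] [CompleteSpace H]
    (π : G →* unitary (BH H))
    (hπ : ∀ ξ : H, Continuous fun s => (π s : BH H) ξ) :
    (∀ μ : MG G, ∀ ν : MG G, ∃ ρ : MG G, IsConvolution μ ν ρ) ∧
    ∃ Γ : MG G →ₗ[ℂ] (BH H →L[ℂ] BH H),
      (∀ (μ : MG G) (T : BH H →L[ℂ] BH H), IsGamma π μ T ↔ T = Γ μ) ∧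
      (∀ μ : MG G, ehNorm (Γ μ) ≤ mnorm μ) ∧
      (∀ μ ν ρ : MG G, IsConvolution μ ν ρ → Γ ρ = (Γ μ).comp (Γ ν)) ∧
      (∀ μ : MG G, Γ μ ∈ extHaagerup (Mstar π) (Mstar π)) ∧
      (∀ μ ∈ L1 G, Γ μ ∈ extHaagerup (Cstar π) (Cstar π)) ∧
      (∀ μ ∈ ell1 G, Γ μ ∈ haagerup (Dstar π) (Dstar π)) ∧
      ((Continuous fun s => (π s : BH H)) →
        ∀ μ : MG G, Γ μ ∈ haagerup (Dstar π) (Dstar π)) :=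
  ⟨exists_isConvolution, conjIntegral hπ, isGamma_iff hπ, ehNorm_conjIntegral_le hπ,
    fun _ _ _ h => conjIntegral_comp hπ (fun μ _ => comp_conjIntegral_mem_predual hπ μ) h,
    conjIntegral_mem_Mstar hπ, fun _ h => conjIntegral_mem_Cstar hπ h,
    fun _ h => conjIntegral_mem_haagerup_of_ell1 hπ h,
    fun hc μ => conjIntegral_mem_haagerup_of_continuous hπ hc μ⟩
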